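/- Let $(A,\mathfrak m)$ be a Noetherian local ring, $M$ a finitely generated $A$-module and $s\ge 1$ an integer. A *filtration* $F=\{(F)_n\}_{n\ge 0}$ of ideals of $A$ is a chain $A=(F)_0\supsetneq (F)_1\supseteq (F)_2\supseteq\cdots$ with $(F)_m(F)_n\subseteq (F)_{m+n}$ for all $m,n$. An ideal $I$ is a *reduction* of $F$ if $I(F)_n\subseteq (F)_{n+1}$ for all $n\ge 0$ and $(F)_{n+1}=I(F)_n$ for all large $n$; $F$ is *good* if it has a reduction, and *$\mathfrak m$-primary* if $(F)_1$ is an $\mathfrak m$-primary ideal. An ideal $I\ne A$ is identified with the filtration $\{I^n\}_{n\ge 0}$. For filtrations $\mathbf F=F_1,\ldots,F_s$ and $\mathbf n\in\mathbb N^s$ put $\mathbb F_{\mathbf n}=(F_1)_{n_1}\cdots(F_s)_{n_s}$, and set $$\mathfrak R(\mathbf F;A)=\bigoplus_{\mathbf n\ge 0}\mathbb F_{\mathbf n}T^{\mathbf n}\subseteq A[t_1,\ldots,t_s],\qquad \mathfrak R(\mathbf F;A)_+=\bigoplus_{|\mathbf n|>0}\mathbb F_{\mathbf n}T^{\mathbf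 n},\qquad \mathfrak R(\mathbf F;M)=\bigoplus_{\mathbf n\ge 0}\mathbb F_{\mathbf n}M\,T^{\mathbf n}.$$ *Mixed multiplicities.* Let $F$ be an $\mathfrak m$-primary good filtration and $F_1,\ldots,F_s$ good filtrations such that $I=(F_1)_1\cdots(F_s)_1\not\subseteq\sqrt{\mathrm{Ann}\,M}$, and put $q=\dim M/(0:_M I^\infty)$. Let $P(n_0,\mathbf n)$ be the polynomial with rational coefficients that equals $\ell_A\big((F)_{n_0}\mathbb F_{\mathbf n}M/(F)_{n_0+1}\mathbb F_{\mathbf n}M\big)$ for all large $n_0,n_1,\ldots,n_s$. For $k_0\in\mathbb N$ and $\mathbf k\in\mathbb N^s$ with $k_0+|\mathbf k|=q-1$, the mixed multiplicity $e(F^{[k_0+1]},\mathbf F^{[\mathbf k]};M)$ is $k_0!\,k_1!\cdots k_s!$ times the coefficient of $n_0^{k_0}n_1^{k_1}\cdots n_s^{k_s}$ in $P$. *Multiplicity.* For an ideal $\mathfrak a$ of a commutative ring $R$ and an $R$-module $N$ of finite dimension $d$ such that all $\ell_R(N/\mathfrak a^nN)$ are finite, $e(\mathfrak a;N)=\lim_{n\to\infty}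 d!\,\ell_R(N/\mathfrak a^nN)/n^d$. **Theorem.** Let $F$ be an $\mathfrak m$-primary good filtration and $F_1,\ldots,F_s$ good filtrations of ideals in $A$ such that $I=(F_1)_1\cdots(F_s)_1\not\subseteq\sqrt{\mathrm{Ann}\,M}$. Let $J,I_1,\ldots,I_s$ be reductions of $F,F_1,\ldots,F_s$, respectively, and write $\mathbf I=I_1,\ldots,I_s$. Let $\mathfrak I$ be an $\mathfrak m$-primary ideal of $A$. (i) For all $k_0\in\mathbb N$ and $\mathbf k\in\mathbb N^s$ with $k_0+|\mathbf k|=q-1$, where $q=\dim M/(0:_MI^\infty)$, the mixed multiplicities of $M$ of type $(k_0+1,\mathbf k)$ with respect to $F,\mathbf F$ and with respect to $J,\mathbf I$ both exist, and $$e(F^{[k_0+1]},\mathbf F^{[\mathbf k]};M)=e(J^{[k_0+1]},\mathbf I^{[\mathbf k]};M).$$ (ii) If $\mathrm{ht}\,\dfrac{I+\mathrm{Ann}\,M}{\mathrm{Ann}\,M}>0$, then both of the following multiplicities exist, and $$e\big((\mathfrak I,\mathfrak R(\mathbf F;A)_+);\mathfrak R(\mathbf F;M)\big)=e\big((\mathfrak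 I,\mathfrak R(\mathbf I;A)_+);\mathfrak R(\mathbf I;M)\big).$$ -/

import Mathlib

open scoped Nat TensorProduct

namespace MixedMult

/-! ### Filtrations of ideals -/

/-- A filtration of ideals `A = F₀ ⊋ F₁ ⊇ F₂ ⊇ ⋯` with `Fₘ Fₙ ⊆ Fₘ₊ₙ`. -/
@[ext]
structure IdealFiltration (A : Type*) [CommRing A] where
  /-- The `n`-th ideal of the filtration. -/
  ideal : ℕ → Ideal A
  ideal_zero : ideal 0 = ⊤
  ideal_one_ne_top : ideal 1 ≠ ⊤
  antitone : Antitone ideal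
  mul_le : ∀ m n, ideal m * ideal n ≤ ideal (m + n)

/-- The filtration by the powers of a proper ideal. -/
def adic {A : Type*} [CommRing A] (I : Ideal A) (hI : I ≠ ⊤) : IdealFiltration A where
  ideal n := I ^ n
  ideal_zero := by simp
  ideal_one_ne_top := by simpa using hI
  antitone _ _ h := Ideal.pow_le_pow_right h
  mul_le m n := (pow_add I m n).ge

/-- `I` is a reduction of `F` (equivalently, `F` is an `I`-good filtration): `I Fₙ ⊆ Fₙ₊₁` for
all `n`, with equality for all large `n`. -/
def IsReduction {A : Type*} [CommRing A] (I : Ideal A) (F : IdealFiltration A) : Prop :=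
  (∀ n, I * F.ideal n ≤ F.ideal (n + 1)) ∧ ∃ N, ∀ n, N ≤ n → F.ideal (n + 1) = I * F.ideal n

/-- A filtration is good if it is `I`-good for some ideal `I`. -/
def IsGood {A : Type*} [CommRing A] (F : IdealFiltration A) : Prop :=
  ∃ I : Ideal A, IsReduction I F

theorem IsReduction.ne_top {A : Type*} [CommRing A] {I : Ideal A} {F : IdealFiltration A}
    (h : IsReduction I F) : I ≠ ⊤ := by
  rintro rfl
  have h0 := h.1 0
  rw [F.ideal_zero, Ideal.top_mul, top_le_iff] at h0
  exact F.ideal_one_ne_top h0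

/-- `I` is primary to the maximal ideal of the local ring `A`. -/
def IsMPrimary {A : Type*} [CommRing A] [IsLocalRing A] (I : Ideal A) : Prop :=
  I.IsPrimary ∧ I.radical = IsLocalRing.maximalIdeal A

/-- The ideal `(F₁)_{n₁} ⋯ (F_s)_{n_s}`. -/
def prodIdeal {A : Type*} [CommRing A] {s : ℕ} (F : Fin s → IdealFiltration A)
    (n : Fin s → ℕ) : Ideal A :=
  ∏ i, (F i).ideal (n i)

theorem prodIdeal_zero {A : Type*} [CommRing A] {s : ℕ} (F : Fin s → IdealFiltration A) :
    prodIdeal F 0 = ⊤ := by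
  simp [prodIdeal, IdealFiltration.ideal_zero]

theorem prodIdeal_mul_le {A : Type*} [CommRing A] {s : ℕ} (F : Fin s → IdealFiltration A)
    (m n : Fin s → ℕ) : prodIdeal F m * prodIdeal F n ≤ prodIdeal F (m + n) := by
  unfold prodIdeal
  rw [← Finset.prod_mul_distrib]
  exact Finset.prod_le_prod' fun i _ => (F i).mul_le _ _

/-! ### Mixed multiplicities -/

/-- The Bhattacharya function: the length over `A` of
`F_{n₀} 𝔽_n M / F_{n₀+1} 𝔽_n M`, where `𝔽_n = (F₁)_{n₁} ⋯ (F_s)_{n_s}`. -/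
noncomputable def bhattacharya {A : Type*} [CommRing A] {s : ℕ} (F : IdealFiltration A)
    (Fs : Fin s → IdealFiltration A) (M : Type*) [AddCommGroup M] [Module A M]
    (n₀ : ℕ) (n : Fin s → ℕ) : ℕ∞ :=
  Module.length A
    (↥((F.ideal n₀ * prodIdeal Fs n) • (⊤ : Submodule A M)) ⧸
      ((F.ideal (n₀ + 1) * prodIdeal Fs n) • (⊤ : Submodule A M)).submoduleOf
        ((F.ideal n₀ * prodIdeal Fs n) • (⊤ : Submodule A M)))

/-- `P` is the Bhattacharya polynomial: for all large `n₀, n₁, …, n_s` the Bhattacharya function is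
finite and equal to `P(n₀, n₁, …, n_s)`. The variable `0` stands for `n₀`, and the variable `i + 1`
for the entry `i` of `n`. -/
def IsBhattacharyaPolynomial {A : Type*} [CommRing A] {s : ℕ} (F : IdealFiltration A)
    (Fs : Fin s → IdealFiltration A) (M : Type*) [AddCommGroup M] [Module A M]
    (P : MvPolynomial (Fin (s + 1)) ℚ) : Prop :=
  ∃ N : ℕ, ∀ (n₀ : ℕ) (n : Fin s → ℕ), N ≤ n₀ → (∀ i, N ≤ n i) →
    ∃ l : ℕ, bhattacharya F Fs M n₀ n = l ∧
      MvPolynomial.eval (fun j => ((Fin.cons n₀ n : Fin (s + 1) → ℕ) j : ℚ)) P = l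

/-- The Bhattacharya polynomial is unique. -/
theorem IsBhattacharyaPolynomial.unique {A : Type*} [CommRing A] {s : ℕ} {F : IdealFiltration A}
    {Fs : Fin s → IdealFiltration A} {M : Type*} [AddCommGroup M] [Module A M]
    {P P' : MvPolynomial (Fin (s + 1)) ℚ} (h : IsBhattacharyaPolynomial F Fs M P)
    (h' : IsBhattacharyaPolynomial F Fs M P') : P = P' := by
  obtain ⟨N, hN⟩ := h
  obtain ⟨N', hN'⟩ := h'
  have hinf : (((↑) : ℕ → ℚ) '' Set.Ici (max N N')).Infinite :=
    (Set.Ici_infinite _).image Nat.cast_injective.injOn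
  refine MvPolynomial.funext_set (fun _ => ((↑) : ℕ → ℚ) '' Set.Ici (max N N'))
    (fun _ => hinf) fun x hx => ?_
  choose y hy hyx using fun i => hx i (Set.mem_univ i)
  obtain ⟨l, hl, hP⟩ := hN (y 0) (fun i => y i.succ) (le_trans (le_max_left _ _) (hy 0))
    (fun i => le_trans (le_max_left _ _) (hy i.succ))
  obtain ⟨l', hl', hP'⟩ := hN' (y 0) (fun i => y i.succ) (le_trans (le_max_right _ _) (hy 0))
    (fun i => le_trans (le_max_right _ _) (hy i.succ))
  have hll : l = l' := by exact_mod_cast hl.symm.trans hl'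
  have hcons : (Fin.cons (y 0) (fun i => y i.succ) : Fin (s + 1) → ℕ) = y :=
    Fin.cons_self_tail y
  have hx' : x = fun j => ((Fin.cons (y 0) (fun i => y i.succ) : Fin (s + 1) → ℕ) j : ℚ) := by
    rw [hcons]
    exact (funext hyx).symm
  rw [hx', hP, hP', hll]

/-- The submodule `0 :_M I^∞ = ⋃ₙ (0 :_M Iⁿ)` of `M`. -/
def saturation {A : Type*} [CommRing A] (I : Ideal A) (M : Type*) [AddCommGroup M]
    [Module A M] : Submodule A M :=
  ⨆ n : ℕ, Submodule.torsionBySet A M ((I ^ n : Ideal A) : Set A)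

/-- The number `q = dim M / (0 :_M I^∞)`, where `I = (F₁)₁ ⋯ (F_s)₁`. -/
noncomputable def mixedDim {A : Type*} [CommRing A] {s : ℕ}
    (Fs : Fin s → IdealFiltration A) (M : Type*) [AddCommGroup M] [Module A M] : WithBot ℕ∞ :=
  Module.supportDim A (M ⧸ saturation (prodIdeal Fs 1) M)

/-- `e` is the mixed multiplicity `e(F^[k₀+1], F₁^[k₁], …, F_s^[k_s]; M)`: the type satisfies
`k₀ + |k| = q - 1`, and in the Bhattacharya polynomial the coefficient of the monomial
`n₀^{k₀} n₁^{k₁} ⋯ n_s^{k_s}` is `e / (k₀! k₁! ⋯ k_s!)`. -/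
def IsMixedMultiplicity {A : Type*} [CommRing A] {s : ℕ} (F : IdealFiltration A)
    (Fs : Fin s → IdealFiltration A) (M : Type*) [AddCommGroup M] [Module A M]
    (k₀ : ℕ) (k : Fin s → ℕ) (e : ℚ) : Prop :=
  ((k₀ + ∑ i, k i + 1 : ℕ) : WithBot ℕ∞) = mixedDim Fs M ∧
    ∃ P : MvPolynomial (Fin (s + 1)) ℚ, IsBhattacharyaPolynomial F Fs M P ∧
      P.coeff (Finsupp.equivFunOnFinite.symm (Fin.cons k₀ k : Fin (s + 1) → ℕ)) =
        e / ((k₀ ! : ℚ) * ∏ i, ((k i)! : ℚ))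

/-- The mixed multiplicity of a given type is unique. -/
theorem IsMixedMultiplicity.unique {A : Type*} [CommRing A] {s : ℕ} {F : IdealFiltration A}
    {Fs : Fin s → IdealFiltration A} {M : Type*} [AddCommGroup M] [Module A M]
    {k₀ : ℕ} {k : Fin s → ℕ} {e e' : ℚ} (h : IsMixedMultiplicity F Fs M k₀ k e)
    (h' : IsMixedMultiplicity F Fs M k₀ k e') : e = e' := by
  obtain ⟨-, P, hP, hc⟩ := h
  obtain ⟨-, P', hP', hc'⟩ := h'
  rw [hP.unique hP', hc'] at hc
  have h0 : ((k₀ ! : ℚ) * ∏ i, ((k i)! : ℚ)) ≠ 0 :=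
    mul_ne_zero (by positivity) (Finset.prod_ne_zero_iff.mpr fun i _ => by positivity)
  field_simp at hc
  exact hc.symm

/-! ### Multi-Rees algebras and modules -/

/-- The multi-Rees algebra `⨁ₙ 𝔽_n Tⁿ`, as a subalgebra of `A[t₁, …, t_s]`. -/
def multiReesAlgebra {A : Type*} [CommRing A] {s : ℕ} (F : Fin s → IdealFiltration A) :
    Subalgebra A (MvPolynomial (Fin s) A) where
  carrier := {f | ∀ n : Fin s →₀ ℕ, f.coeff n ∈ prodIdeal F n}
  mul_mem' {f g} hf hg n := by
    rw [MvPolynomial.coeff_mul]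
    refine Ideal.sum_mem _ fun x hx => ?_
    rw [← Finset.HasAntidiagonal.mem_antidiagonal.mp hx, Finsupp.coe_add]
    exact prodIdeal_mul_le F _ _ (Ideal.mul_mem_mul (hf _) (hg _))
  add_mem' {f g} hf hg n := by
    rw [MvPolynomial.coeff_add]
    exact Ideal.add_mem _ (hf n) (hg n)
  algebraMap_mem' r n := by
    rw [MvPolynomial.algebraMap_eq, MvPolynomial.coeff_C]
    split_ifs with h
    · subst h
      rw [Finsupp.coe_zero, prodIdeal_zero]
      trivial
    · exact Ideal.zero_mem _

/-- The coefficient of `Tⁿ` of an element of `M[t₁, …, t_s] = A[t₁, …, t_s] ⊗ M`; it sends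
`p ⊗ m` to `(coeff n p) • m`. -/
noncomputable def moduleCoeff {A : Type*} [CommRing A] {s : ℕ} (M : Type*) [AddCommGroup M]
    [Module A M] (n : Fin s →₀ ℕ) : MvPolynomial (Fin s) A ⊗[A] M →ₗ[A] M :=
  (TensorProduct.lid A M).toLinearMap ∘ₗ (MvPolynomial.lcoeff A n).rTensor M

@[simp]
theorem moduleCoeff_tmul {A : Type*} [CommRing A] {s : ℕ} (M : Type*) [AddCommGroup M]
    [Module A M] (n : Fin s →₀ ℕ) (p : MvPolynomial (Fin s) A) (m : M) :
    moduleCoeff M n (p ⊗ₜ[A] m) = p.coeff n • m := by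
  simp [moduleCoeff]

theorem moduleCoeff_smul {A : Type*} [CommRing A] {s : ℕ} (M : Type*) [AddCommGroup M]
    [Module A M] (n : Fin s →₀ ℕ) (f : MvPolynomial (Fin s) A)
    (x : MvPolynomial (Fin s) A ⊗[A] M) :
    moduleCoeff M n (f • x) =
      ∑ ij ∈ Finset.HasAntidiagonal.antidiagonal n, f.coeff ij.1 • moduleCoeff M ij.2 x := by
  induction x with
  | zero => simp
  | tmul p m =>
    rw [TensorProduct.smul_tmul', smul_eq_mul]
    simp only [moduleCoeff_tmul, MvPolynomial.coeff_mul, Finset.sum_smul, mul_smul]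
  | add x y hx hy => simp only [smul_add, map_add, hx, hy, Finset.sum_add_distrib]

/-- The multi-Rees module `⨁ₙ 𝔽_n M Tⁿ`, inside `M[t₁, …, t_s] = A[t₁, …, t_s] ⊗ M`. -/
noncomputable def multiReesModule {A : Type*} [CommRing A] {s : ℕ}
    (F : Fin s → IdealFiltration A) (M : Type*) [AddCommGroup M] [Module A M] :
    Submodule (multiReesAlgebra F) (MvPolynomial (Fin s) A ⊗[A] M) where
  carrier := {x | ∀ n : Fin s →₀ ℕ, moduleCoeff M n x ∈ prodIdeal F n • (⊤ : Submodule A M)}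
  zero_mem' n := by simp
  add_mem' {x y} hx hy n := by
    rw [map_add]
    exact Submodule.add_mem _ (hx n) (hy n)
  smul_mem' f x hx n := by
    rw [Subalgebra.smul_def, moduleCoeff_smul]
    refine Submodule.sum_mem _ fun ij hij => ?_
    rw [← Finset.HasAntidiagonal.mem_antidiagonal.mp hij, Finsupp.coe_add]
    refine Submodule.smul_mono_left (prodIdeal_mul_le F _ _) ?_
    rw [Submodule.mul_smul]
    exact Submodule.smul_mem_smul (f.2 _) (hx _)

noncomputable instance {A : Type*} [CommRing A] {s : ℕ} (F : Fin s → IdealFiltration A)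
    (M : Type*) [AddCommGroup M] [Module A M] :
    Module (multiReesAlgebra F) (multiReesModule F M) :=
  Submodule.module _

/-- The ideal `⨁_{|n| > 0} 𝔽_n Tⁿ` of the multi-Rees algebra. -/
noncomputable def multiReesPlus {A : Type*} [CommRing A] {s : ℕ}
    (F : Fin s → IdealFiltration A) : Ideal (multiReesAlgebra F) :=
  RingHom.ker ((MvPolynomial.constantCoeff (σ := Fin s) (R := A)).comp
    (multiReesAlgebra F).val.toRingHom)

/-- The ideal `(Q, R(F; A)₊)` of the multi-Rees algebra, for an ideal `Q` of `A`. -/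
noncomputable def multiReesIdeal {A : Type*} [CommRing A] {s : ℕ}
    (F : Fin s → IdealFiltration A) (Q : Ideal A) : Ideal (multiReesAlgebra F) :=
  Q.map (algebraMap A (multiReesAlgebra F)) ⊔ multiReesPlus F

/-! ### Hilbert–Samuel multiplicity -/

/-- `e` is the multiplicity `e(𝔞; N) = lim_{n → ∞} d! ℓ(N / 𝔞ⁿ N) / n^d`, where `d = dim N`;
the dimension and the lengths are required to be finite. -/
def IsMultiplicity {R : Type*} [CommRing R] (𝔞 : Ideal R) (N : Type*) [AddCommGroup N]
    [Module R N] (e : ℝ) : Prop :=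
  ∃ (d : ℕ) (l : ℕ → ℕ), Module.supportDim R N = (d : WithBot ℕ∞) ∧
    (∀ n, Module.length R (N ⧸ (𝔞 ^ n • (⊤ : Submodule R N))) = l n) ∧
    Filter.Tendsto (fun n : ℕ => (d ! : ℝ) * (l n : ℝ) / (n : ℝ) ^ d) Filter.atTop (nhds e)

/-- The multiplicity is unique. -/
theorem IsMultiplicity.unique {R : Type*} [CommRing R] {𝔞 : Ideal R} {N : Type*} [AddCommGroup N]
    [Module R N] {e e' : ℝ} (h : IsMultiplicity 𝔞 N e) (h' : IsMultiplicity 𝔞 N e') : e = e' := by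
  obtain ⟨d, l, hd, hl, ht⟩ := h
  obtain ⟨d', l', hd', hl', ht'⟩ := h'
  have hdd : d = d' := by exact_mod_cast hd.symm.trans hd'
  have hll : l = l' := funext fun n => by exact_mod_cast (hl n).symm.trans (hl' n)
  subst hdd hll
  exact tendsto_nhds_unique ht ht'

end MixedMult

/-! Part (i). Put `G = (F, F₁, …, F_s)` and `K = (J, I₁, …, I_s)`. From some index `N` on, `𝔾_{N+n}
M = Kⁿ 𝔾_N M`, so the Bhattacharya function is a multigraded Hilbert function of finite type and
agrees with a polynomial `P` for large arguments (`eventuallyPolynomial_relLength`,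
`exists_isStepPolynomial`). The powers of the reductions give another polynomial `P'`. It remains to
show that `P - P'` has degree less than `q - 1`.

Fix a direction `a` with positive entries and put `𝔞 = ∏ Kᵢ^{aᵢ}`, `X = 𝔾_{N'a} M`, `Y = 𝔞^{N'} M`,
so that `𝔞^{N'} X ⊆ Y ⊆ X`. Summing `P` and `P'` over `h` steps in the direction of `F`, with `h`
linear in `n`, gives `ℓ(𝔞ⁿX / Jʰ𝔞ⁿX)` and `ℓ(𝔞ⁿY / Jʰ𝔞ⁿY)`. In one direction they differ by at most
`ℓ(𝔞ⁿX / (𝔞ⁿY + Jʰ𝔞ⁿX))`; the sum of these over `n < L` telescopes into boundedly many copies of one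
`ℓ(X / J^H X)` with `H` linear in `L`, hence is `O(L^q)`, since `dim X ≤ q`. In the other direction
uniform Artin–Rees confines the error to boundedly many values of `P'`, whose degree is at most `q -
1`. So the differences sum to `O(L^q)` along every positive ray, which forces `deg (P - P') < q - 1`
(`coeff_eq_zero_of_sum_growth`). The bound `dim X ≤ q` holds because `𝔽ₙ M` meets `0 :_M I^∞`
trivially for large `n`. The comparison is `IsStepPolynomial.coeff_eq`.

Part (ii). Over the Noetherian ring `R = 𝔑(𝐈; A)`, the module `N₁ = ⨁ 𝔽ₙ M Tⁿ` is finitely generated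
and contains `N₀ = 𝔑(𝐈; M)`. Both have the same annihilator, which only depends on `Ann M`. By the
height condition some `a ∈ ∏ Iᵢ^{Nᵢ}` lies in no minimal prime of `Ann M`; it maps `N₁` into `N₀`,
so `N₁ / N₀` has smaller dimension and `N₀`, `N₁` have equal multiplicities. The filtration of `N₁`
by the powers of `(𝔍, 𝔑(𝐅; A)₊)` is equivalent to the one from `R` up to a bounded shift, which does
not affect the limit (`exists_tendsto_relLength`). Lengths and dimensions over `𝔑(𝐅; A)` and over
`R` coincide, because modulo their irrelevant ideals both rings reduce to `A`, and because the
extension is finite. -/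

namespace MixedMult

/-! ### Lengths of subquotients -/

section RelLength

variable {A : Type*} [CommRing A] {M : Type*} [AddCommGroup M] [Module A M]
  {M' : Type*} [AddCommGroup M'] [Module A M']

/-- The length of `U / (U ∩ V)` for submodules `U` and `V` of a module. -/
noncomputable def relLength (U V : Submodule A M) : ℕ∞ :=
  Module.length A (U ⧸ V.submoduleOf U)

theorem relLength_eq_of_surjective {U V : Submodule A M} (g : U →ₗ[A] M')
    (hg : Function.Surjective g) (hk : LinearMap.ker g = V.submoduleOf U) :
    relLength U V = Module.length A M' := by
  unfold relLength
  rw [← hk]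
  exact (g.quotKerEquivOfSurjective hg).length_eq

theorem relLength_top (V : Submodule A M) : relLength ⊤ V = Module.length A (M ⧸ V) := by
  refine relLength_eq_of_surjective (V.mkQ ∘ₗ (⊤ : Submodule A M).subtype) ?_ ?_
  · intro y
    obtain ⟨x, rfl⟩ := V.mkQ_surjective y
    exact ⟨⟨x, trivial⟩, rfl⟩
  · rw [LinearMap.ker_comp, Submodule.ker_mkQ]; rfl

theorem relLength_inf (U V : Submodule A M) : relLength U (U ⊓ V) = relLength U V := by
  unfold relLength
  rw [show (U ⊓ V).submoduleOf U = V.submoduleOf U by ext x; simp [Submodule.submoduleOf]]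

theorem relLength_eq_zero {U V : Submodule A M} : relLength U V = 0 ↔ U ≤ V := by
  unfold relLength
  rw [Module.length_eq_zero_iff, Submodule.Quotient.subsingleton_iff, Submodule.submoduleOf,
    Submodule.comap_subtype_eq_top]

/-- Second isomorphism theorem along `f`: the map from `U` to `(f(U) + V) / V` is onto, and its
kernel is `U ∩ f⁻¹(V)`. -/
theorem relLength_map_sup (f : M →ₗ[A] M') (U : Submodule A M) (V : Submodule A M') :
    relLength (U.map f ⊔ V) V = relLength U (V.comap f) := by
  let g : U →ₗ[A] (↥(U.map f ⊔ V) ⧸ V.submoduleOf (U.map f ⊔ V)) :=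
    (V.submoduleOf (U.map f ⊔ V)).mkQ ∘ₗ
      (f.restrict (p := U) (q := U.map f ⊔ V)
        fun x hx => Submodule.mem_sup_left (Submodule.mem_map_of_mem hx))
  refine (relLength_eq_of_surjective g ?_ ?_).symm
  · intro y
    obtain ⟨⟨y, hy⟩, rfl⟩ := Submodule.mkQ_surjective _ y
    obtain ⟨z, ⟨x, hx, rfl⟩, v, hv, rfl⟩ := Submodule.mem_sup.mp hy
    refine ⟨⟨x, hx⟩, ?_⟩
    simp only [g, LinearMap.comp_apply, Submodule.mkQ_apply]
    rw [Submodule.Quotient.eq]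
    simpa [Submodule.submoduleOf, LinearMap.restrict_apply] using hv
  · ext x
    simp only [g, LinearMap.mem_ker, LinearMap.comp_apply, Submodule.mkQ_apply,
      Submodule.Quotient.mk_eq_zero]
    rfl

theorem relLength_sup_right (U V : Submodule A M) : relLength (U ⊔ V) V = relLength U V := by
  simpa using relLength_map_sup (LinearMap.id) U V

theorem relLength_map_of_injective (f : M →ₗ[A] M') (hf : Function.Injective f)
    (U V : Submodule A M) : relLength (U.map f) (V.map f) = relLength U V := by
  rw [← relLength_sup_right, relLength_map_sup, Submodule.comap_map_eq_of_injective hf]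

theorem submoduleOf_le_comap_inclusion {U U' : Submodule A M} (h : U ≤ U') (V : Submodule A M) :
    V.submoduleOf U ≤ (V.submoduleOf U').comap (Submodule.inclusion h) := fun _ hx => hx

/-- The map `U / (U ∩ V) → U' / (U' ∩ V)` induced by an inclusion `U ≤ U'`. -/
noncomputable def inclusionQ {U U' : Submodule A M} (h : U ≤ U') (V : Submodule A M) :
    (U ⧸ V.submoduleOf U) →ₗ[A] (U' ⧸ V.submoduleOf U') :=
  Submodule.mapQ _ _ (Submodule.inclusion h) (submoduleOf_le_comap_inclusion h V)

theorem inclusionQ_mk {U U' : Submodule A M} (h : U ≤ U') (V : Submodule A M) (x : U) :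
    inclusionQ h V (Submodule.Quotient.mk x) = Submodule.Quotient.mk (Submodule.inclusion h x) :=
  rfl

theorem inclusionQ_injective {U U' : Submodule A M} (h : U ≤ U') (V : Submodule A M) :
    Function.Injective (inclusionQ h V) := by
  rw [← LinearMap.ker_eq_bot, LinearMap.ker_eq_bot']
  intro x hx
  obtain ⟨x, rfl⟩ := Submodule.Quotient.mk_surjective _ x
  rw [inclusionQ_mk, Submodule.Quotient.mk_eq_zero] at hx
  rw [Submodule.Quotient.mk_eq_zero]
  exact hx

theorem relLength_mono_left {U U' : Submodule A M} (h : U ≤ U') (V : Submodule A M) :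
    relLength U V ≤ relLength U' V :=
  Module.length_le_of_injective _ (inclusionQ_injective h V)

theorem relLength_anti_right (U : Submodule A M) {V V' : Submodule A M} (h : V ≤ V') :
    relLength U V' ≤ relLength U V :=
  Module.length_le_of_surjective
    (Submodule.factor (Submodule.comap_mono h : V.submoduleOf U ≤ V'.submoduleOf U))
    (Submodule.factor_surjective _)

theorem relLength_add {U W V : Submodule A M} (h₁ : V ≤ W) (h₂ : W ≤ U) :
    relLength U V = relLength U W + relLength W V := by
  rw [add_comm]
  have hle : V.submoduleOf U ≤ W.submoduleOf U := Submodule.comap_mono h₁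
  refine Module.length_eq_add_of_exact (inclusionQ h₂ V) (Submodule.factor hle)
    (inclusionQ_injective h₂ V) (Submodule.factor_surjective _) ?_
  intro x
  obtain ⟨x, rfl⟩ := Submodule.Quotient.mk_surjective _ x
  rw [show Submodule.factor hle (Submodule.Quotient.mk x) = Submodule.Quotient.mk x from rfl,
    Submodule.Quotient.mk_eq_zero]
  constructor
  · intro hx
    exact ⟨Submodule.Quotient.mk ⟨x, hx⟩, rfl⟩
  · rintro ⟨y, hy⟩
    obtain ⟨y, rfl⟩ := Submodule.Quotient.mk_surjective _ y
    rw [inclusionQ_mk, Submodule.Quotient.eq] at hy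
    have h3 : (y : M) - x ∈ V := hy
    have h4 : (x : M) ∈ W := by simpa using W.sub_mem y.2 (h₁ h3)
    exact h4

/-- No inclusions are needed: enlarge `U` to `U + W + V` and insert `W + V` between it and `V`. -/
theorem relLength_le_add (U W V : Submodule A M) :
    relLength U V ≤ relLength U W + relLength W V := by
  have h1 : relLength U V = relLength (U ⊔ V) V := (relLength_sup_right U V).symm
  have h2 : relLength (U ⊔ V) V ≤ relLength (U ⊔ (W ⊔ V)) V :=
    relLength_mono_left (sup_le_sup_left le_sup_right _) _
  rw [h1]
  refine h2.trans ?_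
  rw [relLength_add (le_sup_right : V ≤ W ⊔ V) le_sup_right, relLength_sup_right,
    relLength_sup_right]
  gcongr
  exact relLength_anti_right U le_sup_left

/-- A chain of submodules, taken modulo a submodule, splits the length. -/
theorem sum_relLength_succ (X : ℕ → Submodule A M) (hX : Antitone X) (W : Submodule A M) (L : ℕ) :
    ∑ m ∈ Finset.range L, relLength (X m) (X (m + 1) ⊔ W) = relLength (X 0) (X L ⊔ W) := by
  -- Each term becomes the length of a quotient of nested members of the chain `X m ⊔ W`, where
  -- additivity applies.
  have key : ∀ m n, relLength (X m) (X n ⊔ W) = relLength (X m ⊔ (X n ⊔ W)) (X n ⊔ W) :=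
    fun m n => (relLength_sup_right _ _).symm
  induction L with
  | zero => exact (relLength_eq_zero.mpr le_sup_left).symm
  | succ L ih =>
    have h1 : X 0 ⊔ (X L ⊔ W) = X 0 ⊔ W := by
      rw [← sup_assoc, sup_of_le_left (hX (Nat.zero_le L))]
    have h2 : X 0 ⊔ (X (L + 1) ⊔ W) = X 0 ⊔ W := by
      rw [← sup_assoc, sup_of_le_left (hX (Nat.zero_le _))]
    have h3 : X L ⊔ (X (L + 1) ⊔ W) = X L ⊔ W := by
      rw [← sup_assoc, sup_of_le_left (hX (Nat.le_succ L))]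
    rw [Finset.sum_range_succ, ih, key 0 L, key L (L + 1), key 0 (L + 1), h1, h2, h3,
      ← relLength_add (sup_le_sup_right (hX (Nat.le_succ L)) _)
        (sup_le_sup_right (hX (Nat.zero_le L)) _)]

theorem relLength_mono {U U' V V' : Submodule A M} (h : U ≤ U') (h' : V' ≤ V) :
    relLength U V ≤ relLength U' V' :=
  (relLength_mono_left h V).trans (relLength_anti_right U' h')

end RelLength

/-! ### Discrete antiderivatives of polynomials -/

section Antiderivative

variable {σ : Type*}

/-- Faulhaber's formula, through Bernoulli polynomials. -/
theorem exists_eval_eq_sum_range_pow (e : ℕ) :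
    ∃ q : Polynomial ℚ, ∀ n : ℕ, q.eval (n : ℚ) = ∑ k ∈ Finset.range n, (k : ℚ) ^ e := by
  refine ⟨Polynomial.C ((e + 1 : ℚ)⁻¹) *
    (Polynomial.bernoulli e.succ - Polynomial.C (_root_.bernoulli e.succ)), fun n => ?_⟩
  have h : (e + 1 : ℚ) ≠ 0 := by positivity
  rw [Polynomial.eval_mul, Polynomial.eval_sub, Polynomial.eval_C, Polynomial.eval_C,
    ← Polynomial.sum_range_pow_eq_bernoulli_sub, inv_mul_cancel_left₀ h]

theorem exists_eval_eq_sum_range (g : Polynomial ℚ) :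
    ∃ G : Polynomial ℚ, ∀ n : ℕ, G.eval (n : ℚ) = ∑ k ∈ Finset.range n, g.eval (k : ℚ) := by
  induction g using Polynomial.induction_on' with
  | add p q hp hq =>
    obtain ⟨P, hP⟩ := hp
    obtain ⟨Q, hQ⟩ := hq
    exact ⟨P + Q, fun n => by simp [hP, hQ, Finset.sum_add_distrib]⟩
  | monomial e c =>
    obtain ⟨q, hq⟩ := exists_eval_eq_sum_range_pow e
    exact ⟨Polynomial.C c * q, fun n => by simp [hq, Finset.mul_sum]⟩

theorem eval_aeval_mvPolynomial {τ : Type*} (x : τ → ℚ) (g : σ → MvPolynomial τ ℚ)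
    (p : MvPolynomial σ ℚ) :
    MvPolynomial.eval x (MvPolynomial.aeval g p) =
      MvPolynomial.eval (fun i => MvPolynomial.eval x (g i)) p := by
  induction p using MvPolynomial.induction_on with
  | C a => simp
  | add p q hp hq => rw [map_add, map_add, hp, hq, map_add]
  | mul_X p i hp => rw [map_mul, map_mul, hp, map_mul, MvPolynomial.aeval_X, MvPolynomial.eval_X]

theorem eval_aeval_X (x : σ → ℚ) (i : σ) (q : Polynomial ℚ) :
    MvPolynomial.eval x (Polynomial.aeval (MvPolynomial.X i) q) = q.eval (x i) := by
  induction q using Polynomial.induction_on' with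
  | add p q hp hq => simp only [map_add, Polynomial.eval_add, hp, hq]
  | monomial e c => simp [Polynomial.aeval_monomial, MvPolynomial.algebraMap_eq]

/-- Polynomials in several variables have discrete antiderivatives in each variable. -/
theorem exists_eval_eq_sum_range_update [DecidableEq σ] (p : MvPolynomial σ ℚ) (i : σ) :
    ∃ S : MvPolynomial σ ℚ, ∀ (x : σ → ℚ) (h : ℕ), MvPolynomial.eval (Function.update x i h) S =
      ∑ k ∈ Finset.range h, MvPolynomial.eval (Function.update x i (k : ℚ)) p := by
  induction p using MvPolynomial.induction_on' with
  | add p q hp hq =>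
    obtain ⟨P, hP⟩ := hp
    obtain ⟨Q, hQ⟩ := hq
    exact ⟨P + Q, fun x h => by simp [hP, hQ, Finset.sum_add_distrib]⟩
  | monomial d c =>
    obtain ⟨q, hq⟩ := exists_eval_eq_sum_range_pow (d i)
    -- Only the variable `i` is summed: the other factors of the monomial are constants for the sum.
    refine ⟨MvPolynomial.monomial (d.erase i) c * Polynomial.aeval (MvPolynomial.X i) q,
      fun x h => ?_⟩
    have h1 : ∀ y : ℚ, MvPolynomial.eval (Function.update x i y)
        (MvPolynomial.monomial (d.erase i) c) =
        MvPolynomial.eval x (MvPolynomial.monomial (d.erase i) c) := by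
      intro y
      simp only [MvPolynomial.eval_monomial]
      congr 1
      refine Finsupp.prod_congr fun j hj => ?_
      rw [Function.update_of_ne]
      rintro rfl
      simp at hj
    have h2 : ∀ y : ℚ, MvPolynomial.eval (Function.update x i y)
        (MvPolynomial.monomial d c) =
        MvPolynomial.eval x (MvPolynomial.monomial (d.erase i) c) * y ^ (d i) := by
      intro y
      rw [← h1 y]
      conv_lhs => rw [← Finsupp.erase_add_single i d]
      rw [show (MvPolynomial.monomial (d.erase i + Finsupp.single i (d i))) c =
        MvPolynomial.monomial (d.erase i) c * MvPolynomial.monomial (Finsupp.single i (d i)) 1 by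
          rw [MvPolynomial.monomial_mul, mul_one], map_mul]
      congr 1
      simp [MvPolynomial.eval_monomial]
    rw [map_mul, h1, eval_aeval_X, Function.update_self, hq, Finset.mul_sum]
    simp only [h2]

end Antiderivative

/-! ### Functions that are eventually polynomial -/

section EventuallyPolynomial

/-- A function on `ℕ^σ` that agrees with a polynomial when all arguments are large. -/
def EventuallyPolynomial {σ : Type*} (f : (σ → ℕ) → ℚ) : Prop :=
  ∃ (P : MvPolynomial σ ℚ) (N : ℕ), ∀ n : σ → ℕ, (∀ i, N ≤ n i) →
    f n = MvPolynomial.eval (fun i => (n i : ℚ)) P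

variable {σ : Type*}

theorem exists_polynomial_of_differences [Fintype σ] [DecidableEq σ] (f : (σ → ℕ) → ℚ)
    (p : σ → MvPolynomial σ ℚ)
    (hf : ∀ i n, f (n + Pi.single i 1) - f n = MvPolynomial.eval (fun j => (n j : ℚ)) (p i)) :
    ∃ P : MvPolynomial σ ℚ, ∀ n, f n = MvPolynomial.eval (fun i => (n i : ℚ)) P := by
  -- The coordinates are brought down to `0` one at a time, `T` being the set of those already
  -- treated. Each move costs an antiderivative of `p i`, taken with the coordinates in `T` equal to
  -- `0`.
  suffices H : ∀ T : Finset σ, ∃ P : MvPolynomial σ ℚ, ∀ n : σ → ℕ,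
      f n = MvPolynomial.eval (fun i => (n i : ℚ)) P + f (fun j => if j ∈ T then 0 else n j) by
    obtain ⟨P, hP⟩ := H Finset.univ
    refine ⟨P + MvPolynomial.C (f fun _ => 0), fun n => ?_⟩
    rw [hP n]
    simp
  intro T
  induction T using Finset.induction_on with
  | empty => exact ⟨0, fun n => by simp⟩
  | insert i T hi ih =>
    obtain ⟨P, hP⟩ := ih
    obtain ⟨S, hS⟩ := exists_eval_eq_sum_range_update (p i) i
    refine ⟨P + MvPolynomial.aeval (fun j => if j ∈ T then 0 else MvPolynomial.X j) S,
      fun n => ?_⟩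
    rw [hP n, map_add, add_assoc]
    congr 1
    set m : σ → ℕ := fun j => if j ∈ T then 0 else n j with hm
    have hmi : m i = n i := by simp [hm, hi]
    have h1 : (fun j => if j ∈ insert i T then 0 else n j) = Function.update m i 0 := by
      ext j
      by_cases hj : j = i
      · subst hj; simp
      · simp [hm, hj]
    have h2 : ∀ h : ℕ, ∑ k ∈ Finset.range h,
        MvPolynomial.eval (Function.update (fun j => (m j : ℚ)) i (k : ℚ)) (p i) =
        f (Function.update m i h) - f (Function.update m i 0) := by
      intro h
      induction h with
      | zero => simp
      | succ h ih =>
        have h3 : Function.update m i h + Pi.single i 1 = Function.update m i (h + 1) := by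
          ext j
          by_cases hj : j = i
          · subst hj; simp
          · simp [hj]
        have h4 : (fun j => ((Function.update m i h j : ℕ) : ℚ)) =
            Function.update (fun j => (m j : ℚ)) i (h : ℚ) := by
          ext j
          by_cases hj : j = i
          · subst hj; simp
          · simp [hj]
        have h5 := hf i (Function.update m i h)
        rw [h3, h4] at h5
        rw [Finset.sum_range_succ, ih, ← h5]
        ring
    have h6 : MvPolynomial.eval (fun j => (n j : ℚ))
        (MvPolynomial.aeval (fun j => if j ∈ T then 0 else MvPolynomial.X j) S) =
        MvPolynomial.eval (Function.update (fun j => (m j : ℚ)) i ((n i : ℕ) : ℚ)) S := by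
      rw [eval_aeval_mvPolynomial]
      congr 1
      congr 1
      ext j
      by_cases hj : j = i
      · subst hj; simp [hi]
      · by_cases hjT : j ∈ T <;> simp [hj, hjT, hm]
    rw [h1, h6, hS, h2, ← hmi, Function.update_eq_self]
    ring

theorem EventuallyPolynomial.of_shift {f : (σ → ℕ) → ℚ} (N : ℕ)
    (h : EventuallyPolynomial fun n => f (n + fun _ => N)) : EventuallyPolynomial f := by
  obtain ⟨P, N', hP⟩ := h
  refine ⟨MvPolynomial.aeval (fun i => MvPolynomial.X i - MvPolynomial.C (N : ℚ)) P, N + N',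
    fun n hn => ?_⟩
  have h1 : n = (n - fun _ => N : σ → ℕ) + fun _ => N := by
    ext i
    have := hn i
    simp only [Pi.add_apply, Pi.sub_apply]
    lia
  have h2 : ∀ i, N' ≤ (n - fun _ => N : σ → ℕ) i := by
    intro i
    have := hn i
    simp only [Pi.sub_apply]
    lia
  have h3 := hP _ h2
  beta_reduce at h3
  rw [← h1] at h3
  rw [h3, eval_aeval_mvPolynomial]
  congr 2
  ext i
  have : N ≤ n i := le_trans (Nat.le_add_right _ _) (hn i)
  simp [Nat.cast_sub this]

theorem EventuallyPolynomial.shift {f : (σ → ℕ) → ℚ} (h : EventuallyPolynomial f) (m : σ → ℕ) :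
    EventuallyPolynomial fun n => f (n + m) := by
  obtain ⟨P, N, hP⟩ := h
  refine ⟨MvPolynomial.aeval (fun i => MvPolynomial.X i + MvPolynomial.C (m i : ℚ)) P, N,
    fun n hn => ?_⟩
  beta_reduce
  rw [hP (n + m) fun i => le_trans (hn i) (Nat.le_add_right _ _), eval_aeval_mvPolynomial]
  congr 2
  ext i
  simp

theorem EventuallyPolynomial.sub {f g : (σ → ℕ) → ℚ} (hf : EventuallyPolynomial f)
    (hg : EventuallyPolynomial g) : EventuallyPolynomial fun n => f n - g n := by
  obtain ⟨P, N, hP⟩ := hf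
  obtain ⟨Q, N', hQ⟩ := hg
  refine ⟨P - Q, max N N', fun n hn => ?_⟩
  beta_reduce
  rw [hP n fun i => le_trans (le_max_left _ _) (hn i),
    hQ n fun i => le_trans (le_max_right _ _) (hn i), map_sub]

/-- A shift beyond all the thresholds makes the differences polynomial everywhere, so that they can
be summed from the origin. -/
theorem EventuallyPolynomial.of_differences [Fintype σ] [DecidableEq σ] {f : (σ → ℕ) → ℚ}
    (hf : ∀ i, EventuallyPolynomial fun n => f (n + Pi.single i 1) - f n) :
    EventuallyPolynomial f := by
  choose p N hp using hf
  let N₀ := Finset.univ.sup N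
  refine EventuallyPolynomial.of_shift N₀ ?_
  obtain ⟨P, hP⟩ := exists_polynomial_of_differences (fun n => f (n + fun _ => N₀))
    (fun i => MvPolynomial.aeval (fun j => MvPolynomial.X j + MvPolynomial.C (N₀ : ℚ)) (p i)) (by
      intro i n
      have h1 := hp i (n + fun _ => N₀) fun j =>
        le_trans (Finset.le_sup (Finset.mem_univ i)) (Nat.le_add_left _ _)
      beta_reduce at h1
      rw [add_right_comm, h1, eval_aeval_mvPolynomial]
      congr 2
      ext j
      simp)
  exact ⟨P, 0, fun n _ => hP n⟩

end EventuallyPolynomial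

/-! ### Degree bounds from growth along rays -/

section Growth

/-- If the partial sums of the values of `g` grow at most like `L ^ (D + 1)`, then `g` has degree
at most `D`. -/
theorem natDegree_le_of_sum_growth (g : Polynomial ℚ) (D N : ℕ) (C : ℚ)
    (h : ∀ L : ℕ, |∑ n ∈ Finset.range L, g.eval ((n + N : ℕ) : ℚ)| ≤ C * (L + 1) ^ (D + 1)) :
    g.natDegree ≤ D := by
  set g' := Polynomial.taylor (N : ℚ) g with hg'
  obtain ⟨G, hG⟩ := exists_eval_eq_sum_range g'
  have hG' : ∀ L : ℕ, |G.eval (L : ℚ)| ≤ C * (L + 1) ^ (D + 1) := by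
    intro L
    rw [hG]
    have h1 : ∀ n : ℕ, g'.eval (n : ℚ) = g.eval ((n + N : ℕ) : ℚ) := fun n => by
      simp [hg', Polynomial.taylor_eval]
    simp only [h1]
    exact h L
  have hdiff : Polynomial.taylor 1 G - G = g' := by
    refine Polynomial.eq_of_infinite_eval_eq _ _ ((Set.infinite_range_of_injective
      (Nat.cast_injective (R := ℚ))).mono ?_)
    rintro _ ⟨n, rfl⟩
    have h1 := hG (n + 1)
    rw [Finset.sum_range_succ, ← hG n] at h1
    simp only [Set.mem_ofPred_eq, Polynomial.eval_sub, Polynomial.taylor_eval]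
    push_cast at h1
    rw [h1]
    ring
  -- If the antiderivative had larger degree, its quotient by `(X + 1) ^ (D + 1)` would be unbounded
  -- on `ℕ`.
  have hdegG : G.natDegree ≤ D + 1 := by
    by_contra! hlt
    set Q : Polynomial ℚ := (Polynomial.X + 1) ^ (D + 1) with hQ
    have hQm : Q.Monic := (Polynomial.monic_X_add_C (1 : ℚ)).pow _
    have hQd : Q.natDegree = D + 1 := by
      rw [hQ, Polynomial.natDegree_pow, ← Polynomial.C_1, Polynomial.natDegree_X_add_C, mul_one]
    have hlt' : Q.degree < G.degree := Polynomial.degree_lt_degree (by rw [hQd]; exact hlt)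
    have ht := (Polynomial.abs_div_tendsto_atTop_atTop_of_degree_gt G Q hlt' hQm.ne_zero).comp
      (tendsto_natCast_atTop_atTop (R := ℚ))
    obtain ⟨n, hn⟩ := (ht.eventually (Filter.eventually_gt_atTop C)).exists
    have hpos : (0 : ℚ) < ((n : ℚ) + 1) ^ (D + 1) := by positivity
    have hQn : Q.eval (n : ℚ) = ((n : ℚ) + 1) ^ (D + 1) := by simp [hQ]
    simp only [Function.comp_apply] at hn
    rw [hQn, abs_div, abs_of_pos hpos, lt_div_iff₀ hpos] at hn
    exact absurd (hG' n) (not_le.mpr hn)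
  -- The difference operator lowers the degree, and `g'` is the difference of `G`.
  have h2 : g'.natDegree ≤ D := by
    by_cases hG0 : G = 0
    · rw [← hdiff, hG0]; simp
    · have h3 : (Polynomial.taylor 1 G - G).degree < (Polynomial.taylor 1 G).degree :=
        Polynomial.degree_sub_lt_left (Polynomial.degree_taylor _ _)
          (by rwa [ne_eq, Polynomial.taylor_eq_zero]) (Polynomial.leadingCoeff_taylor _ _)
      rw [hdiff, Polynomial.degree_taylor G 1] at h3
      have h5 : g'.degree < ((D + 1 : ℕ) : WithBot ℕ) := by
        refine h3.trans_le (Polynomial.degree_le_natDegree.trans ?_)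
        exact_mod_cast hdegG
      exact Polynomial.natDegree_le_iff_degree_le.mpr (Order.le_of_lt_succ (by exact_mod_cast h5))
  rwa [hg', Polynomial.natDegree_taylor] at h2

variable {σ : Type*}

theorem abs_eval_le (p : MvPolynomial σ ℚ) :
    ∃ C : ℚ, 0 ≤ C ∧ ∀ (x : σ → ℚ) (B : ℚ), 1 ≤ B → (∀ i, |x i| ≤ B) →
      |MvPolynomial.eval x p| ≤ C * B ^ p.totalDegree := by
  refine ⟨∑ d ∈ p.support, |p.coeff d|, Finset.sum_nonneg fun _ _ => abs_nonneg _,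
    fun x B hB hx => ?_⟩
  rw [MvPolynomial.eval_eq, Finset.sum_mul]
  refine (Finset.abs_sum_le_sum_abs _ _).trans (Finset.sum_le_sum fun d hd => ?_)
  rw [abs_mul, Finset.abs_prod]
  gcongr
  calc ∏ i ∈ d.support, |x i ^ d i| ≤ ∏ i ∈ d.support, B ^ d i := by
        refine Finset.prod_le_prod (fun _ _ => abs_nonneg _) fun i _ => ?_
        rw [abs_pow]
        gcongr
        exact hx i
    _ = B ^ (d.sum fun _ e => e) := by rw [Finset.prod_pow_eq_pow_sum]; rfl
    _ ≤ B ^ p.totalDegree := pow_le_pow_right₀ hB (MvPolynomial.le_totalDegree hd)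

/-- The restriction of a polynomial to the ray through `a`. -/
noncomputable def ray (p : MvPolynomial σ ℚ) (a : σ → ℕ) : Polynomial ℚ :=
  MvPolynomial.aeval (fun i => Polynomial.C (a i : ℚ) * Polynomial.X) p

theorem eval_ray (p : MvPolynomial σ ℚ) (a : σ → ℕ) (t : ℚ) :
    (ray p a).eval t = MvPolynomial.eval (fun i => t * a i) p := by
  unfold ray
  induction p using MvPolynomial.induction_on with
  | C c => simp
  | add p q hp hq => rw [map_add, Polynomial.eval_add, hp, hq, map_add]
  | mul_X p i hp =>
    rw [map_mul, Polynomial.eval_mul, hp, map_mul, MvPolynomial.aeval_X, MvPolynomial.eval_X]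
    simp [mul_comm]

theorem coeff_ray (p : MvPolynomial σ ℚ) (a : σ → ℕ) (k : ℕ) :
    (ray p a).coeff k =
      MvPolynomial.eval (fun i => (a i : ℚ)) (MvPolynomial.homogeneousComponent k p) := by
  unfold ray
  induction p using MvPolynomial.induction_on' with
  | add p q hp hq => rw [map_add, Polynomial.coeff_add, hp, hq, map_add, map_add]
  | monomial d c =>
    have h1 : MvPolynomial.aeval (fun i => Polynomial.C (a i : ℚ) * Polynomial.X)
        (MvPolynomial.monomial d c) =
        Polynomial.C (MvPolynomial.eval (fun i => (a i : ℚ)) (MvPolynomial.monomial d c)) *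
          Polynomial.X ^ d.degree := by
      rw [MvPolynomial.aeval_monomial, MvPolynomial.eval_monomial, map_mul, mul_assoc]
      congr 1
      simp only [mul_pow, Finsupp.prod, Finset.prod_mul_distrib, Finset.prod_pow_eq_pow_sum,
        map_prod, map_pow]
      rfl
    have h2 : MvPolynomial.monomial d c ∈ MvPolynomial.homogeneousSubmodule σ ℚ d.degree :=
      MvPolynomial.isHomogeneous_monomial c rfl
    rw [h1, Polynomial.coeff_C_mul, Polynomial.coeff_X_pow,
      MvPolynomial.homogeneousComponent_of_mem h2]
    split_ifs <;> simp

/-- The coefficient of `t ^ k` on the ray through `a` is the value at `a` of the homogeneous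
component of degree `k`. For `k > D` this component vanishes at all positive integer points, hence
is zero. -/
theorem totalDegree_le_of_ray_growth (p : MvPolynomial σ ℚ) (D : ℕ)
    (h : ∀ a : σ → ℕ, (∀ i, 0 < a i) → ∃ (N : ℕ) (C : ℚ), ∀ L : ℕ,
      |∑ n ∈ Finset.range L, MvPolynomial.eval (fun i => (((n + N) * a i : ℕ) : ℚ)) p| ≤
        C * (L + 1) ^ (D + 1)) :
    p.totalDegree ≤ D := by
  have hk : ∀ k, D < k → MvPolynomial.homogeneousComponent k p = 0 := by
    intro k hk
    have hinf : (((↑) : ℕ → ℚ) '' Set.Ici 1).Infinite :=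
      (Set.Ici_infinite _).image Nat.cast_injective.injOn
    refine MvPolynomial.funext_set (fun _ => ((↑) : ℕ → ℚ) '' Set.Ici 1)
      (fun _ => hinf) fun x hx => ?_
    choose a ha hax using fun i => hx i (Set.mem_univ i)
    obtain ⟨N, C, hC⟩ := h a ha
    have h1 : (ray p a).natDegree ≤ D := by
      refine natDegree_le_of_sum_growth _ D N C fun L => ?_
      convert hC L using 5 with n
      rw [eval_ray]
      congr 2
      ext i
      push_cast
      ring
    rw [show x = fun i => (a i : ℚ) from (funext hax).symm, ← coeff_ray,
      Polynomial.coeff_eq_zero_of_natDegree_lt (h1.trans_lt hk), map_zero]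
  refine Finset.sup_le fun d hd => ?_
  by_contra! hlt
  have h1 := congrArg (MvPolynomial.coeff d) (hk _ hlt)
  rw [MvPolynomial.coeff_homogeneousComponent, if_pos (by rfl), MvPolynomial.coeff_zero] at h1
  exact MvPolynomial.mem_support_iff.mp hd h1

theorem sum_range_pow_le (C : ℚ) (hC : 0 ≤ C) (N D L : ℕ) :
    ∑ n ∈ Finset.range L, C * ((n + N + 1 : ℕ) : ℚ) ^ D ≤ C * (N + 1) ^ D * (L + 1) ^ (D + 1) := by
  calc ∑ n ∈ Finset.range L, C * ((n + N + 1 : ℕ) : ℚ) ^ D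
      ≤ ∑ n ∈ Finset.range L, C * ((N + 1 : ℚ) * (L + 1)) ^ D := by
        refine Finset.sum_le_sum fun n hn => ?_
        have : (n : ℚ) ≤ L := by exact_mod_cast (Finset.mem_range.mp hn).le
        gcongr
        push_cast
        nlinarith [(Nat.cast_nonneg N : (0 : ℚ) ≤ N), (Nat.cast_nonneg L : (0 : ℚ) ≤ L)]
    _ = L * (C * ((N + 1 : ℚ) * (L + 1)) ^ D) := by simp
    _ ≤ (L + 1) * (C * ((N + 1 : ℚ) * (L + 1)) ^ D) := by
        gcongr
        linarith
    _ = C * (N + 1) ^ D * (L + 1) ^ (D + 1) := by rw [mul_pow]; ring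

theorem totalDegree_le_of_pointwise (p : MvPolynomial σ ℚ) (D : ℕ)
    (h : ∀ a : σ → ℕ, (∀ i, 0 < a i) → ∃ (N : ℕ) (C : ℚ), 0 ≤ C ∧ ∀ n : ℕ,
      |MvPolynomial.eval (fun i => (((n + N) * a i : ℕ) : ℚ)) p| ≤
        C * ((n + N + 1 : ℕ) : ℚ) ^ D) :
    p.totalDegree ≤ D := by
  refine totalDegree_le_of_ray_growth p D fun a ha => ?_
  obtain ⟨N, C, hC, hN⟩ := h a ha
  refine ⟨N, C * (N + 1) ^ D, fun L => ?_⟩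
  exact (Finset.abs_sum_le_sum_abs _ _).trans
    ((Finset.sum_le_sum fun n _ => hN n).trans (sum_range_pow_le C hC N D L))

theorem X_dvd_sub_aeval_update [DecidableEq σ] (p : MvPolynomial σ ℚ) (i : σ) :
    MvPolynomial.X i ∣ p - MvPolynomial.aeval (Function.update MvPolynomial.X i 0) p := by
  induction p using MvPolynomial.induction_on with
  | C c => simp
  | add p q hp hq =>
    rw [map_add, add_sub_add_comm]
    exact dvd_add hp hq
  | mul_X p j hp =>
    rw [map_mul, MvPolynomial.aeval_X]
    by_cases hj : j = i
    · subst hj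
      simp
    · rw [Function.update_of_ne hj, ← sub_mul]
      exact hp.mul_right _

/-- If the sums `∑_{k < c n} p(n a + k e)`, summed over `n < L`, grow at most like `L ^ (D + 1)`
along all positive rays, then the coefficients of `p` in degrees at least `D` vanish. -/
theorem coeff_eq_zero_of_sum_growth [Finite σ] [DecidableEq σ] (p : MvPolynomial σ ℚ) (i₀ : σ)
    (D : ℕ)
    (h : ∀ (a : σ → ℕ) (c : ℕ), (∀ i, 0 < a i) → 0 < c → ∃ (N : ℕ) (C : ℚ), ∀ L : ℕ,
      |∑ n ∈ Finset.range L, ∑ k ∈ Finset.range ((n + N) * c), MvPolynomial.eval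
        (fun i => (((n + N) * a i + if i = i₀ then k else 0 : ℕ) : ℚ)) p| ≤
        C * (L + 1) ^ (D + 1))
    (d : σ →₀ ℕ) (hd : D ≤ d.degree) : p.coeff d = 0 := by
  -- `S(m, x)` is the sum of `p(x + k e)` over `k < m`; the extra variable `none` carries `m`. The
  -- hypothesis bounds the growth of `S` along rays, so `S` has degree at most `D`.
  obtain ⟨S, hS⟩ := exists_eval_eq_sum_range_update (MvPolynomial.aeval (fun i : σ =>
    MvPolynomial.X (some i) + if i = i₀ then MvPolynomial.X none else 0) p) (none : Option σ)
  have hS' : ∀ (x : σ → ℚ) (m : ℕ), MvPolynomial.eval (fun o : Option σ => o.elim (m : ℚ) x) S =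
      ∑ k ∈ Finset.range m, MvPolynomial.eval (fun i => x i + if i = i₀ then (k : ℚ) else 0) p := by
    intro x m
    have h1 := hS (fun o => o.elim 0 x) m
    have h2 : ∀ y : ℚ, Function.update (fun o : Option σ => o.elim 0 x) none y =
        fun o => o.elim y x := by
      intro y
      ext o
      cases o <;> simp
    simp only [h2] at h1
    rw [h1]
    refine Finset.sum_congr rfl fun k _ => ?_
    rw [eval_aeval_mvPolynomial]
    congr 2
    ext i
    split_ifs <;> simp
  have hdeg : S.totalDegree ≤ D := by
    refine totalDegree_le_of_ray_growth S D fun b hb => ?_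
    obtain ⟨N, C, hC⟩ := h (fun i => b (some i)) (b none) (fun i => hb _) (hb _)
    refine ⟨N, C, fun L => ?_⟩
    convert hC L using 4 with n
    have h1 := hS' (fun i => (((n + N) * b (some i) : ℕ) : ℚ)) ((n + N) * b none)
    rw [show (fun o : Option σ => o.elim (((n + N) * b none : ℕ) : ℚ)
        fun i => (((n + N) * b (some i) : ℕ) : ℚ)) = fun o => (((n + N) * b o : ℕ) : ℚ) by
      ext o; cases o <;> rfl] at h1
    rw [h1]
    refine Finset.sum_congr rfl fun k _ => ?_
    congr 2
    ext i
    split_ifs <;> simp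
  -- The empty sum vanishes, so `S = m * S'`. This division by `m` gains one degree, and `p(x) =
  -- S(1, x) = S'(1, x)`.
  have hzero : MvPolynomial.aeval (Function.update (MvPolynomial.X (R := ℚ)) none 0) S = 0 := by
    refine MvPolynomial.funext fun x => ?_
    rw [eval_aeval_mvPolynomial, map_zero]
    have h1 := hS x 0
    rw [Finset.sum_range_zero] at h1
    rw [← h1]
    congr 2
    ext o
    cases o <;> simp
  obtain ⟨S', hS'X⟩ := X_dvd_sub_aeval_update S none
  rw [hzero, sub_zero] at hS'X
  have hp : ∀ x : σ → ℚ, MvPolynomial.eval x p =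
      MvPolynomial.eval (fun o : Option σ => o.elim 1 x) S' := by
    intro x
    have h1 := hS' x 1
    rw [hS'X] at h1
    simpa using h1.symm
  by_cases hS0 : S' = 0
  · have : p = 0 := MvPolynomial.funext fun x => by rw [hp, hS0, map_zero, map_zero]
    rw [this, MvPolynomial.coeff_zero]
  have hdeg' : S'.totalDegree + 1 ≤ D := by
    rw [hS'X, MvPolynomial.totalDegree_mul_of_isDomain (MvPolynomial.X_ne_zero (none : Option σ)) hS0,
      MvPolynomial.totalDegree_X] at hdeg
    lia
  -- Setting the variable `none` equal to `1` cannot raise the degree; this is read off from growth.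
  have hpd : p.totalDegree ≤ S'.totalDegree := by
    refine totalDegree_le_of_pointwise p _ fun a ha => ?_
    obtain ⟨C, hC0, hC⟩ := abs_eval_le S'
    have := Fintype.ofFinite σ
    obtain ⟨B, hB⟩ : ∃ B : ℕ, ∀ i, a i ≤ B :=
      ⟨Finset.univ.sup a, fun i => Finset.le_sup (Finset.mem_univ i)⟩
    refine ⟨0, C * (B + 1) ^ S'.totalDegree, by positivity, fun n => ?_⟩
    rw [hp, mul_assoc, ← mul_pow]
    have hn : (0 : ℚ) ≤ n := Nat.cast_nonneg n
    have hB0 : (0 : ℚ) ≤ B := Nat.cast_nonneg B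
    refine hC _ _ (by push_cast; nlinarith) fun o => ?_
    cases o with
    | none => simp only [Option.elim_none, abs_one]; push_cast; nlinarith
    | some i =>
      have : (a i : ℚ) ≤ B := by exact_mod_cast hB i
      simp only [Option.elim_some, add_zero]
      rw [abs_of_nonneg (by positivity)]
      push_cast
      nlinarith
  refine MvPolynomial.coeff_eq_zero_of_totalDegree_lt ?_
  exact (hpd.trans_lt (Nat.lt_of_succ_le hdeg')).trans_le hd

end Growth

/-! ### Multigraded Hilbert functions -/

section HilbertPolynomial

variable {A : Type*} [CommRing A] {M : Type*} [AddCommGroup M] [Module A M]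
  {σ : Type*} [DecidableEq σ]

/-- The family `W` of submodules is stable under multiplication by the elements `a` of degree `i`,
for `(a, i) ∈ g`. -/
def IsStableFamily (g : Finset (A × σ)) (W : (σ → ℕ) → Submodule A M) : Prop :=
  ∀ p ∈ g, ∀ n, ∀ x ∈ W n, p.1 • x ∈ W (n + Pi.single p.2 1)

/-- The ascending chain condition for the stable families between `V` and `U`. -/
def IsNoetherianFamily (g : Finset (A × σ)) (U V : (σ → ℕ) → Submodule A M) : Prop :=
  WellFoundedGT {W : (σ → ℕ) → Submodule A M // V ≤ W ∧ W ≤ U ∧ IsStableFamily g W}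

theorem IsNoetherianFamily.mono {g g' : Finset (A × σ)} {U V U' V' : (σ → ℕ) → Submodule A M}
    (h : IsNoetherianFamily g U V)
    (h' : ∀ W, V' ≤ W → W ≤ U' → IsStableFamily g' W → V ≤ W ∧ W ≤ U ∧ IsStableFamily g W) :
    IsNoetherianFamily g' U' V' := by
  unfold IsNoetherianFamily at h ⊢
  let f : {W : (σ → ℕ) → Submodule A M // V' ≤ W ∧ W ≤ U' ∧ IsStableFamily g' W} →
      {W : (σ → ℕ) → Submodule A M // V ≤ W ∧ W ≤ U ∧ IsStableFamily g W} :=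
    fun W => ⟨W.1, h' W.1 W.2.1 W.2.2.1 W.2.2.2⟩
  have hf : StrictMono f := fun W W' hW => hW
  exact hf.wellFoundedGT

/-- If no generator has degree `i`, then a Noetherian family is concentrated in bounded degrees
with respect to `i`. -/
theorem IsNoetherianFamily.eventually_le {g : Finset (A × σ)} {U V : (σ → ℕ) → Submodule A M}
    (hVU : V ≤ U) (hU : IsStableFamily g U) (hV : IsStableFamily g V)
    (h : IsNoetherianFamily g U V) (i : σ) (hi : ∀ p ∈ g, p.2 ≠ i) :
    ∃ N, ∀ n : σ → ℕ, N ≤ n i → U n ≤ V n := by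
  unfold IsNoetherianFamily at h
  -- No generator changes the `i`-th degree, so truncation in that degree keeps stability. The chain
  -- condition makes the truncations stationary.
  let W : ℕ → (σ → ℕ) → Submodule A M := fun k n => if n i < k then U n else V n
  have hW : ∀ k, V ≤ W k ∧ W k ≤ U ∧ IsStableFamily g (W k) := by
    refine fun k => ⟨fun n => ?_, fun n => ?_, fun p hp n x hx => ?_⟩
    · by_cases hn : n i < k
      · simpa [W, hn] using hVU n
      · simp [W, hn]
    · by_cases hn : n i < k
      · simp [W, hn]
      · simpa [W, hn] using hVU n
    · have h1 : (n + Pi.single p.2 1 : σ → ℕ) i = n i := by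
        simp [Pi.single_eq_of_ne (hi p hp).symm]
      simp only [W, h1] at hx ⊢
      split_ifs at hx ⊢ with hn
      · exact hU p hp n x hx
      · exact hV p hp n x hx
  let f : ℕ →o {W : (σ → ℕ) → Submodule A M // V ≤ W ∧ W ≤ U ∧ IsStableFamily g W} :=
    ⟨fun k => ⟨W k, hW k⟩, fun k l hkl n => by
      change W k n ≤ W l n
      by_cases hn : n i < k
      · simp [W, hn, hn.trans_le hkl]
      · by_cases hn' : n i < l
        · simpa [W, hn, hn'] using hVU n
        · simp [W, hn, hn']⟩
  obtain ⟨N, hN⟩ := WellFoundedGT.monotone_chain_condition f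
  refine ⟨N, fun n hn => ?_⟩
  have h1 : W N = W (n i + 1) := congrArg Subtype.val (hN (n i + 1) (by lia))
  have h2 := congrFun h1 n
  simp only [W, not_lt.mpr hn, if_false, Nat.lt_succ_self, if_true] at h2
  exact h2.ge

theorem smul_mem_of_smul_mem {g : Finset (A × σ)} {U : (σ → ℕ) → Submodule A M}
    (hU : IsStableFamily g U) {p : A × σ} (hp : p ∈ g) {m n : σ → ℕ} (h : m + Pi.single p.2 1 = n)
    {x : M} (hx : x ∈ U m) : p.1 • x ∈ U n :=
  h ▸ hU p hp m x hx

/-- A multigraded Hilbert function of a Noetherian family is eventually polynomial. -/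
theorem eventuallyPolynomial_relLength [Fintype σ] (g : Finset (A × σ))
    (U V : (σ → ℕ) → Submodule A M) (hVU : V ≤ U) (hU : IsStableFamily g U)
    (hV : IsStableFamily g V) (hacc : IsNoetherianFamily g U V)
    (hfin : ∀ n, relLength (U n) (V n) ≠ ⊤) :
    EventuallyPolynomial fun n => ((relLength (U n) (V n)).toNat : ℚ) := by
  classical
  -- Induction on the number of generators, as for Hilbert's theorem: one generator is removed by
  -- passing to kernel and cokernel of its multiplication.
  obtain ⟨r, hr⟩ : ∃ r, g.card = r := ⟨_, rfl⟩
  induction r generalizing g U V with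
  | zero =>
    rw [Finset.card_eq_zero] at hr
    subst hr
    by_cases hσ : IsEmpty σ
    · refine ⟨MvPolynomial.C ((relLength (U 0) (V 0)).toNat : ℚ), 0, fun n _ => ?_⟩
      rw [MvPolynomial.eval_C, Subsingleton.elim n 0]
    · obtain ⟨i⟩ := not_isEmpty_iff.mp hσ
      obtain ⟨N, hN⟩ := hacc.eventually_le hVU hU hV i (by simp)
      exact ⟨0, N, fun n hn => by simp [relLength_eq_zero.mpr (hN n (hn i))]⟩
  | succ r ih =>
    by_cases hdir : ∃ i, ∀ p ∈ g, p.2 ≠ i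
    · obtain ⟨i, hi⟩ := hdir
      obtain ⟨N, hN⟩ := hacc.eventually_le hVU hU hV i hi
      exact ⟨0, N, fun n hn => by simp [relLength_eq_zero.mpr (hN n (hn i))]⟩
    · push Not at hdir
      refine EventuallyPolynomial.of_differences fun i => ?_
      obtain ⟨p, hp, rfl⟩ := hdir i
      set e : σ → ℕ := Pi.single p.2 1 with he
      let μ : M →ₗ[A] M := LinearMap.lsmul A M p.1
      have hμ : ∀ x, μ x = p.1 • x := fun x => rfl
      -- For multiplication by `p.1` on `U / V`, the kernel is `K / V` and the cokernel is `U / B`.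
      -- The supremum in `B` has at most one index, and none when `n` has no predecessor in this
      -- direction.
      let K : (σ → ℕ) → Submodule A M := fun n => U n ⊓ (V (n + e)).comap μ
      let B : (σ → ℕ) → Submodule A M := fun n => V n ⊔ ⨆ m : {m // m + e = n}, (U m.1).map μ
      have hVK : V ≤ K := fun n x hx => ⟨hVU n hx, hV p hp n x hx⟩
      have hKU : K ≤ U := fun n => inf_le_left
      have hVB : V ≤ B := fun n => le_sup_left
      have hBU : B ≤ U := by
        intro n
        refine sup_le (hVU n) (iSup_le ?_)
        rintro ⟨m, hm⟩ _ ⟨x, hx, rfl⟩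
        exact smul_mem_of_smul_mem hU hp hm hx
      have hmono : ∀ {W : (σ → ℕ) → Submodule A M}, IsStableFamily g W →
          IsStableFamily (g.erase p) W := fun hW q hq => hW q (Finset.mem_of_mem_erase hq)
      have hK : IsStableFamily (g.erase p) K := by
        intro q hq n x hx
        refine ⟨hmono hU q hq n x hx.1, ?_⟩
        have h1 : q.1 • p.1 • x ∈ V (n + e + Pi.single q.2 1) :=
          hmono hV q hq _ _ hx.2
        rw [smul_comm, add_right_comm] at h1
        exact h1
      have hB : IsStableFamily (g.erase p) B := by
        intro q hq n x hx
        suffices H : B n ≤ (B (n + Pi.single q.2 1)).comap (LinearMap.lsmul A M q.1) from H hx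
        refine sup_le (fun v hv => Submodule.mem_sup_left (hmono hV q hq n v hv)) (iSup_le ?_)
        rintro ⟨m, hm⟩ _ ⟨y, hy, rfl⟩
        refine Submodule.mem_sup_right (Submodule.mem_iSup_of_mem ⟨m + Pi.single q.2 1, ?_⟩ ?_)
        · rw [add_right_comm, hm]
        · exact ⟨q.1 • y, hmono hU q hq _ _ hy, smul_comm _ _ _⟩
      have hstab : ∀ {W : (σ → ℕ) → Submodule A M}, IsStableFamily (g.erase p) W →
          (∀ n, ∀ x ∈ W n, p.1 • x ∈ W (n + e)) → IsStableFamily g W := by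
        intro W hW h q hq
        by_cases hqp : q = p
        · subst hqp; exact h
        · exact hW q (Finset.mem_erase.mpr ⟨hqp, hq⟩)
      -- `p` acts as zero on kernel and cokernel, so stability under the remaining generators
      -- already implies stability under `p`, and the chain condition is inherited.
      have haccK : IsNoetherianFamily (g.erase p) K V := hacc.mono fun W h1 h2 h3 =>
        ⟨h1, h2.trans hKU, hstab h3 fun n x hx => h1 _ (h2 n hx).2⟩
      have haccB : IsNoetherianFamily (g.erase p) U B := hacc.mono fun W h1 h2 h3 =>
        ⟨hVB.trans h1, h2, hstab h3 fun n x hx => h1 _ (Submodule.mem_sup_right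
          (Submodule.mem_iSup_of_mem ⟨n, rfl⟩ ⟨x, h2 n hx, rfl⟩))⟩
      have hcard : (g.erase p).card = r := by rw [Finset.card_erase_of_mem hp, hr]; rfl
      have hfinK : ∀ n, relLength (K n) (V n) ≠ ⊤ := fun n =>
        ne_top_of_le_ne_top (hfin n) (relLength_mono_left (hKU n) _)
      have hfinUK : ∀ n, relLength (U n) (K n) ≠ ⊤ := fun n =>
        ne_top_of_le_ne_top (hfin n) (relLength_anti_right _ (hVK n))
      have hfinB : ∀ n, relLength (U n) (B n) ≠ ⊤ := fun n =>
        ne_top_of_le_ne_top (hfin n) (relLength_anti_right _ (hVB n))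
      have hKpoly := ih (g.erase p) K V hVK hK (hmono hV) haccK hfinK hcard
      have hBpoly := ih (g.erase p) U B hBU (hmono hU) hB haccB hfinB hcard
      have hBe : ∀ n, B (n + e) = (U n).map μ ⊔ V (n + e) := by
        intro n
        rw [sup_comm]
        refine le_antisymm (sup_le_sup_left (iSup_le ?_) _) (sup_le_sup_left ?_ _)
        · rintro ⟨m, hm⟩
          obtain rfl := add_right_cancel hm
          exact le_rfl
        · exact le_iSup_of_le ⟨n, rfl⟩ le_rfl
      -- Additivity of length on `0 → K/V → U/V → U/V → U/B → 0`, with degrees shifted by `e` in the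
      -- middle.
      have key : ∀ n, ((relLength (U (n + e)) (V (n + e))).toNat : ℚ) -
          ((relLength (U n) (V n)).toNat : ℚ) =
          ((relLength (U (n + e)) (B (n + e))).toNat : ℚ) -
          ((relLength (K n) (V n)).toNat : ℚ) := by
        intro n
        have h1 := relLength_add (hVK n) (hKU n)
        have h2 := relLength_add (hVB (n + e)) (hBU (n + e))
        have h3 : relLength (B (n + e)) (V (n + e)) = relLength (U n) (K n) := by
          rw [hBe, relLength_map_sup, relLength_inf]
        rw [h3] at h2
        rw [h1, h2, ENat.toNat_add (hfinUK n) (hfinK n), ENat.toNat_add (hfinB _) (hfinUK n)]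
        push_cast
        ring
      simp only [key]
      exact (hBpoly.shift e).sub hKpoly

end HilbertPolynomial

/-! ### Coefficients of elements of `M[t]` -/

section Coefficients

variable {A : Type*} [CommRing A] {s : ℕ} {M : Type*} [AddCommGroup M] [Module A M]

theorem moduleCoeff_monomial_tmul (n k : Fin s →₀ ℕ) (c : A) (m : M) :
    moduleCoeff M n (MvPolynomial.monomial k c ⊗ₜ[A] m) = if k = n then c • m else 0 := by
  classical
  rw [moduleCoeff_tmul, MvPolynomial.coeff_monomial]
  split_ifs <;> simp

theorem exists_eq_sum_monomial_tmul (x : MvPolynomial (Fin s) A ⊗[A] M) :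
    ∃ S : Finset (Fin s →₀ ℕ),
      x = ∑ n ∈ S, MvPolynomial.monomial n (1 : A) ⊗ₜ[A] moduleCoeff M n x := by
  classical
  -- Allowing every larger index set lets the sets of two summands be merged.
  suffices H : ∃ S : Finset (Fin s →₀ ℕ), ∀ S', S ⊆ S' →
      x = ∑ n ∈ S', MvPolynomial.monomial n (1 : A) ⊗ₜ[A] moduleCoeff M n x by
    obtain ⟨S, hS⟩ := H
    exact ⟨S, hS S subset_rfl⟩
  induction x with
  | zero => exact ⟨∅, fun S' _ => by simp⟩
  | tmul p m =>
    refine ⟨p.support, fun S' hS' => ?_⟩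
    simp only [moduleCoeff_tmul, ← TensorProduct.smul_tmul, MvPolynomial.smul_monomial, smul_eq_mul,
      mul_one]
    rw [← TensorProduct.sum_tmul]
    congr 1
    conv_lhs => rw [MvPolynomial.as_sum p]
    refine Finset.sum_subset hS' fun n _ hn => ?_
    rw [MvPolynomial.notMem_support_iff.mp hn, map_zero]
  | add x y hx hy =>
    obtain ⟨S, hS⟩ := hx
    obtain ⟨T, hT⟩ := hy
    refine ⟨S ∪ T, fun S' hS' => ?_⟩
    simp only [map_add, TensorProduct.tmul_add, Finset.sum_add_distrib]
    rw [← hS S' (Finset.union_subset_left hS'), ← hT S' (Finset.union_subset_right hS')]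

theorem eq_zero_of_moduleCoeff {x : MvPolynomial (Fin s) A ⊗[A] M}
    (h : ∀ n, moduleCoeff M n x = 0) : x = 0 := by
  obtain ⟨S, hS⟩ := exists_eq_sum_monomial_tmul x
  rw [hS]
  exact Finset.sum_eq_zero fun n _ => by rw [h, TensorProduct.tmul_zero]

/-- The homogeneous element `c Tⁿ` of the multi-Rees algebra. -/
noncomputable def reesMonomial {F : Fin s → IdealFiltration A} (n : Fin s →₀ ℕ) (c : A)
    (hc : c ∈ prodIdeal F n) : multiReesAlgebra F :=
  ⟨MvPolynomial.monomial n c, fun k => by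
    classical
    rw [MvPolynomial.coeff_monomial]
    split_ifs with h
    · exact h ▸ hc
    · exact zero_mem _⟩

theorem reesMonomial_smul_monomial_tmul {F : Fin s → IdealFiltration A} (n k : Fin s →₀ ℕ) (c : A)
    (hc : c ∈ prodIdeal F n) (m : M) :
    reesMonomial n c hc • (MvPolynomial.monomial k (1 : A) ⊗ₜ[A] m) =
      MvPolynomial.monomial (n + k) (1 : A) ⊗ₜ[A] (c • m) := by
  rw [Subalgebra.smul_def, TensorProduct.smul_tmul', reesMonomial, smul_eq_mul,
    MvPolynomial.monomial_mul, TensorProduct.tmul_smul, TensorProduct.smul_tmul',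
    MvPolynomial.smul_monomial, smul_eq_mul]

end Coefficients

/-! ### Multi-Rees algebras of powers of ideals -/

section AdicRees

variable {A : Type*} [CommRing A] {s : ℕ} {M : Type*} [AddCommGroup M] [Module A M]
  (Is : Fin s → Ideal A) (hIs : ∀ i, Is i ≠ ⊤)

/-- The filtrations by the powers of the ideals of a family. -/
abbrev adicFamily : Fin s → IdealFiltration A := fun i => adic (Is i) (hIs i)

theorem prodIdeal_adicFamily (n : Fin s → ℕ) :
    prodIdeal (adicFamily Is hIs) n = ∏ i, Is i ^ n i := rfl

/-- A multiplicative family of ideals that contains the generators contains all products. -/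
theorem prod_pow_le_of_mul_le (L : (Fin s →₀ ℕ) → Ideal A) (h0 : 1 ∈ L 0)
    (hmul : ∀ m n, L m * L n ≤ L (m + n)) (h1 : ∀ i, Is i ≤ L (Finsupp.single i 1))
    (n : Fin s →₀ ℕ) : ∏ i, Is i ^ n i ≤ L n := by
  classical
  have hpow : ∀ i k, Is i ^ k ≤ L (Finsupp.single i k) := by
    intro i k
    induction k with
    | zero =>
      rw [Finsupp.single_zero, (Ideal.eq_top_iff_one _).mpr h0]
      exact le_top
    | succ k ih =>
      rw [pow_succ, Finsupp.single_add]
      exact (Ideal.mul_mono ih (h1 i)).trans (hmul _ _)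
  have hT : ∀ T : Finset (Fin s), ∏ i ∈ T, Is i ^ n i ≤ L (∑ i ∈ T, Finsupp.single i (n i)) := by
    intro T
    induction T using Finset.induction_on with
    | empty =>
      rw [Finset.sum_empty, (Ideal.eq_top_iff_one _).mpr h0]
      exact le_top
    | insert i T hi ih =>
      rw [Finset.prod_insert hi, Finset.sum_insert hi]
      exact (Ideal.mul_mono (hpow i _) ih).trans (hmul _ _)
  simpa using hT Finset.univ

/-- The generators are the `c tᵢ` with `c` in a finite generating set of `Iᵢ`. -/
theorem multiReesAlgebra_adicFamily_fg [IsNoetherianRing A] :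
    (multiReesAlgebra (adicFamily Is hIs)).FG := by
  classical
  have hfg : ∀ i, ∃ S : Finset A, Ideal.span (S : Set A) = Is i := fun i =>
    (isNoetherianRing_iff_ideal_fg A).mp inferInstance (Is i)
  choose S hS using hfg
  let G : Finset (MvPolynomial (Fin s) A) :=
    Finset.univ.biUnion fun i => (S i).image (MvPolynomial.monomial (Finsupp.single i 1))
  refine ⟨G, le_antisymm (Algebra.adjoin_le ?_) ?_⟩
  · intro x hx
    simp only [G, Finset.coe_biUnion, Finset.coe_univ, Set.mem_univ, Set.iUnion_true,
      Set.mem_iUnion, Finset.coe_image, Set.mem_image, Finset.mem_coe] at hx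
    obtain ⟨i, c, hc, rfl⟩ := hx
    refine (reesMonomial (F := adicFamily Is hIs) (Finsupp.single i 1) c ?_).2
    rw [prodIdeal_adicFamily, Finset.prod_eq_single i]
    · rw [Finsupp.single_eq_same, pow_one, ← hS]
      exact Ideal.subset_span hc
    · intro j _ hj
      rw [Finsupp.single_eq_of_ne hj, pow_zero, Ideal.one_eq_top]
    · simp
  · intro x hx
    -- The coefficients admitted by the generated subalgebra in each degree form a multiplicative
    -- family of ideals.
    let L : (Fin s →₀ ℕ) → Ideal A := fun n =>
      (Subalgebra.toSubmodule (Algebra.adjoin A (G : Set (MvPolynomial (Fin s) A)))).comap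
        (MvPolynomial.monomial n)
    have hL : ∀ n c, c ∈ L n ↔
      MvPolynomial.monomial n c ∈ Algebra.adjoin A (G : Set (MvPolynomial (Fin s) A)) :=
      fun n c => Iff.rfl
    have key : ∀ n : Fin s →₀ ℕ, ∏ i, Is i ^ n i ≤ L n := by
      refine prod_pow_le_of_mul_le Is L ?_ ?_ ?_
      · rw [hL]
        exact one_mem _
      · intro m n
        rw [Ideal.mul_le]
        intro a ha b hb
        rw [hL] at ha hb ⊢
        rw [← MvPolynomial.monomial_mul]
        exact mul_mem ha hb
      · intro i
        rw [← hS i, Ideal.span_le]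
        intro c hc
        rw [SetLike.mem_coe, hL]
        refine Algebra.subset_adjoin ?_
        simp only [G, Finset.coe_biUnion, Finset.coe_univ, Set.mem_univ, Set.iUnion_true,
          Set.mem_iUnion, Finset.coe_image, Set.mem_image, Finset.mem_coe]
        exact ⟨i, c, hc, rfl⟩
    rw [MvPolynomial.as_sum x]
    exact sum_mem fun n _ => key n (hx n)

instance [IsNoetherianRing A] : Algebra.FiniteType A (multiReesAlgebra (adicFamily Is hIs)) :=
  (Subalgebra.fg_iff_finiteType _).mp (multiReesAlgebra_adicFamily_fg Is hIs)

instance [IsNoetherianRing A] : IsNoetherianRing (multiReesAlgebra (adicFamily Is hIs)) :=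
  Algebra.FiniteType.isNoetherianRing A _

/-- The elements of `M[t]` whose coefficient of `Tⁿ` lies in `𝕁^{n - N} M` form a submodule of
a finitely generated module over the multi-Rees algebra of `𝕁`. -/
theorem exists_fg_of_coeff_mem [Module.Finite A M] (N : Fin s →₀ ℕ) :
    ∃ B : Submodule (multiReesAlgebra (adicFamily Is hIs)) (MvPolynomial (Fin s) A ⊗[A] M),
      B.FG ∧ ∀ x, (∀ n : Fin s →₀ ℕ, moduleCoeff M n x ∈
        (∏ i, Is i ^ (n - N) i) • (⊤ : Submodule A M)) → x ∈ B := by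
  classical
  obtain ⟨S, hS⟩ := Module.Finite.fg_top (R := A) (M := M)
  -- The generators are `Tʲ m` with `j ≤ N` and `m` in a finite generating set of `M`. Degree `n` is
  -- reached from `j = n ⊓ N` through the algebra element of degree `n - N`.
  let G : Finset (MvPolynomial (Fin s) A ⊗[A] M) := (Finset.Iic N).biUnion fun j =>
    S.image fun m => MvPolynomial.monomial j (1 : A) ⊗ₜ[A] m
  let B := Submodule.span (multiReesAlgebra (adicFamily Is hIs))
    (G : Set (MvPolynomial (Fin s) A ⊗[A] M))
  have hB : ∀ j ≤ N, ∀ m : M, MvPolynomial.monomial j (1 : A) ⊗ₜ[A] m ∈ B := by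
    intro j hj m
    have h1 : Submodule.span A (S : Set M) ≤ (B.restrictScalars A).comap
        (TensorProduct.mk A _ M (MvPolynomial.monomial j (1 : A))) := by
      rw [Submodule.span_le]
      intro m hm
      refine Submodule.subset_span ?_
      simp only [G, Finset.coe_biUnion, Set.mem_iUnion, Finset.coe_image, Set.mem_image]
      exact ⟨j, by simpa using hj, m, hm, rfl⟩
    rw [hS] at h1
    exact h1 (Submodule.mem_top (x := m))
  refine ⟨B, ⟨G, rfl⟩, fun x hx => ?_⟩
  obtain ⟨T, hT⟩ := exists_eq_sum_monomial_tmul x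
  rw [hT]
  refine sum_mem fun n _ => ?_
  refine Submodule.smul_induction_on (hx n) (fun c hc m _ => ?_) fun y z hy hz => ?_
  · have h1 := reesMonomial_smul_monomial_tmul (F := adicFamily Is hIs) (n - N) (n ⊓ N) c hc m
    rw [show n - N + n ⊓ N = n by ext i; simp [tsub_add_min]] at h1
    rw [← h1]
    exact B.smul_mem _ (hB _ inf_le_right m)
  · rw [TensorProduct.tmul_add]
    exact add_mem hy hz

end AdicRees

/-! ### Hilbert polynomials for products of powers -/

section AdicHilbert

variable {A : Type*} [CommRing A] {s : ℕ} {M : Type*} [AddCommGroup M] [Module A M]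
  (Is : Fin s → Ideal A)

theorem IsStableFamily.smul_mem {g : Finset (A × Fin s)}
    (hg : ∀ i, Is i ≤ Ideal.span {a | (a, i) ∈ g}) {W : (Fin s → ℕ) → Submodule A M}
    (hW : IsStableFamily g W) (n m : Fin s →₀ ℕ) {c : A} (hc : c ∈ ∏ i, Is i ^ n i) {x : M}
    (hx : x ∈ W m) : c • x ∈ W ⇑(n + m) := by
  let L : (Fin s →₀ ℕ) → Ideal A := fun n =>
    { carrier := {c | ∀ m : Fin s →₀ ℕ, ∀ x ∈ W m, c • x ∈ W ⇑(n + m)}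
      add_mem' := fun ha hb m x hx => by rw [add_smul]; exact add_mem (ha m x hx) (hb m x hx)
      zero_mem' := fun m x _ => by rw [zero_smul]; exact zero_mem _
      smul_mem' := fun r c hc m x hx => by
        rw [smul_eq_mul, mul_smul]; exact Submodule.smul_mem _ _ (hc m x hx) }
  have hL : ∀ n c, c ∈ L n ↔ ∀ m : Fin s →₀ ℕ, ∀ x ∈ W m, c • x ∈ W ⇑(n + m) := fun _ _ => Iff.rfl
  refine prod_pow_le_of_mul_le Is L ?_ ?_ ?_ n hc m x hx
  · intro m x hx
    rwa [one_smul, zero_add]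
  · intro m n
    rw [Ideal.mul_le]
    intro a ha b hb k x hx
    rw [mul_smul, add_assoc]
    exact ha _ _ (hb _ _ hx)
  · intro i
    refine (hg i).trans (Ideal.span_le.mpr fun a ha => ?_)
    rw [SetLike.mem_coe, hL]
    intro m x hx
    rw [add_comm, Finsupp.coe_add, Finsupp.single_eq_pi_single]
    exact hW (a, i) ha m x hx

theorem wellFoundedGT_Iic_of_fg {R T : Type*} [CommRing R] [IsNoetherianRing R] [AddCommGroup T]
    [Module R T] {B : Submodule R T} (hB : B.FG) : WellFoundedGT (Set.Iic B) := by
  have hN : IsNoetherian R B := isNoetherian_of_fg_of_noetherian B hB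
  exact B.mapIic.symm.strictMono.wellFoundedGT

/-- A stable family below `𝕁ⁿ M` is the family of homogeneous parts of a submodule over the
multi-Rees algebra, contained in one finitely generated module. The chain condition comes from that
Noetherian module. -/
theorem isNoetherianFamily_of_le [IsNoetherianRing A] [Module.Finite A M] (hIs : ∀ i, Is i ≠ ⊤)
    {g : Finset (A × Fin s)} (hg : ∀ i, Is i ≤ Ideal.span {a | (a, i) ∈ g})
    (U V : (Fin s → ℕ) → Submodule A M) (hU : ∀ n, U n ≤ (∏ i, Is i ^ n i) • ⊤) :
    IsNoetherianFamily g U V := by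
  obtain ⟨B, hBfg, hB⟩ := exists_fg_of_coeff_mem (M := M) Is hIs 0
  have hN := wellFoundedGT_Iic_of_fg hBfg
  let f : {W : (Fin s → ℕ) → Submodule A M // V ≤ W ∧ W ≤ U ∧ IsStableFamily g W} →
      Set.Iic B := fun W =>
    ⟨{
        carrier := {x | ∀ n : Fin s →₀ ℕ, moduleCoeff M n x ∈ W.1 n}
        add_mem' := fun hx hy n => by rw [map_add]; exact add_mem (hx n) (hy n)
        zero_mem' := fun n => by rw [map_zero]; exact zero_mem _
        smul_mem' := fun c x hx n => by
          rw [Subalgebra.smul_def, moduleCoeff_smul]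
          refine sum_mem fun ij hij => ?_
          rw [← Finset.HasAntidiagonal.mem_antidiagonal.mp hij]
          exact W.2.2.2.smul_mem Is hg _ _ (c.2 _) (hx _) },
      fun x hx => hB x fun n => by
        rw [tsub_zero]
        exact hU n (W.2.2.1 n (hx n))⟩
  have hf : ∀ W x, x ∈ (f W).1 ↔ ∀ n : Fin s →₀ ℕ, moduleCoeff M n x ∈ W.1 n :=
    fun _ _ => Iff.rfl
  have hmono : Monotone f := fun W W' h x hx n => h n (hx n)
  have hinj : Function.Injective f := by
    have hle : ∀ W W', f W = f W' → W ≤ W' := by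
      intro W W' h n m hm
      let k := Finsupp.equivFunOnFinite.symm n
      have h1 : MvPolynomial.monomial k (1 : A) ⊗ₜ[A] m ∈ (f W).1 := by
        rw [hf]
        intro j
        rw [moduleCoeff_monomial_tmul, one_smul]
        split_ifs with hj
        · subst hj
          exact hm
        · exact zero_mem _
      rw [h, hf] at h1
      have h2 := h1 k
      rw [moduleCoeff_monomial_tmul, one_smul, if_pos rfl] at h2
      exact h2
    exact fun W W' h => le_antisymm (hle W W' h) (hle W' W h.symm)
  exact (hmono.strictMono_of_injective hinj).wellFoundedGT

theorem prod_pow_add_single (n : Fin s → ℕ) (i : Fin s) :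
    ∏ j, Is j ^ (n + Pi.single i 1 : Fin s → ℕ) j = Is i * ∏ j, Is j ^ n j := by
  classical
  rw [mul_comm]
  simp only [Pi.add_apply, pow_add, Finset.prod_mul_distrib]
  congr 1
  rw [Finset.prod_eq_single i]
  · simp
  · intro j _ hj
    simp [hj]
  · simp

/-- The function `n ↦ ℓ(𝕁ⁿ X / 𝔟 𝕁ⁿ X)` is eventually polynomial. -/
theorem eventuallyPolynomial_adic [IsNoetherianRing A] [Module.Finite A M]
    (hIs : ∀ i, Is i ≠ ⊤) (𝔟 : Ideal A) (X : Submodule A M)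
    (hfin : ∀ n : Fin s → ℕ,
      relLength ((∏ i, Is i ^ n i) • X) (𝔟 • (∏ i, Is i ^ n i) • X) ≠ ⊤) :
    EventuallyPolynomial fun n : Fin s → ℕ =>
      ((relLength ((∏ i, Is i ^ n i) • X) (𝔟 • (∏ i, Is i ^ n i) • X)).toNat : ℚ) := by
  classical
  have hfg : ∀ i, ∃ S : Finset A, Ideal.span (S : Set A) = Is i := fun i =>
    (isNoetherianRing_iff_ideal_fg A).mp inferInstance (Is i)
  choose S hS using hfg
  let g : Finset (A × Fin s) := Finset.univ.biUnion fun i => (S i).image fun a => (a, i)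
  have hmem : ∀ p : A × Fin s, p ∈ g ↔ p.1 ∈ S p.2 := by
    rintro ⟨a, i⟩
    simp [g]
  have hg : ∀ i, Is i ≤ Ideal.span {a | (a, i) ∈ g} := by
    intro i
    rw [← hS i]
    exact Ideal.span_mono fun a ha => (hmem (a, i)).mpr ha
  have hgI : ∀ p ∈ g, p.1 ∈ Is p.2 := by
    intro p hp
    rw [← hS]
    exact Ideal.subset_span ((hmem p).mp hp)
  have hst : IsStableFamily g fun n => (∏ i, Is i ^ n i) • X := by
    intro p hp n x hx
    beta_reduce
    rw [prod_pow_add_single, mul_smul]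
    exact Submodule.smul_mem_smul (hgI p hp) hx
  refine eventuallyPolynomial_relLength g _ _ (fun n => Submodule.smul_le_right) hst ?_
    (isNoetherianFamily_of_le Is hIs hg _ _ fun n => smul_mono_right _ le_top) hfin
  intro p hp n x hx
  beta_reduce
  rw [prod_pow_add_single, mul_smul, ← mul_smul, mul_comm, mul_smul]
  exact Submodule.smul_mem_smul (hgI p hp) hx

end AdicHilbert

/-! ### Lengths modulo powers of elements -/

section SystemOfParameters

variable {R : Type*} [CommRing R] {X : Type*} [AddCommGroup X] [Module R X]
  {Y : Type*} [AddCommGroup Y] [Module R Y]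

theorem relLength_map_le (f : X →ₗ[R] Y) (U V : Submodule R X) (W : Submodule R Y)
    (h : V ≤ W.comap f) : relLength (U.map f) W ≤ relLength U V := by
  rw [← relLength_sup_right, relLength_map_sup]
  exact relLength_anti_right U h

/-- In the chain of the `xᵐ X`, taken modulo `W`, every step is a quotient of `X / (xX + W)`. -/
theorem relLength_top_pow_sup_le (x : R) (W : Submodule R X) (n : ℕ) :
    relLength ⊤ ((⊤ : Submodule R X).map (LinearMap.lsmul R X (x ^ n)) ⊔ W) ≤
      n * relLength ⊤ ((⊤ : Submodule R X).map (LinearMap.lsmul R X x) ⊔ W) := by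
  let Z : ℕ → Submodule R X := fun m => (⊤ : Submodule R X).map (LinearMap.lsmul R X (x ^ m))
  have hZ : Antitone Z := by
    refine antitone_nat_of_succ_le fun m => ?_
    rintro _ ⟨v, -, rfl⟩
    exact ⟨x • v, trivial, by simp [pow_succ, mul_smul, smul_comm x]⟩
  have h0 : Z 0 = ⊤ := by
    refine top_unique fun v _ => ⟨v, trivial, by simp⟩
  have h1 := sum_relLength_succ Z hZ W n
  rw [h0] at h1
  rw [← h1]
  refine (Finset.sum_le_card_nsmul _ _
    (relLength ⊤ ((⊤ : Submodule R X).map (LinearMap.lsmul R X x) ⊔ W)) fun m _ => ?_).trans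
    (by simp)
  refine relLength_map_le _ _ _ _ (sup_le ?_ fun v hv => ?_)
  · rintro _ ⟨v, -, rfl⟩
    exact Submodule.mem_sup_left ⟨v, trivial, by simp [pow_succ, mul_smul, smul_comm x]⟩
  · exact Submodule.mem_sup_right (W.smul_mem _ hv)

theorem relLength_top_iSup_pow_le (T : Finset R) (W : Submodule R X) (n : ℕ) :
    relLength ⊤ ((⨆ x ∈ T, (⊤ : Submodule R X).map (LinearMap.lsmul R X (x ^ n))) ⊔ W) ≤
      (n : ℕ∞) ^ T.card *
        relLength ⊤ ((⨆ x ∈ T, (⊤ : Submodule R X).map (LinearMap.lsmul R X x)) ⊔ W) := by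
  classical
  induction T using Finset.induction_on generalizing W with
  | empty => simp
  | insert x T hx ih =>
    rw [Finset.iSup_insert, Finset.iSup_insert, sup_assoc, sup_assoc,
      Finset.card_insert_of_notMem hx, pow_succ', mul_assoc]
    refine (relLength_top_pow_sup_le x _ n).trans ?_
    gcongr
    rw [sup_left_comm (Submodule.map (LinearMap.lsmul R X x) ⊤),
      sup_left_comm (Submodule.map (LinearMap.lsmul R X x) ⊤)]
    exact ih _

theorem relLength_smul_eq_top (X' : Submodule R X) (𝔠 : Ideal R) :
    relLength X' (𝔠 • X') = relLength (⊤ : Submodule R X') (𝔠 • ⊤) := by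
  rw [← relLength_map_of_injective X'.subtype X'.subtype_injective, Submodule.map_smul'',
    Submodule.map_subtype_top]

/-- Elements outside `𝔪` are units modulo its powers. This replaces localization at `𝔪`, which
matters for multi-Rees algebras as they need not be local. -/
theorem exists_mul_sub_one_mem_pow (𝔪 : Ideal R) [𝔪.IsMaximal] {y : R} (hy : y ∉ 𝔪) (n : ℕ) :
    ∃ z, z * y - 1 ∈ 𝔪 ^ n := by
  obtain ⟨z, i, hi, hz⟩ := Ideal.IsMaximal.exists_inv (I := 𝔪) inferInstance hy
  have h1 : IsCoprime (Ideal.span {y}) (𝔪 ^ n) := by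
    refine IsCoprime.pow_right ?_
    rw [Ideal.isCoprime_iff_exists]
    exact ⟨z * y, Ideal.mul_mem_left _ _ (Ideal.mem_span_singleton_self y), i, hi, hz⟩
  obtain ⟨a, ha, b, hb, hab⟩ := Ideal.isCoprime_iff_exists.mp h1
  obtain ⟨z, rfl⟩ := Ideal.mem_span_singleton'.mp ha
  refine ⟨z, ?_⟩
  rw [← hab, sub_add_cancel_left]
  exact neg_mem hb

end SystemOfParameters

/-! ### Finite length from powers of a maximal ideal -/

section FiniteLength

variable {R : Type*} [CommRing R] [IsNoetherianRing R] {X : Type*} [AddCommGroup X] [Module R X]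

theorem length_ne_top_of_isTorsionBySet [Module.Finite R X] (𝔪 : Ideal R) [𝔪.IsMaximal]
    (h : Module.IsTorsionBySet R X 𝔪) : Module.length R X ≠ ⊤ := by
  let := h.module
  let := Ideal.Quotient.field 𝔪
  have : Module.Finite (R ⧸ 𝔪) X := Module.Finite.of_restrictScalars_finite R _ _
  rw [Module.length_eq_of_surjective (R := R ⧸ 𝔪) (S := R) Ideal.Quotient.mk_surjective]
  have : IsArtinian (R ⧸ 𝔪) X := inferInstance
  exact Module.length_ne_top

variable [Module.Finite R X]

theorem relLength_ne_top (𝔪 : Ideal R) [𝔪.IsMaximal] (n : ℕ) {U V : Submodule R X}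
    (h : 𝔪 ^ n • U ≤ V) : relLength U V ≠ ⊤ := by
  refine ne_top_of_le_ne_top ?_ (relLength_anti_right U h)
  clear h
  induction n with
  | zero =>
    rw [pow_zero, Ideal.one_eq_top, Submodule.top_smul, relLength_eq_zero.mpr le_rfl]
    exact ENat.zero_ne_top
  | succ n ih =>
    have h1 : 𝔪 ^ (n + 1) • U ≤ 𝔪 ^ n • U := Submodule.smul_mono_left (Ideal.pow_le_pow_right n.le_succ)
    rw [relLength_add h1 Submodule.smul_le_right]
    refine WithTop.add_ne_top.mpr ⟨ih, ?_⟩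
    refine length_ne_top_of_isTorsionBySet 𝔪 ?_
    rintro x ⟨a, ha⟩
    obtain ⟨x, rfl⟩ := Submodule.Quotient.mk_surjective _ x
    change Submodule.Quotient.mk (a • x) = 0
    rw [Submodule.Quotient.mk_eq_zero]
    change a • (x : X) ∈ 𝔪 ^ (n + 1) • U
    rw [pow_succ', mul_smul]
    exact Submodule.smul_mem_smul ha x.2

end FiniteLength

/-! ### Growth of Hilbert–Samuel functions -/

section Growth

variable {R : Type*} [CommRing R] [IsNoetherianRing R] {X : Type*} [AddCommGroup X] [Module R X]
  [Module.Finite R X]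

/-- In a Noetherian ring, a prime ideal that contains the annihilator of `X` is minimal over
`(x₁, …, x_d) + Ann X` for some elements, where `d = dim X`. -/
theorem exists_finset_mem_minimalPrimes (𝔪 : Ideal R) [𝔪.IsPrime]
    (h : Module.annihilator R X ≤ 𝔪) (d : ℕ) (hd : Module.supportDim R X ≤ d) :
    ∃ T : Finset R, T.card ≤ d ∧
      𝔪 ∈ (Ideal.span (T : Set R) ⊔ Module.annihilator R X).minimalPrimes := by
  classical
  set 𝔞 := Module.annihilator R X
  have hp : (𝔪.map (Ideal.Quotient.mk 𝔞)).IsPrime :=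
    Ideal.map_isPrime_of_surjective Ideal.Quotient.mk_surjective (by rwa [Ideal.mk_ker])
  -- The converse of Krull's height theorem in `R / Ann X`, where the height of `𝔪` is at most `dim
  -- X`.
  obtain ⟨S, hS, hcard⟩ :=
    (𝔪.map (Ideal.Quotient.mk 𝔞)).exists_finset_card_eq_height_of_isNoetherianRing
  let T : Finset R := S.image (Function.surjInv Ideal.Quotient.mk_surjective)
  have hTS : T.image (Ideal.Quotient.mk 𝔞) = S := by
    rw [Finset.image_image]
    refine (Finset.image_congr fun x _ => ?_).trans Finset.image_id
    exact Function.surjInv_eq Ideal.Quotient.mk_surjective x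
  refine ⟨T, Finset.card_image_le.trans ?_, ?_⟩
  · have h1 : ((𝔪.map (Ideal.Quotient.mk 𝔞)).height : WithBot ℕ∞) ≤ d :=
      Ideal.height_le_ringKrullDim_of_isPrime.trans
        ((Module.supportDim_eq_ringKrullDim_quotient_annihilator R X).symm.trans_le hd)
    rw [← hcard] at h1
    exact_mod_cast h1
  · have h1 := Ideal.minimalPrimes_comap_of_surjective
      (Ideal.Quotient.mk_surjective (I := 𝔞)) hS
    rw [Ideal.comap_map_of_surjective _ Ideal.Quotient.mk_surjective, ← RingHom.ker_eq_comap_bot,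
      Ideal.mk_ker, sup_of_le_left h, ← hTS, Finset.coe_image, ← Ideal.map_span,
      Ideal.comap_map_of_surjective _ Ideal.Quotient.mk_surjective, ← RingHom.ker_eq_comap_bot,
      Ideal.mk_ker] at h1
    exact h1

/-- In the local ring at `𝔪` the extension of `I` has the maximal ideal as its radical, so it
contains a power of it; then denominators are cleared. -/
theorem exists_pow_mul_mem_of_mem_minimalPrimes (𝔪 I : Ideal R) [𝔪.IsPrime]
    (h : 𝔪 ∈ I.minimalPrimes) : ∃ K : ℕ, ∀ r ∈ 𝔪 ^ K, ∃ y ∉ 𝔪, y * r ∈ I := by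
  let L := Localization.AtPrime 𝔪
  have h1 := IsLocalization.AtPrime.radical_map_of_mem_minimalPrimes L 𝔪 I h
  have h2 : 𝔪 ≤ ((I.map (algebraMap R L)).comap (algebraMap R L)).radical := by
    rw [← Ideal.comap_radical, h1]
    exact Ideal.le_comap_map
  obtain ⟨K, hK⟩ := Ideal.exists_pow_le_of_le_radical_of_fg h2 (IsNoetherian.noetherian 𝔪)
  refine ⟨K, fun r hr => ?_⟩
  have h3 := hK hr
  rw [Ideal.mem_comap, IsLocalization.algebraMap_mem_map_algebraMap_iff 𝔪.primeCompl] at h3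
  exact h3

/-- The Hilbert–Samuel function grows at most like `n ^ dim X`. -/
theorem relLength_top_pow_smul_le (𝔪 𝔞 : Ideal R) [𝔪.IsMaximal] (c : ℕ)
    (hc : 𝔪 ^ c ≤ 𝔞) (d : ℕ) (hd : Module.supportDim R X ≤ d) :
    ∃ C : ℕ, ∀ n : ℕ, relLength (⊤ : Submodule R X) (𝔞 ^ n • ⊤) ≤ (C * n ^ d : ℕ) ∨ n = 0 := by
  classical
  have hcn : ∀ n, 𝔪 ^ (c * n) ≤ 𝔞 ^ n := fun n => by
    rw [pow_mul]; exact Ideal.pow_right_mono hc n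
  by_cases hann : Module.annihilator R X ≤ 𝔪
  · obtain ⟨T, hT, hTmin⟩ := exists_finset_mem_minimalPrimes 𝔪 hann d hd
    obtain ⟨K, hK⟩ := exists_pow_mul_mem_of_mem_minimalPrimes 𝔪 _ hTmin
    obtain ⟨C, hC⟩ := ENat.ne_top_iff_exists.mp
      (relLength_ne_top (X := X) 𝔪 K (le_refl (𝔪 ^ K • ⊤)))
    -- The bound `C = ℓ(X / 𝔪ᴷ X)` does not depend on `n`: for `r ∈ 𝔪ᴷ` some `y ∉ 𝔪` brings `yr`
    -- into `(T) + Ann X`, and `y` is invertible modulo `𝔪^{cn} ⊆ 𝔞ⁿ`.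
    have hCn : ∀ n, relLength ⊤ ((⨆ x ∈ T, (⊤ : Submodule R X).map (LinearMap.lsmul R X x)) ⊔
        𝔞 ^ n • ⊤) ≤ C := by
      intro n
      rw [hC]
      refine relLength_anti_right _ (Submodule.smul_le.mpr fun r hr v _ => ?_)
      obtain ⟨y, hy, hyr⟩ := hK r hr
      obtain ⟨z, hz⟩ := exists_mul_sub_one_mem_pow 𝔪 hy (c * n)
      have h1 : r • v = z • (y * r) • v - (z * y - 1) • r • v := by
        simp only [smul_smul, ← sub_smul]
        ring_nf
      rw [h1]
      refine sub_mem (Submodule.smul_mem _ _ ?_)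
        (Submodule.mem_sup_right (Submodule.smul_mem_smul (hcn n hz) trivial))
      obtain ⟨a, ha, b, hb, hab⟩ := Submodule.mem_sup.mp hyr
      rw [← hab, add_smul, Module.mem_annihilator.mp hb, add_zero]
      refine Submodule.mem_sup_left ?_
      have h2 : Ideal.span (T : Set R) ≤ (⨆ x ∈ T, (⊤ : Submodule R X).map
          (LinearMap.lsmul R X x)).comap (LinearMap.toSpanSingleton R X v) := by
        rw [Ideal.span_le]
        intro x hx
        exact Submodule.mem_iSup_of_mem x (Submodule.mem_iSup_of_mem hx ⟨v, trivial, rfl⟩)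
      exact h2 ha
    refine ⟨c ^ T.card * C, fun n => ?_⟩
    by_cases hn : n = 0
    · exact Or.inr hn
    left
    -- With exponent `c * n` the powers of the parameters lie in `𝔞ⁿ`, so the supremum is absorbed
    -- and the length of `X / 𝔞ⁿX` remains.
    have h3 := relLength_top_iSup_pow_le T (𝔞 ^ n • ⊤ : Submodule R X) (c * n)
    have h4 : (⨆ x ∈ T, (⊤ : Submodule R X).map (LinearMap.lsmul R X (x ^ (c * n)))) ≤
        𝔞 ^ n • ⊤ := by
      refine iSup₂_le fun x hx => ?_
      rintro _ ⟨v, -, rfl⟩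
      refine Submodule.smul_mem_smul (hcn n (Ideal.pow_mem_pow ?_ _)) trivial
      exact hTmin.1.2 (Ideal.mem_sup_left (Ideal.subset_span hx))
    rw [sup_of_le_right h4] at h3
    refine h3.trans ((mul_le_mul_right (hCn n) _).trans ?_)
    have h5 : (c * n) ^ T.card * C ≤ c ^ T.card * C * n ^ d := by
      rw [mul_pow, mul_right_comm]
      exact Nat.mul_le_mul_left _ (Nat.pow_le_pow_right (Nat.pos_of_ne_zero hn) hT)
    exact_mod_cast h5
  -- Here `Ann X` contains a unit modulo every power of `𝔪`, so `𝔞ⁿ X = X`.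
  · refine ⟨0, fun n => Or.inl ?_⟩
    obtain ⟨y, hy, hym⟩ := SetLike.not_le_iff_exists.mp hann
    rw [relLength_eq_zero.mpr]
    · exact bot_le
    · intro v _
      obtain ⟨z, hz⟩ := exists_mul_sub_one_mem_pow 𝔪 hym (c * n)
      have h1 : v = - ((z * y - 1) • v) := by
        rw [sub_smul, one_smul, mul_smul, Module.mem_annihilator.mp hy, smul_zero]
        simp
      rw [h1]
      exact neg_mem (Submodule.smul_mem_smul (hcn n hz) trivial)

end Growth

/-! ### Artin–Rees lemmas -/

section ArtinRees

theorem exists_inf_pow_smul_le {R : Type*} [CommRing R] [IsNoetherianRing R] {T : Type*}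
    [AddCommGroup T] [Module R T] (𝔠 : Ideal R) {X Y : Submodule R T} (hXY : X ≤ Y)
    (hY : Y.FG) : ∃ κ, ∀ h, X ⊓ 𝔠 ^ (h + κ) • Y ≤ 𝔠 ^ h • X := by
  have : Module.Finite R Y := Module.Finite.iff_fg.mpr hY
  obtain ⟨κ, hκ⟩ := Ideal.exists_pow_inf_eq_pow_smul 𝔠 (X.submoduleOf Y)
  refine ⟨κ, fun h x hx => ?_⟩
  obtain ⟨hx1, hx2⟩ := hx
  have h2 : (⟨x, hXY hx1⟩ : Y) ∈ 𝔠 ^ (h + κ) • (⊤ : Submodule R Y) := by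
    have h1 : x ∈ (𝔠 ^ (h + κ) • (⊤ : Submodule R Y)).map Y.subtype := by
      rw [Submodule.map_smul'', Submodule.map_subtype_top]
      exact hx2
    obtain ⟨y, hy, rfl⟩ := h1
    exact hy
  have h3 : (⟨x, hXY hx1⟩ : Y) ∈ 𝔠 ^ (h + κ) • (⊤ : Submodule R Y) ⊓ X.submoduleOf Y :=
    ⟨h2, hx1⟩
  rw [hκ _ (Nat.le_add_left _ _), Nat.add_sub_cancel] at h3
  have hle : 𝔠 ^ h • (𝔠 ^ κ • ⊤ ⊓ X.submoduleOf Y) ≤ 𝔠 ^ h • X.submoduleOf Y :=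
    smul_mono_right _ inf_le_right
  have h4 := hle h3
  have h5 := Submodule.mem_map_of_mem (f := Y.subtype) h4
  rw [Submodule.map_smul''] at h5
  refine (smul_mono_right _ ?_ : 𝔠 ^ h • (X.submoduleOf Y).map Y.subtype ≤ _) h5
  rintro _ ⟨v, hv, rfl⟩
  exact hv

variable {A : Type*} [CommRing A] {M : Type*} [AddCommGroup M] [Module A M]

/-- The submodules `Jᵏ 𝔞ⁱ N` form an `𝔞`-filtration, whose Rees module contains the products in
question. -/
theorem coeff_mem_of_mem_map_pow_smul (𝔞 J : Ideal A) (k : ℕ) (N : Submodule A M)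
    {f : PolynomialModule A M}
    (hf : f ∈ (J.map (algebraMap A (reesAlgebra 𝔞))) ^ k • (𝔞.stableFiltration N).submodule)
    (i : ℕ) : f.coeff i ∈ J ^ k • 𝔞 ^ i • N := by
  rw [← Ideal.map_pow] at hf
  let G : 𝔞.Filtration M :=
    { N := fun i => J ^ k • 𝔞 ^ i • N
      mono := fun i => smul_mono_right _ ((𝔞.stableFiltration N).mono i)
      smul_le := fun i => by
        rw [smul_comm]
        exact smul_mono_right _ ((𝔞.stableFiltration N).smul_le i) }
  have h : (J ^ k).map (algebraMap A (reesAlgebra 𝔞)) • (𝔞.stableFiltration N).submodule ≤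
      G.submodule := by
    refine Submodule.smul_le.mpr fun r hr p hp => ?_
    have h1 : (J ^ k).map (algebraMap A (reesAlgebra 𝔞)) ≤
        G.submodule.comap (LinearMap.toSpanSingleton (reesAlgebra 𝔞) _ p) := by
      refine Ideal.map_le_iff_le_comap.mpr fun a ha i => ?_
      rw [LinearMap.toSpanSingleton_apply]
      refine (congr_arg (· ∈ G.N i) ?_).mpr (Submodule.smul_mem_smul ha (hp i))
      exact congr_arg (fun q => PolynomialModule.coeff q i) (algebraMap_smul (Polynomial A) a p)
    exact h1 hr
  exact h hf i

variable [IsNoetherianRing A] [Module.Finite A M]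

/-- A uniform version of the Artin–Rees lemma for the modules `𝔞ⁿ X ⊆ 𝔞ⁿ Y`. -/
theorem exists_uniform_artinRees (𝔞 J : Ideal A) {X Y : Submodule A M} (hXY : X ≤ Y) :
    ∃ κ, ∀ n h, (𝔞 ^ n • X) ⊓ (J ^ (h + κ) • 𝔞 ^ n • Y) ≤ J ^ h • 𝔞 ^ n • X := by
  have hfg : (𝔞.stableFiltration Y).submodule.FG := (Ideal.Filtration.submodule_fg_iff_stable _
    fun i => IsNoetherian.noetherian _).mpr (𝔞.stableFiltration_stable Y)
  have hle : (𝔞.stableFiltration X).submodule ≤ (𝔞.stableFiltration Y).submodule :=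
    fun f hf i => smul_mono_right _ hXY (hf i)
  -- Ordinary Artin–Rees over the Rees algebra of `𝔞`, for `⨁ 𝔞ⁿX ⊆ ⨁ 𝔞ⁿY`. One graded module
  -- contains all degrees, which makes `κ` independent of `n`.
  obtain ⟨κ, hκ⟩ := exists_inf_pow_smul_le (J.map (algebraMap A (reesAlgebra 𝔞))) hle hfg
  have hsingle : ∀ n (N : Submodule A M) x, x ∈ 𝔞 ^ n • N →
      PolynomialModule.single A n x ∈ (𝔞.stableFiltration N).submodule := by
    intro n N x hx i
    rw [PolynomialModule.coeff_single, Finsupp.single_apply]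
    split_ifs with h
    · subst h; exact hx
    · exact zero_mem _
  refine ⟨κ, fun n h x hx => ?_⟩
  have h1 : PolynomialModule.single A n x ∈
      (J.map (algebraMap A (reesAlgebra 𝔞))) ^ (h + κ) • (𝔞.stableFiltration Y).submodule := by
    have h2 := hx.2
    refine Submodule.smul_induction_on h2 (fun r hr y hy => ?_) fun y z hy hz => ?_
    · have h3 : PolynomialModule.single A n (r • y) =
          algebraMap A (reesAlgebra 𝔞) r • PolynomialModule.single A n y := by
        rw [PolynomialModule.single_smul]
        exact (algebraMap_smul (Polynomial A) r _).symm
      rw [h3]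
      refine Submodule.smul_mem_smul ?_ (hsingle n Y y hy)
      rw [← Ideal.map_pow]
      exact Ideal.mem_map_of_mem _ hr
    · rw [PolynomialModule.single_add]
      exact add_mem hy hz
  have h4 := coeff_mem_of_mem_map_pow_smul 𝔞 J h X (hκ h ⟨hsingle n X x hx.1, h1⟩) n
  rwa [PolynomialModule.coeff_single, Finsupp.single_eq_same] at h4

/-- A linear Artin–Rees lemma for products of powers. -/
theorem exists_linear_artinRees (𝔞 J : Ideal A) (X : Submodule A M) :
    ∃ κ, ∀ m h, (𝔞 ^ m • X) ⊓ (J ^ (h + κ * m) • X) ≤ J ^ h • 𝔞 ^ m • X := by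
  obtain ⟨κ, hκ⟩ := exists_uniform_artinRees 𝔞 J (Submodule.smul_le_right : 𝔞 • X ≤ X)
  refine ⟨κ, fun m => ?_⟩
  induction m with
  | zero => intro h; simp
  | succ m ih =>
    intro h
    have h1 : 𝔞 ^ (m + 1) • X ≤ 𝔞 ^ m • X := Submodule.smul_mono_left (Ideal.pow_le_pow_right m.le_succ)
    intro x hx
    -- Every further factor `𝔞` costs `κ` powers of `J`, whence the linear term `κ * m`.
    have h2 := ih (h + κ) ⟨h1 hx.1, by
      have := hx.2
      rwa [show h + κ * (m + 1) = h + κ + κ * m by ring] at this⟩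
    have h3 := hκ m h ⟨by rw [smul_smul, ← pow_succ]; exact hx.1, h2⟩
    rwa [smul_smul (𝔞 ^ m), ← pow_succ] at h3

end ArtinRees

/-! ### Length estimates for `𝔞ⁿX` modulo powers of `J` -/

section LengthEstimates

variable {A : Type*} [CommRing A] {M : Type*} [AddCommGroup M] [Module A M]

theorem relLength_le_add_of_le {X Y V W : Submodule A M} (hWV : W ≤ V) :
    relLength X V ≤ relLength X (Y ⊔ V) + relLength Y W := by
  refine (relLength_le_add X (Y ⊔ V) V).trans ?_
  rw [relLength_sup_right]
  gcongr
  exact relLength_anti_right _ hWV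

/-- `Y / (Y ∩ V)` embeds into `X / V`, and `Y ∩ V` is confined to `Z`. In the application Artin–Rees
supplies a `Z` close to `W`. -/
theorem relLength_le_add_of_inf_le {X Y V W Z : Submodule A M} (hYX : Y ≤ X) (hZ : Y ⊓ V ≤ Z) :
    relLength Y W ≤ relLength X V + relLength Z W := by
  refine (relLength_le_add Y (Y ⊓ V) W).trans ?_
  rw [relLength_inf]
  exact add_le_add (relLength_mono_left hYX V) (relLength_mono_left hZ W)

variable [IsNoetherianRing A] [Module.Finite A M]

theorem exists_relLength_pow_smul_le (𝔪 J : Ideal A) [𝔪.IsMaximal] {c₀ : ℕ} (hJ : 𝔪 ^ c₀ ≤ J)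
    {X : Submodule A M} {q : ℕ} (hq : Module.supportDim A X ≤ q) :
    ∃ C : ℕ, ∀ n, relLength X (J ^ n • X) ≤ (C * n ^ q : ℕ) := by
  obtain ⟨C, hC⟩ := relLength_top_pow_smul_le (X := X) 𝔪 J c₀ hJ q hq
  refine ⟨C, fun n => ?_⟩
  rw [relLength_smul_eq_top]
  rcases hC n with h | rfl
  · exact h
  · rw [relLength_eq_zero.mpr]
    · exact bot_le
    · simp

/-- Linear Artin–Rees bounds the length by that of `X / J^{h+κn} X`, to which the Hilbert–Samuel
bound applies. -/
theorem exists_relLength_pow_smul_pow_smul_le (𝔪 J 𝔞 : Ideal A) [𝔪.IsMaximal] {c₀ : ℕ}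
    (hJ : 𝔪 ^ c₀ ≤ J) {X : Submodule A M} {q : ℕ} (hq : Module.supportDim A X ≤ q) :
    ∃ C : ℕ, ∀ n h, relLength (𝔞 ^ n • X) (J ^ h • 𝔞 ^ n • X) ≤ (C * (h + n) ^ q : ℕ) := by
  obtain ⟨C, hC⟩ := exists_relLength_pow_smul_le 𝔪 J hJ hq
  obtain ⟨κ, hκ⟩ := exists_linear_artinRees 𝔞 J X
  refine ⟨C * (κ + 1) ^ q, fun n h => ?_⟩
  calc relLength (𝔞 ^ n • X) (J ^ h • 𝔞 ^ n • X)
      ≤ relLength (𝔞 ^ n • X) (J ^ (h + κ * n) • X) := by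
        rw [← relLength_inf _ (J ^ (h + κ * n) • X)]
        exact relLength_anti_right _ (hκ n h)
    _ ≤ relLength X (J ^ (h + κ * n) • X) := relLength_mono_left Submodule.smul_le_right _
    _ ≤ (C * (h + κ * n) ^ q : ℕ) := hC _
    _ ≤ (C * (κ + 1) ^ q * (h + n) ^ q : ℕ) := by
        rw [mul_assoc, ← mul_pow]
        gcongr
        nlinarith

/-- The telescoping estimate: the lengths of the `𝔞ⁿX / (𝔞ⁿ⁺¹X + J^h 𝔞ⁿX)` add up to at most the
length of a single `X / J^H X`. -/
theorem exists_sum_relLength_le (𝔪 J 𝔞 : Ideal A) [𝔪.IsMaximal] {c₀ : ℕ} (hJ : 𝔪 ^ c₀ ≤ J)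
    {X : Submodule A M} {q : ℕ} (hq : Module.supportDim A X ≤ q) (c N : ℕ) :
    ∃ C : ℕ, ∀ L, ∑ m ∈ Finset.range L,
      relLength (𝔞 ^ m • X) (𝔞 ^ (m + 1) • X ⊔ J ^ ((m + N) * c) • 𝔞 ^ m • X) ≤
        (C * (L + N) ^ q : ℕ) := by
  obtain ⟨C, hC⟩ := exists_relLength_pow_smul_le 𝔪 J hJ hq
  obtain ⟨κ, hκ⟩ := exists_linear_artinRees 𝔞 J X
  refine ⟨C * (c + κ) ^ q, fun L => ?_⟩
  have hanti : Antitone fun m => 𝔞 ^ m • X := fun m n h =>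
    Submodule.smul_mono_left (Ideal.pow_le_pow_right h)
  -- This exponent serves all `m < L` at once: being at least `(m + N) * c + κ * m`, it makes the
  -- intersection with `𝔞ᵐX` lie in `J^{(m+N)c} 𝔞ᵐX`.
  have h1 := sum_relLength_succ _ hanti (J ^ ((L + N) * c + κ * L) • X) L
  have h2 : ∀ m ∈ Finset.range L,
      relLength (𝔞 ^ m • X) (𝔞 ^ (m + 1) • X ⊔ J ^ ((m + N) * c) • 𝔞 ^ m • X) ≤
        relLength (𝔞 ^ m • X) (𝔞 ^ (m + 1) • X ⊔ J ^ ((L + N) * c + κ * L) • X) := by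
    intro m hm
    have hmL := (Finset.mem_range.mp hm).le
    -- The modular law, with `𝔞ᵐ⁺¹X ⊆ 𝔞ᵐX`, moves the intersection onto the power of `J`.
    rw [← relLength_inf _ (𝔞 ^ (m + 1) • X ⊔ J ^ ((L + N) * c + κ * L) • X), inf_comm,
      sup_inf_assoc_of_le _ (hanti m.le_succ), inf_comm]
    refine relLength_anti_right _ (sup_le_sup_left ?_ _)
    refine le_trans (inf_le_inf_left _ ?_) (hκ m ((m + N) * c))
    refine Submodule.smul_mono_left (Ideal.pow_le_pow_right ?_)
    gcongr
  refine (Finset.sum_le_sum h2).trans ?_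
  rw [h1]
  simp only [pow_zero, Ideal.one_eq_top, Submodule.top_smul]
  refine (relLength_anti_right X le_sup_right).trans ((hC _).trans ?_)
  rw [mul_assoc, ← mul_pow]
  gcongr
  nlinarith

/-- Since `𝔞ⁿ⁺ᴺX ⊆ 𝔞ⁿY`, the `n`-th term is at most the sum of `N` consecutive terms of the
telescoping estimate; each of those is used at most `N` times. -/
theorem exists_sum_relLength_sup_le (𝔪 J 𝔞 : Ideal A) [𝔪.IsMaximal] {c₀ : ℕ} (hJ : 𝔪 ^ c₀ ≤ J)
    {X Y : Submodule A M} {q : ℕ} (hq : Module.supportDim A X ≤ q) (c N : ℕ)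
    (hXY : 𝔞 ^ N • X ≤ Y) :
    ∃ C : ℕ, ∀ L, ∑ n ∈ Finset.range L,
      relLength (𝔞 ^ n • X) (𝔞 ^ n • Y ⊔ J ^ ((n + N) * c) • 𝔞 ^ n • X) ≤
        (C * (L + 1) ^ q : ℕ) := by
  obtain ⟨C, hC⟩ := exists_sum_relLength_le 𝔪 J 𝔞 hJ hq c N
  refine ⟨N * (C * (2 * N + 1) ^ q), fun L => ?_⟩
  have hanti : Antitone fun m => 𝔞 ^ m • X := fun m n h =>
    Submodule.smul_mono_left (Ideal.pow_le_pow_right h)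
  let f : ℕ → ℕ∞ := fun m =>
    relLength (𝔞 ^ m • X) (𝔞 ^ (m + 1) • X ⊔ J ^ ((m + N) * c) • 𝔞 ^ m • X)
  have h1 : ∀ n, relLength (𝔞 ^ n • X) (𝔞 ^ n • Y ⊔ J ^ ((n + N) * c) • 𝔞 ^ n • X) ≤
      ∑ j ∈ Finset.range N, f (n + j) := by
    intro n
    have h2 : 𝔞 ^ (n + N) • X ⊔ J ^ ((n + N) * c) • 𝔞 ^ n • X ≤
        𝔞 ^ n • Y ⊔ J ^ ((n + N) * c) • 𝔞 ^ n • X := by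
      refine sup_le_sup_right ?_ _
      rw [pow_add, mul_smul]
      exact smul_mono_right _ hXY
    have h3 := sum_relLength_succ (fun j => 𝔞 ^ (n + j) • X)
      (fun i j h => hanti (Nat.add_le_add_left h n)) (J ^ ((n + N) * c) • 𝔞 ^ n • X) N
    refine (relLength_anti_right _ h2).trans (h3.symm.le.trans ?_)
    refine Finset.sum_le_sum fun j hj => relLength_anti_right _ (sup_le_sup_left ?_ _)
    refine (Submodule.smul_mono_left (Ideal.pow_le_pow_right ?_)).trans
      (smul_mono_right _ (hanti (Nat.le_add_right n j)))
    gcongr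
    exact Nat.le_add_right n j
  calc ∑ n ∈ Finset.range L,
        relLength (𝔞 ^ n • X) (𝔞 ^ n • Y ⊔ J ^ ((n + N) * c) • 𝔞 ^ n • X)
      ≤ ∑ n ∈ Finset.range L, ∑ j ∈ Finset.range N, f (n + j) :=
        Finset.sum_le_sum fun n _ => h1 n
    _ = ∑ j ∈ Finset.range N, ∑ n ∈ Finset.range L, f (n + j) := Finset.sum_comm
    _ ≤ ∑ j ∈ Finset.range N, ∑ m ∈ Finset.range (L + N), f m := by
        refine Finset.sum_le_sum fun j hj => ?_
        refine (Finset.sum_map (Finset.range L) (addRightEmbedding j) f).symm.le.trans ?_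
        refine Finset.sum_le_sum_of_subset fun m hm => ?_
        obtain ⟨n, hn, rfl⟩ := Finset.mem_map.mp hm
        have := Finset.mem_range.mp hn
        have := Finset.mem_range.mp hj
        exact Finset.mem_range.mpr (by simp only [addRightEmbedding_apply]; omega)
    _ ≤ ∑ j ∈ Finset.range N, ((C * (L + N + N) ^ q : ℕ) : ℕ∞) :=
        Finset.sum_le_sum fun j _ => hC _
    _ ≤ (N * (C * (2 * N + 1) ^ q) * (L + 1) ^ q : ℕ) := by
        rw [Finset.sum_const, Finset.card_range, nsmul_eq_mul, mul_assoc, mul_assoc, ← mul_pow]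
        norm_cast
        gcongr
        nlinarith

end LengthEstimates

/-! ### Reductions of filtrations -/

section Reductions

variable {A : Type*} [CommRing A]

theorem IsReduction.pow_le {I : Ideal A} {F : IdealFiltration A} (h : IsReduction I F) (n : ℕ) :
    I ^ n ≤ F.ideal n := by
  induction n with
  | zero => simp [F.ideal_zero]
  | succ n ih =>
    rw [pow_succ']
    exact (Ideal.mul_mono_right ih).trans (h.1 n)

theorem IsReduction.exists_ideal_add {I : Ideal A} {F : IdealFiltration A} (h : IsReduction I F) :
    ∃ N, ∀ n m, N ≤ n → F.ideal (n + m) = I ^ m * F.ideal n := by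
  obtain ⟨N, hN⟩ := h.2
  refine ⟨N, fun n m hn => ?_⟩
  induction m with
  | zero => simp
  | succ m ih => rw [← add_assoc, hN _ (hn.trans (Nat.le_add_right n m)), ih, ← mul_assoc, pow_succ']

theorem isReduction_adic {I : Ideal A} (hI : I ≠ ⊤) : IsReduction I (adic I hI) :=
  ⟨fun n => (pow_succ' I n).ge, 0, fun n _ => pow_succ' I n⟩

theorem IsReduction.exists_ideal_one_pow_le {I : Ideal A} {F : IdealFiltration A}
    (h : IsReduction I F) : ∃ N, F.ideal 1 ^ N ≤ I := by
  obtain ⟨N, hN⟩ := h.2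
  have h1 : ∀ n, F.ideal 1 ^ n ≤ F.ideal n := by
    intro n
    induction n with
    | zero => simp [F.ideal_zero]
    | succ n ih =>
      rw [pow_succ]
      exact (Ideal.mul_mono_left ih).trans (F.mul_le n 1)
  exact ⟨N + 1, (h1 _).trans ((hN N le_rfl).trans_le Ideal.mul_le_left)⟩

variable {r : ℕ} {G : Fin r → IdealFiltration A} {K : Fin r → Ideal A}

theorem prod_pow_le_prodIdeal (hK : ∀ i, IsReduction (K i) (G i)) (n : Fin r → ℕ) :
    ∏ i, K i ^ n i ≤ prodIdeal G n :=
  Finset.prod_le_prod' fun i _ => (hK i).pow_le (n i)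

theorem exists_prodIdeal_add (hK : ∀ i, IsReduction (K i) (G i)) :
    ∃ N, ∀ n m : Fin r → ℕ, (∀ i, N ≤ n i) →
      prodIdeal G (n + m) = (∏ i, K i ^ m i) * prodIdeal G n := by
  choose N hN using fun i => (hK i).exists_ideal_add
  refine ⟨Finset.univ.sup N, fun n m hn => ?_⟩
  unfold prodIdeal
  rw [← Finset.prod_mul_distrib]
  exact Finset.prod_congr rfl fun i _ =>
    hN i _ _ ((Finset.le_sup (Finset.mem_univ i)).trans (hn i))

theorem prod_pow_single (K : Fin r → Ideal A) (i₀ : Fin r) (h : ℕ) :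
    ∏ i, K i ^ (Pi.single i₀ h : Fin r → ℕ) i = K i₀ ^ h := by
  rw [Finset.prod_eq_single i₀ (fun i _ hi => by rw [Pi.single_eq_of_ne hi, pow_zero])
    (fun h => absurd (Finset.mem_univ _) h), Pi.single_eq_same]

theorem prod_pow_smul (K : Fin r → Ideal A) (a : Fin r → ℕ) (n : ℕ) :
    ∏ i, K i ^ (n • a) i = (∏ i, K i ^ a i) ^ n := by
  rw [← Finset.prod_pow]
  exact Finset.prod_congr rfl fun i _ => by rw [← pow_mul, Pi.smul_apply, smul_eq_mul, mul_comm]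

theorem prodIdeal_antitone (G : Fin r → IdealFiltration A) : Antitone (prodIdeal G) :=
  fun _ _ h => Finset.prod_le_prod' fun i _ => (G i).antitone (h i)

end Reductions

/-! ### Step lengths in one direction -/

section Difference

variable {A : Type*} [CommRing A] {r : ℕ} (G : Fin r → IdealFiltration A) (i₀ : Fin r)
  (M : Type*) [AddCommGroup M] [Module A M]

/-- The length of `𝔾ₙ M / 𝔾ₙ₊ₑ M`, where `e` is the `i₀`-th unit vector. -/
noncomputable def stepLength (n : Fin r → ℕ) : ℕ∞ :=
  relLength (prodIdeal G n • (⊤ : Submodule A M)) (prodIdeal G (n + Pi.single i₀ 1) • ⊤)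

/-- `P` computes `stepLength` at all arguments with entries at least `N`. -/
def IsStepPolynomial (P : MvPolynomial (Fin r) ℚ) (N : ℕ) : Prop :=
  ∀ n : Fin r → ℕ, (∀ i, N ≤ n i) → ∃ l : ℕ, stepLength G i₀ M n = l ∧
    MvPolynomial.eval (fun i => (n i : ℚ)) P = l

variable {G i₀ M}

theorem IsStepPolynomial.mono {P : MvPolynomial (Fin r) ℚ} {N N' : ℕ}
    (h : IsStepPolynomial G i₀ M P N) (hN : N ≤ N') : IsStepPolynomial G i₀ M P N' :=
  fun n hn => h n fun i => hN.trans (hn i)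

theorem sum_stepLength (n : Fin r → ℕ) (h : ℕ) :
    ∑ k ∈ Finset.range h, stepLength G i₀ M (n + Pi.single i₀ k) =
      relLength (prodIdeal G n • (⊤ : Submodule A M)) (prodIdeal G (n + Pi.single i₀ h) • ⊤) := by
  have hanti : Antitone fun k => prodIdeal G (n + Pi.single i₀ k) • (⊤ : Submodule A M) :=
    fun k l hkl => Submodule.smul_mono_left (prodIdeal_antitone G
      (add_le_add_right (Pi.single_mono i₀ hkl) n))
  have h1 := sum_relLength_succ _ hanti ⊥ h
  simp only [sup_bot_eq, Pi.single_zero, add_zero] at h1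
  rw [← h1]
  refine Finset.sum_congr rfl fun k _ => ?_
  rw [stepLength, add_assoc, ← Pi.single_add]

theorem IsStepPolynomial.sum_eval {P : MvPolynomial (Fin r) ℚ} {N : ℕ}
    (hP : IsStepPolynomial G i₀ M P N) {n : Fin r → ℕ} (hn : ∀ i, N ≤ n i) (h : ℕ) :
    ∃ l : ℕ, relLength (prodIdeal G n • (⊤ : Submodule A M))
        (prodIdeal G (n + Pi.single i₀ h) • ⊤) = l ∧
      ∑ k ∈ Finset.range h,
        MvPolynomial.eval (fun i => ((n i + if i = i₀ then k else 0 : ℕ) : ℚ)) P = l := by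
  choose l hl hPl using fun k : ℕ => hP (n + Pi.single i₀ k) fun i => (hn i).trans (by simp)
  refine ⟨∑ k ∈ Finset.range h, l k, ?_, ?_⟩
  · rw [← sum_stepLength, Nat.cast_sum]
    exact Finset.sum_congr rfl fun k _ => hl k
  · rw [Nat.cast_sum]
    refine Finset.sum_congr rfl fun k _ => ?_
    rw [← hPl k]
    congr 2 with i
    rw [Pi.add_apply, Pi.single_apply]

/-- Lengths along a ray, in terms of powers of an ideal. -/
theorem IsStepPolynomial.sum_eval_ray {P : MvPolynomial (Fin r) ℚ} {N : ℕ}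
    (hP : IsStepPolynomial G i₀ M P N)
    {K : Fin r → Ideal A}
    (hN : ∀ n m : Fin r → ℕ, (∀ i, N ≤ n i) →
      prodIdeal G (n + m) = (∏ i, K i ^ m i) * prodIdeal G n)
    {a : Fin r → ℕ} (ha : ∀ i, 0 < a i) (n h : ℕ) :
    ∃ l : ℕ, relLength ((∏ i, K i ^ a i) ^ n • prodIdeal G (N • a) • (⊤ : Submodule A M))
        (K i₀ ^ h • (∏ i, K i ^ a i) ^ n • prodIdeal G (N • a) • ⊤) = l ∧
      ∑ k ∈ Finset.range h,
        MvPolynomial.eval (fun i => (((n + N) * a i + if i = i₀ then k else 0 : ℕ) : ℚ)) P = l := by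
  have hNa : ∀ i, N ≤ (N • a) i := fun i => Nat.le_mul_of_pos_right N (ha i)
  have hnNa : ∀ i, N ≤ ((n + N) • a) i := fun i => (hNa i).trans
    (Nat.mul_le_mul_right _ (Nat.le_add_left N n))
  obtain ⟨l, hl, hlP⟩ := hP.sum_eval hnNa h
  refine ⟨l, ?_, hlP⟩
  rw [← hl, hN _ _ hnNa, prod_pow_single, mul_smul, add_smul, add_comm (n • a), hN _ _ hNa,
    prod_pow_smul, mul_smul]

end Difference

/-! ### Leading coefficients of a family and of its reductions -/

section Comparison

variable {A : Type*} [CommRing A] [IsNoetherianRing A] {r : ℕ} {G : Fin r → IdealFiltration A}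
  {K : Fin r → Ideal A} {i₀ : Fin r} {M : Type*} [AddCommGroup M] [Module A M] [Module.Finite A M]

/-- From `N` on the family is adic relative to `X = 𝔾_N M`, so the Hilbert polynomial for products
of powers applies. -/
theorem exists_isStepPolynomial (hK : ∀ i, IsReduction (K i) (G i)) (𝔪 : Ideal A) [𝔪.IsMaximal]
    {c₀ : ℕ} (hc : 𝔪 ^ c₀ ≤ K i₀) : ∃ P N, IsStepPolynomial G i₀ M P N := by
  obtain ⟨N, hN⟩ := exists_prodIdeal_add hK
  let X : Submodule A M := prodIdeal G (fun _ => N) • ⊤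
  have h1 : ∀ n : Fin r → ℕ, stepLength G i₀ M (n + fun _ => N) =
      relLength ((∏ i, K i ^ n i) • X) (K i₀ • (∏ i, K i ^ n i) • X) := by
    intro n
    have h2 := hN (fun _ => N) n fun _ => le_rfl
    have h3 := hN (fun _ => N) (n + Pi.single i₀ 1) fun _ => le_rfl
    rw [prod_pow_add_single] at h3
    rw [stepLength, add_right_comm, add_comm _ (fun _ => N), h2, ← add_comm (fun _ => N), h3,
      mul_smul, mul_assoc, mul_smul, mul_smul]
  have h2 : ∀ n : Fin r → ℕ,
      relLength ((∏ i, K i ^ n i) • X) (K i₀ • (∏ i, K i ^ n i) • X) ≠ ⊤ := fun n =>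
    relLength_ne_top 𝔪 c₀ (Submodule.smul_mono_left hc)
  have h3 : EventuallyPolynomial fun n => ((stepLength G i₀ M n).toNat : ℚ) := by
    refine EventuallyPolynomial.of_shift N ?_
    simp only [h1]
    exact eventuallyPolynomial_adic K (fun i => (hK i).ne_top) (K i₀) X h2
  obtain ⟨P, N', hP⟩ := h3
  refine ⟨P, max N N', fun n hn => ⟨_, (ENat.natCast_toNat ?_).symm, (hP n fun i => ?_).symm⟩⟩
  · have h4 : n = (n - fun _ => N : Fin r → ℕ) + fun _ => N :=
      funext fun i => (Nat.sub_add_cancel ((le_max_left _ _).trans (hn i))).symm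
    rw [h4, h1]
    exact h2 _
  · exact (le_max_right _ _).trans (hn i)

/-- Each inner sum is a length `ℓ(𝔞ⁿX / Jʰ𝔞ⁿX) = O(n^{D+1})` with `h` linear in `n`. The sum over
`n` is `O(L^{D+2})`, and the growth criterion applies with `D + 1`. -/
theorem IsStepPolynomial.totalDegree_le {P : MvPolynomial (Fin r) ℚ} {N : ℕ}
    (hP : IsStepPolynomial G i₀ M P N) (hK : ∀ i, IsReduction (K i) (G i)) (𝔪 : Ideal A)
    [𝔪.IsMaximal] {c₀ : ℕ} (hc : 𝔪 ^ c₀ ≤ K i₀) {D N₁ : ℕ}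
    (hdim : ∀ n : Fin r → ℕ, (∀ i, N₁ ≤ n i) →
      Module.supportDim A ↥(prodIdeal G n • (⊤ : Submodule A M)) ≤ (D + 1 : ℕ)) :
    P.totalDegree ≤ D := by
  obtain ⟨N₂, hN₂⟩ := exists_prodIdeal_add hK
  have hcoeff : ∀ d : Fin r →₀ ℕ, D + 1 ≤ d.degree → P.coeff d = 0 := by
    refine coeff_eq_zero_of_sum_growth P i₀ (D + 1) fun a c ha hc' => ?_
    let N' := N + N₁ + N₂
    have hNa : ∀ i, N₁ ≤ (N' • a) i := fun i => le_trans (by omega)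
      (Nat.le_mul_of_pos_right N' (ha i))
    obtain ⟨C, hC⟩ := exists_relLength_pow_smul_pow_smul_le 𝔪 (K i₀) (∏ i, K i ^ a i) hc
      (hdim _ hNa)
    refine ⟨N', C * (c + 1) ^ (D + 1) * (N' + 1) ^ (D + 1), fun L => ?_⟩
    refine le_trans ?_ (sum_range_pow_le (C * (c + 1) ^ (D + 1) : ℚ) (by positivity) N' (D + 1) L)
    refine (Finset.abs_sum_le_sum_abs _ _).trans (Finset.sum_le_sum fun n _ => ?_)
    obtain ⟨l, hl, hlP⟩ := (hP.mono (show N ≤ N' by omega)).sum_eval_ray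
      (fun n m hn => hN₂ n m fun i => le_trans (by omega) (hn i)) ha n ((n + N') * c)
    rw [hlP, Nat.abs_cast]
    have h1 := hC n ((n + N') * c)
    rw [hl] at h1
    have h2 : l ≤ C * ((n + N') * c + n) ^ (D + 1) := by exact_mod_cast h1
    have h3 : C * ((n + N') * c + n) ^ (D + 1) ≤
        C * (c + 1) ^ (D + 1) * (n + N' + 1) ^ (D + 1) := by
      rw [mul_assoc, ← mul_pow]
      gcongr
      nlinarith
    exact_mod_cast h2.trans h3
  refine Finset.sup_le fun d hd => ?_
  by_contra! h
  exact MvPolynomial.mem_support_iff.mp hd (hcoeff d h)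

/-- Lengths computed by the reductions agree in the leading degree. -/
theorem IsStepPolynomial.coeff_eq {P P' : MvPolynomial (Fin r) ℚ} {N : ℕ}
    (hP : IsStepPolynomial G i₀ M P N) (hK : ∀ i, IsReduction (K i) (G i))
    (hP' : IsStepPolynomial (adicFamily K fun i => (hK i).ne_top) i₀ M P' N) (𝔪 : Ideal A)
    [𝔪.IsMaximal] {c₀ : ℕ} (hc : 𝔪 ^ c₀ ≤ K i₀) {D N₁ : ℕ}
    (hdim : ∀ n : Fin r → ℕ, (∀ i, N₁ ≤ n i) →
      Module.supportDim A ↥(prodIdeal G n • (⊤ : Submodule A M)) ≤ (D + 1 : ℕ))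
    (d : Fin r →₀ ℕ) (hd : D ≤ d.degree) : P.coeff d = P'.coeff d := by
  obtain ⟨N₂, hN₂⟩ := exists_prodIdeal_add hK
  have hK' : ∀ i, IsReduction (K i) (adicFamily K (fun i => (hK i).ne_top) i) := fun i =>
    isReduction_adic (hK i).ne_top
  have hadd : ∀ n m : Fin r → ℕ, prodIdeal (adicFamily K fun i => (hK i).ne_top) (n + m) =
      (∏ i, K i ^ m i) * prodIdeal (adicFamily K fun i => (hK i).ne_top) n := by
    intro n m
    rw [prodIdeal_adicFamily, prodIdeal_adicFamily, mul_comm]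
    simp only [Pi.add_apply, pow_add, Finset.prod_mul_distrib]
  have hle : ∀ n : Fin r → ℕ, prodIdeal (adicFamily K fun i => (hK i).ne_top) n •
      (⊤ : Submodule A M) ≤ prodIdeal G n • (⊤ : Submodule A M) := fun n =>
    Submodule.smul_mono_left (prod_pow_le_prodIdeal hK n)
  have hdeg : P'.totalDegree ≤ D := hP'.totalDegree_le hK' 𝔪 hc fun n hn =>
    (Module.supportDim_le_of_injective _ (Submodule.inclusion_injective (hle n))).trans (hdim n hn)
  obtain ⟨C₂, hC₂0, hC₂⟩ := abs_eval_le P'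
  rw [← sub_eq_zero, ← MvPolynomial.coeff_sub]
  refine coeff_eq_zero_of_sum_growth (P - P') i₀ D (fun a c ha hc' => ?_) d hd
  let N' := N + N₁ + N₂
  have hN'a : ∀ i, N' ≤ (N' • a) i := fun i => Nat.le_mul_of_pos_right N' (ha i)
  set 𝔞 : Ideal A := ∏ i, K i ^ a i with h𝔞
  set X : Submodule A M := prodIdeal G (N' • a) • ⊤ with hX
  set Y : Submodule A M := prodIdeal (adicFamily K fun i => (hK i).ne_top) (N' • a) • ⊤ with hY
  have hYX : Y ≤ X := hle _
  -- `Y` is `𝔞^{N'} M`, because its family is adic.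
  have hXY : 𝔞 ^ N' • X ≤ Y := by
    rw [hY, prodIdeal_adicFamily, prod_pow_smul]
    exact smul_mono_right _ le_top
  obtain ⟨C₁, hC₁⟩ := exists_sum_relLength_sup_le 𝔪 (K i₀) 𝔞 hc
    (hdim (N' • a) fun i => le_trans (by omega) (hN'a i)) c N' hXY
  obtain ⟨κ, hκ⟩ := exists_uniform_artinRees 𝔞 (K i₀) hYX
  choose lX hlX hPX using fun n => (hP.mono (show N ≤ N' by omega)).sum_eval_ray
    (fun n m hn => hN₂ n m fun i => le_trans (by omega) (hn i)) ha n ((n + N') * c)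
  choose lY hlY hPY using fun n => (hP'.mono (show N ≤ N' by omega)).sum_eval_ray
    (fun n m _ => hadd n m) ha n ((n + N') * c)
  have hu : ∀ n, ∃ u : ℕ,
      relLength (𝔞 ^ n • X) (𝔞 ^ n • Y ⊔ K i₀ ^ ((n + N') * c) • 𝔞 ^ n • X) = u := fun n =>
    ⟨_, (ENat.natCast_toNat (ne_top_of_le_ne_top (hlX n ▸ ENat.natCast_ne_top _)
      (relLength_anti_right _ le_sup_right))).symm⟩
  choose u hu using hu
  let S : ℕ := ∑ i, a i + c
  have hw : ∀ n, ∃ w : ℕ, lY n ≤ lX n + w ∧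
      (w : ℚ) ≤ κ * (C₂ * (S : ℚ) ^ D) * ((n + N' + 1 : ℕ) : ℚ) ^ D := by
    intro n
    set h := (n + N') * c with hh
    -- `w` is the length of the last `h - (h - κ) ≤ κ` steps before `h`: boundedly many values of
    -- `P'` at points of size `O(n)`, hence `O(n^D)`. Truncated subtraction covers `h < κ`.
    set b : Fin r → ℕ := (n + N') • a + Pi.single i₀ (h - κ)
    have hb : ∀ i, N ≤ b i := fun i => by
      have h1 : N ≤ (n + N') * a i := le_trans (by omega) (Nat.le_mul_of_pos_right _ (ha i))
      exact h1.trans (Nat.le_add_right _ _)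
    obtain ⟨w, hw, hPw⟩ := hP'.sum_eval hb (h - (h - κ))
    have hYn : prodIdeal (adicFamily K fun i => (hK i).ne_top) ((n + N') • a) •
        (⊤ : Submodule A M) = 𝔞 ^ n • Y := by
      rw [add_smul, add_comm (n • a), hadd, prod_pow_smul, mul_smul]
    refine ⟨w, ?_, ?_⟩
    · have h1 : relLength (K i₀ ^ (h - κ) • 𝔞 ^ n • Y) (K i₀ ^ h • 𝔞 ^ n • Y) = w := by
        rw [← hw, add_assoc, ← Pi.single_add, Nat.add_sub_of_le (Nat.sub_le h κ), hadd, hadd,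
          prod_pow_single, prod_pow_single, mul_smul, mul_smul, hYn]
      have h2 : (𝔞 ^ n • Y) ⊓ K i₀ ^ h • 𝔞 ^ n • X ≤ K i₀ ^ (h - κ) • 𝔞 ^ n • Y := by
        rcases le_total κ h with hκh | hκh
        · have := hκ n (h - κ)
          rwa [Nat.sub_add_cancel hκh] at this
        · rw [Nat.sub_eq_zero_of_le hκh, pow_zero, Ideal.one_eq_top, Submodule.top_smul]
          exact inf_le_left
      have h3 := relLength_le_add_of_inf_le (W := K i₀ ^ h • 𝔞 ^ n • Y)
        (smul_mono_right (𝔞 ^ n) hYX) h2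
      rw [hlX, hlY, h1] at h3
      exact_mod_cast h3
    · rw [← hPw]
      refine (Finset.sum_le_card_nsmul _ _ (C₂ * (S : ℚ) ^ D * ((n + N' + 1 : ℕ) : ℚ) ^ D)
        fun k hk => ?_).trans ?_
      · have hS : 1 ≤ S * (n + N' + 1) := Nat.mul_pos (by omega) (by omega)
        have hkh : h - κ + k ≤ h := by
          have := Finset.mem_range.mp hk
          omega
        refine (le_abs_self _).trans ((hC₂ _ (S * (n + N' + 1) : ℕ) (by exact_mod_cast hS)
          fun i => ?_).trans ?_)
        · rw [Nat.abs_cast, Nat.cast_le]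
          have h1 : b i + (if i = i₀ then k else 0) ≤ (n + N') * a i + h := by
            change (n + N') * a i + (Pi.single i₀ (h - κ) : Fin r → ℕ) i + _ ≤ _
            rw [Pi.single_apply]
            split_ifs <;> omega
          have h2 : a i ≤ ∑ j, a j := Finset.single_le_sum (fun _ _ => Nat.zero_le _)
            (Finset.mem_univ i)
          refine h1.trans ?_
          rw [hh, ← mul_add, mul_comm]
          exact Nat.mul_le_mul (Nat.add_le_add_right h2 c) (Nat.le_succ _)
        · rw [mul_assoc, ← mul_pow]
          push_cast
          refine mul_le_mul_of_nonneg_left (pow_le_pow_right₀ ?_ hdeg) hC₂0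
          exact_mod_cast hS
      · rw [Finset.card_range, nsmul_eq_mul, mul_assoc (κ : ℚ)]
        refine mul_le_mul_of_nonneg_right ?_ (by positivity)
        exact_mod_cast (show h - (h - κ) ≤ κ by omega)
  choose w hw hwC using hw
  have hsum : ∀ n, ∑ k ∈ Finset.range ((n + N') * c), MvPolynomial.eval
      (fun i => (((n + N') * a i + if i = i₀ then k else 0 : ℕ) : ℚ)) (P - P') =
      (lX n : ℚ) - lY n := by
    intro n
    rw [← hPX, ← hPY, ← Finset.sum_sub_distrib]
    exact Finset.sum_congr rfl fun k _ => map_sub _ _ _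
  -- The defects `u n` are only controlled after summation over `n`, by the telescoping estimate;
  -- this is why the growth criterion is phrased with sums.
  have hXu : ∀ n, lX n ≤ u n + lY n := by
    intro n
    have h1 := relLength_le_add_of_le (X := 𝔞 ^ n • X) (Y := 𝔞 ^ n • Y)
      (smul_mono_right (K i₀ ^ ((n + N') * c)) (smul_mono_right (𝔞 ^ n) hYX))
    rw [hlX, hlY, hu] at h1
    exact_mod_cast h1
  refine ⟨N', C₁ + κ * (C₂ * (S : ℚ) ^ D) * (N' + 1) ^ D, fun L => ?_⟩
  have h1 : ∑ n ∈ Finset.range L, (u n : ℚ) ≤ C₁ * (L + 1) ^ (D + 1) := by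
    have h2 := (Finset.sum_congr rfl fun n _ => (hu n).symm).trans_le (hC₁ L)
    exact_mod_cast h2
  have h2 : ∑ n ∈ Finset.range L, (w n : ℚ) ≤
      κ * (C₂ * (S : ℚ) ^ D) * (N' + 1) ^ D * (L + 1) ^ (D + 1) :=
    (Finset.sum_le_sum fun n _ => hwC n).trans (sum_range_pow_le _ (by positivity) _ _ _)
  have h3 : ∑ n ∈ Finset.range L, ((lX n : ℚ) - lY n) ≤ ∑ n ∈ Finset.range L, (u n : ℚ) :=
    Finset.sum_le_sum fun n _ => by
      have : (lX n : ℚ) ≤ u n + lY n := by exact_mod_cast hXu n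
      linarith
  have h4 : -∑ n ∈ Finset.range L, ((lX n : ℚ) - lY n) ≤ ∑ n ∈ Finset.range L, (w n : ℚ) := by
    rw [← Finset.sum_neg_distrib]
    refine Finset.sum_le_sum fun n _ => ?_
    have : (lY n : ℚ) ≤ lX n + w n := by exact_mod_cast hw n
    linarith
  have h5 : (0 : ℚ) ≤ ∑ n ∈ Finset.range L, (u n : ℚ) :=
    Finset.sum_nonneg fun _ _ => Nat.cast_nonneg _
  have h6 : (0 : ℚ) ≤ ∑ n ∈ Finset.range L, (w n : ℚ) :=
    Finset.sum_nonneg fun _ _ => Nat.cast_nonneg _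
  simp only [hsum]
  rw [abs_le, add_mul]
  constructor <;> linarith

end Comparison

/-! ### The submodule `0 :_M I^∞` and the dimension `q` -/

section Saturation

variable {A : Type*} [CommRing A] {M : Type*} [AddCommGroup M] [Module A M]

theorem monotone_torsionBySet_pow (I : Ideal A) :
    Monotone fun n : ℕ => Submodule.torsionBySet A M ((I ^ n : Ideal A) : Set A) :=
  fun _ _ h => Submodule.torsionBySet_le_torsionBySet_of_subset (Ideal.pow_le_pow_right h)

theorem saturation_le_of_pow_le {I I' : Ideal A} {k : ℕ} (h : I ^ k ≤ I') :
    saturation I' M ≤ saturation I M := by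
  refine iSup_le fun n => le_trans ?_ (le_iSup _ (k * n))
  refine Submodule.torsionBySet_le_torsionBySet_of_subset ?_
  rw [pow_mul]
  exact Ideal.pow_right_mono h n

theorem exists_pow_smul_saturation_eq_bot [IsNoetherian A M] (I : Ideal A) :
    ∃ k : ℕ, I ^ k • saturation I M = ⊥ := by
  obtain ⟨k, hk⟩ := monotone_stabilizes_iff_noetherian.mpr (inferInstance : IsNoetherian A M)
    ⟨_, monotone_torsionBySet_pow I⟩
  refine ⟨k, le_bot_iff.mp (Submodule.smul_le.mpr fun a ha x hx => ?_)⟩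
  have h1 : saturation I M ≤ Submodule.torsionBySet A M ((I ^ k : Ideal A) : Set A) :=
    iSup_le fun n => (monotone_torsionBySet_pow I (Nat.le_max_left n k)).trans
      (hk (max n k) (Nat.le_max_right n k)).ge
  exact (Submodule.mem_torsionBySet_iff _ _).mp (h1 hx) ⟨a, ha⟩

/-- By Artin–Rees the intersection lies in a power of `I` times the saturation, and a power of `I`
kills the saturation. -/
theorem exists_pow_smul_inf_saturation_eq_bot [IsNoetherianRing A] [Module.Finite A M]
    (I : Ideal A) : ∃ k : ℕ, I ^ k • (⊤ : Submodule A M) ⊓ saturation I M = ⊥ := by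
  obtain ⟨k, hk⟩ := exists_pow_smul_saturation_eq_bot (M := M) I
  obtain ⟨l, hl⟩ := Ideal.exists_pow_inf_eq_pow_smul I (saturation I M)
  refine ⟨k + l, ?_⟩
  rw [hl _ (Nat.le_add_left l k), Nat.add_sub_cancel, ← le_bot_iff, ← hk]
  exact smul_mono_right _ inf_le_right

theorem supportDim_le_of_inf_eq_bot (X Z : Submodule A M) (h : X ⊓ Z = ⊥) :
    Module.supportDim A X ≤ Module.supportDim A (M ⧸ Z) := by
  refine Module.supportDim_le_of_injective (Z.mkQ ∘ₗ X.subtype) ?_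
  rw [← LinearMap.ker_eq_bot, LinearMap.ker_comp, Submodule.ker_mkQ]
  exact Submodule.disjoint_iff_comap_eq_bot.mp (disjoint_iff.mpr h)

variable {s : ℕ} {Fs : Fin s → IdealFiltration A} {Is : Fin s → Ideal A}

theorem prodIdeal_one (Fs : Fin s → IdealFiltration A) : prodIdeal Fs 1 = ∏ i, (Fs i).ideal 1 :=
  rfl

theorem exists_prodIdeal_one_pow_le (hIs : ∀ i, IsReduction (Is i) (Fs i)) :
    ∃ k, prodIdeal Fs 1 ^ k ≤ ∏ i, Is i := by
  choose N hN using fun i => (hIs i).exists_ideal_one_pow_le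
  refine ⟨Finset.univ.sup N, ?_⟩
  rw [prodIdeal_one, ← Finset.prod_pow]
  exact Finset.prod_le_prod' fun i _ =>
    (Ideal.pow_le_pow_right (Finset.le_sup (Finset.mem_univ i))).trans (hN i)

theorem exists_prodIdeal_le_pow (hIs : ∀ i, IsReduction (Is i) (Fs i)) (m : ℕ) :
    ∃ N, ∀ n : Fin s → ℕ, (∀ i, N ≤ n i) → prodIdeal Fs n ≤ (∏ i, Is i) ^ m := by
  obtain ⟨N, hN⟩ := exists_prodIdeal_add hIs
  refine ⟨N + m, fun n hn => ?_⟩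
  have h1 : n = (fun _ => N) + (n - fun _ => N : Fin s → ℕ) :=
    funext fun i => (Nat.add_sub_of_le (le_trans (Nat.le_add_right N m) (hn i))).symm
  rw [h1, hN _ _ fun _ => le_rfl, ← Finset.prod_pow]
  refine Ideal.mul_le_left.trans (Finset.prod_le_prod' fun i _ => Ideal.pow_le_pow_right ?_)
  exact Nat.le_sub_of_add_le' (hn i)

/-- `∏ Iᵢ` lies in `∏ (Fᵢ)₁` and contains a power of it, so both have the same saturation. -/
theorem mixedDim_adicFamily (hIs : ∀ i, IsReduction (Is i) (Fs i)) :
    mixedDim (fun i => adic (Is i) (hIs i).ne_top) M = mixedDim Fs M := by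
  obtain ⟨k, hk⟩ := exists_prodIdeal_one_pow_le hIs
  have h1 : prodIdeal (fun i => adic (Is i) (hIs i).ne_top) 1 = ∏ i, Is i :=
    Finset.prod_congr rfl fun i _ => pow_one _
  have h2 : ∏ i, Is i ≤ prodIdeal Fs 1 := by
    have := prod_pow_le_prodIdeal hIs 1
    simpa using this
  unfold mixedDim
  rw [h1, le_antisymm (saturation_le_of_pow_le hk)
    (saturation_le_of_pow_le (k := 1) (by rwa [pow_one]))]

/-- For large `n` the module `𝔽ₙ M` meets `0 :_M I^∞` trivially and embeds into the quotient that
defines `q`. -/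
theorem exists_supportDim_prodIdeal_smul_le [IsNoetherianRing A] [Module.Finite A M]
    (hIs : ∀ i, IsReduction (Is i) (Fs i)) :
    ∃ N, ∀ n : Fin s → ℕ, (∀ i, N ≤ n i) → ∀ X : Submodule A M, X ≤ prodIdeal Fs n • ⊤ →
      Module.supportDim A X ≤ mixedDim Fs M := by
  obtain ⟨k, hk⟩ := exists_pow_smul_inf_saturation_eq_bot (M := M) (prodIdeal Fs 1)
  obtain ⟨N, hN⟩ := exists_prodIdeal_le_pow hIs k
  refine ⟨N, fun n hn X hX => supportDim_le_of_inf_eq_bot _ _ ?_⟩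
  rw [← le_bot_iff, ← hk]
  refine inf_le_inf_right _ (hX.trans (Submodule.smul_mono_left ((hN n hn).trans ?_)))
  refine Ideal.pow_right_mono ?_ k
  have := prod_pow_le_prodIdeal hIs 1
  simpa using this

end Saturation

/-! ### Equality of mixed multiplicities -/

section MixedMultiplicity

variable {A : Type*} [CommRing A] {s : ℕ}

theorem IsMPrimary.exists_pow_le [IsLocalRing A] [IsNoetherianRing A] {I : Ideal A}
    (h : IsMPrimary I) : ∃ c, IsLocalRing.maximalIdeal A ^ c ≤ I := by
  obtain ⟨c, hc⟩ := Ideal.exists_radical_pow_le_of_fg I (IsNoetherian.noetherian _)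
  rw [h.2] at hc
  exact ⟨c, hc⟩

/-- The family consisting of `F` and of the members of `Fs`. -/
def consFamily (F : IdealFiltration A) (Fs : Fin s → IdealFiltration A) :
    Fin (s + 1) → IdealFiltration A :=
  Fin.cons F Fs

theorem prodIdeal_consFamily (F : IdealFiltration A) (Fs : Fin s → IdealFiltration A)
    (n : Fin (s + 1) → ℕ) :
    prodIdeal (consFamily F Fs) n = F.ideal (n 0) * prodIdeal Fs fun i => n i.succ := by
  rw [prodIdeal, Fin.prod_univ_succ]
  rfl

variable {M : Type*} [AddCommGroup M] [Module A M]

theorem stepLength_consFamily (F : IdealFiltration A) (Fs : Fin s → IdealFiltration A)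
    (n₀ : ℕ) (n : Fin s → ℕ) :
    stepLength (consFamily F Fs) 0 M (Fin.cons n₀ n : Fin (s + 1) → ℕ) =
      bhattacharya F Fs M n₀ n := by
  have h1 : (fun i : Fin s => (Fin.cons n₀ n + Pi.single 0 1 : Fin (s + 1) → ℕ) i.succ) = n := by
    ext i
    simp
  have h2 : (Fin.cons n₀ n + Pi.single 0 1 : Fin (s + 1) → ℕ) 0 = n₀ + 1 := by simp
  rw [stepLength, prodIdeal_consFamily, prodIdeal_consFamily, h1, h2]
  rfl

theorem IsStepPolynomial.isBhattacharyaPolynomial {F : IdealFiltration A}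
    {Fs : Fin s → IdealFiltration A} {P : MvPolynomial (Fin (s + 1)) ℚ} {N : ℕ}
    (h : IsStepPolynomial (consFamily F Fs) 0 M P N) : IsBhattacharyaPolynomial F Fs M P := by
  refine ⟨N, fun n₀ n hn₀ hn => ?_⟩
  obtain ⟨l, hl, hP⟩ := h (Fin.cons n₀ n) (Fin.cases hn₀ hn)
  exact ⟨l, (stepLength_consFamily F Fs n₀ n).symm.trans hl, hP⟩

theorem exists_isMixedMultiplicity [IsLocalRing A] [IsNoetherianRing A] [Module.Finite A M]
    {F : IdealFiltration A} (hF : IsMPrimary (F.ideal 1)) {Fs : Fin s → IdealFiltration A}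
    {J : Ideal A} (hJ : IsReduction J F) {Is : Fin s → Ideal A}
    (hIs : ∀ i, IsReduction (Is i) (Fs i)) (k₀ : ℕ) (k : Fin s → ℕ)
    (hk : ((k₀ + ∑ i, k i + 1 : ℕ) : WithBot ℕ∞) = mixedDim Fs M) :
    ∃ e : ℚ, IsMixedMultiplicity F Fs M k₀ k e ∧
      IsMixedMultiplicity (adic J hJ.ne_top) (fun i => adic (Is i) (hIs i).ne_top) M k₀ k e := by
  let K : Fin (s + 1) → Ideal A := Fin.cons J Is
  have hK : ∀ i, IsReduction (K i) (consFamily F Fs i) := Fin.cases hJ hIs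
  have hadic : consFamily (adic J hJ.ne_top) (fun i => adic (Is i) (hIs i).ne_top) =
      adicFamily K fun i => (hK i).ne_top := by
    funext i
    exact Fin.cases rfl (fun _ => rfl) i
  obtain ⟨c₁, hc₁⟩ := hF.exists_pow_le
  obtain ⟨c₂, hc₂⟩ := hJ.exists_ideal_one_pow_le
  have hc : IsLocalRing.maximalIdeal A ^ (c₁ * c₂) ≤ K 0 := by
    rw [pow_mul]
    exact (Ideal.pow_right_mono hc₁ c₂).trans hc₂
  obtain ⟨P, N, hP⟩ := exists_isStepPolynomial (M := M) hK _ hc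
  obtain ⟨P', N', hP'⟩ := exists_isStepPolynomial (M := M)
    (fun i => isReduction_adic (hK i).ne_top) _ hc
  obtain ⟨N₁, hN₁⟩ := exists_supportDim_prodIdeal_smul_le (M := M) hIs
  -- Here `D = q - 1`. The factor from `F` only shrinks the module, so its dimension is still at
  -- most `q`.
  have hcoeff := (hP.mono (le_max_left N N')).coeff_eq hK (hP'.mono (le_max_right N N')) _ hc
    (D := k₀ + ∑ i, k i) (N₁ := N₁) (fun n hn => by
      rw [hk, prodIdeal_consFamily]
      exact hN₁ _ (fun i => hn i.succ) _ (Submodule.smul_mono_left Ideal.mul_le_right))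
    (Finsupp.equivFunOnFinite.symm (Fin.cons k₀ k : Fin (s + 1) → ℕ)) (by
      rw [Finsupp.degree_eq_sum, Fin.sum_univ_succ]
      rfl)
  have h0 : ((k₀ ! : ℚ) * ∏ i, ((k i)! : ℚ)) ≠ 0 :=
    mul_ne_zero (by positivity) (Finset.prod_ne_zero_iff.mpr fun i _ => by positivity)
  refine ⟨_, ⟨hk, P, hP.isBhattacharyaPolynomial, (mul_div_cancel_right₀ _ h0).symm⟩,
    ⟨hk.trans (mixedDim_adicFamily hIs).symm, P', ?_, ?_⟩⟩
  · have h1 : IsStepPolynomial (adicFamily K fun i => (hK i).ne_top) 0 M P' N' := hP'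
    rw [← hadic] at h1
    exact h1.isBhattacharyaPolynomial
  · rw [← hcoeff, mul_div_cancel_right₀ _ h0]

end MixedMultiplicity

/-! ### Krull dimension and minimal primes -/

section KrullDimension

/-- Lying over and going up lift chains of primes; incomparability keeps contracted chains strict.
-/
theorem ringKrullDim_eq_of_isIntegral {R S : Type*} [CommRing R] [CommRing S] [Algebra R S]
    [Algebra.IsIntegral R S] (h : Function.Injective (algebraMap R S)) :
    ringKrullDim R = ringKrullDim S := by
  refine le_antisymm (iSup_le fun l => ?_) ?_
  · obtain ⟨P, -, hP, hPl⟩ := Ideal.exists_ideal_over_prime_of_isIntegral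
      (S := S) l.head.asIdeal ⊥ (by
        rw [← RingHom.ker_eq_comap_bot, (RingHom.injective_iff_ker_eq_bot _).mp h]
        exact bot_le)
    have : P.LiesOver l.head.asIdeal := ⟨hPl.symm⟩
    obtain ⟨L, hL, -⟩ := Ideal.exists_ltSeries_of_hasGoingUp l P
    rw [← hL]
    exact le_iSup (fun L : LTSeries (PrimeSpectrum S) => ((L.length : ℕ∞) : WithBot ℕ∞)) L
  · exact Order.krullDim_le_of_strictMono (PrimeSpectrum.comap (algebraMap R S))
      fun p q hpq => Ideal.IsIntegral.comap_lt_comap hpq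

variable {R : Type*} [CommRing R]

theorem ringKrullDim_quotient_congr {I J : Ideal R} (h : I.radical = J.radical) :
    ringKrullDim (R ⧸ I) = ringKrullDim (R ⧸ J) := by
  rw [ringKrullDim_quotient, ringKrullDim_quotient, ← PrimeSpectrum.zeroLocus_radical, h,
    PrimeSpectrum.zeroLocus_radical]

/-- An ideal that contains an element which is regular modulo the radical of a smaller ideal
defines a closed subset of smaller dimension. -/
theorem ringKrullDim_quotient_add_one_le {I J : Ideal R} (hIJ : I ≤ J) {a : R} (ha : a ∈ J)
    (hreg : ∀ f, a * f ∈ I.radical → f ∈ I.radical) :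
    ringKrullDim (R ⧸ J) + 1 ≤ ringKrullDim (R ⧸ I) := by
  rw [← ringKrullDim_quotient_congr (I.radical_idem), ← ringKrullDim_quotient_congr J.radical_idem]
  have hle := Ideal.radical_mono hIJ
  refine ringKrullDim_succ_le_of_surjective (Ideal.Quotient.factor hle)
    (Ideal.Quotient.factor_surjective hle) (r := Ideal.Quotient.mk _ a) ?_ ?_
  · rw [mem_nonZeroDivisors_iff_right]
    intro x hx
    obtain ⟨x, rfl⟩ := Ideal.Quotient.mk_surjective x
    rw [← map_mul, Ideal.Quotient.eq_zero_iff_mem, mul_comm] at hx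
    exact Ideal.Quotient.eq_zero_iff_mem.mpr (hreg x hx)
  · rw [Ideal.Quotient.factor_mk, Ideal.Quotient.eq_zero_iff_mem]
    exact Ideal.le_radical ha

theorem supportDim_add_one_le {X Z : Type*} [AddCommGroup X] [Module R X] [Module.Finite R X]
    [AddCommGroup Z] [Module R Z] [Module.Finite R Z]
    (h : Module.annihilator R X ≤ Module.annihilator R Z) {a : R}
    (ha : a ∈ Module.annihilator R Z)
    (hreg : ∀ f, a * f ∈ (Module.annihilator R X).radical →
      f ∈ (Module.annihilator R X).radical) :
    Module.supportDim R Z + 1 ≤ Module.supportDim R X := by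
  rw [Module.supportDim_eq_ringKrullDim_quotient_annihilator,
    Module.supportDim_eq_ringKrullDim_quotient_annihilator]
  exact ringKrullDim_quotient_add_one_le h ha hreg

theorem exists_mem_forall_notMem_minimalPrimes [IsNoetherianRing R] {I J : Ideal R}
    (h : ∀ p ∈ I.minimalPrimes, ¬ J ≤ p) : ∃ a ∈ J, ∀ p ∈ I.minimalPrimes, a ∉ p := by
  by_contra! hJ
  have h1 : (J : Set R) ⊆ ⋃ p ∈ I.minimalPrimes, (p : Set R) := fun a ha => by
    obtain ⟨p, hp, hap⟩ := hJ a ha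
    exact Set.mem_biUnion hp hap
  obtain ⟨p, hp, hJp⟩ := (Ideal.subset_union_prime_finite
    (Ideal.finite_minimalPrimes_of_isNoetherianRing R I) (f := id) ⊥ ⊥
    fun p hp _ _ => hp.1.1).mp h1
  exact h p hp hJp

theorem mem_radical_of_mul_mem {I : Ideal R} {a b : R} (ha : ∀ p ∈ I.minimalPrimes, a ∉ p)
    (h : a * b ∈ I) : b ∈ I.radical := by
  rw [← Ideal.sInf_minimalPrimes, Ideal.mem_sInf]
  intro p hp
  exact (hp.1.1.mem_or_mem (hp.1.2 h)).resolve_left (ha p hp)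

theorem not_le_of_height_pos {I 𝔞 : Ideal R}
    (h : 0 < ((I ⊔ 𝔞).map (Ideal.Quotient.mk 𝔞)).height) : ∀ p ∈ 𝔞.minimalPrimes, ¬ I ≤ p := by
  intro p hp hIp
  rw [Ideal.minimalPrimes_eq_comap] at hp
  obtain ⟨q, hq, rfl⟩ := hp
  have := hq.1.1
  have h1 : (I ⊔ 𝔞).map (Ideal.Quotient.mk 𝔞) ≤ q :=
    Ideal.map_le_iff_le_comap.mpr (sup_le hIp fun x hx => by
      rw [Ideal.mem_comap, Ideal.Quotient.eq_zero_iff_mem.mpr hx]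
      exact q.zero_mem)
  have h2 := Ideal.height_mono h1
  rw [Ideal.height_eq_zero_iff.mpr hq] at h2
  exact absurd h (not_lt.mpr h2)

end KrullDimension

/-! ### Lengths under change of rings -/

section ChangeOfRings

variable {A R : Type*} [CommRing A] [CommRing R] [Algebra A R] {T : Type*} [AddCommGroup T]
  [Module A T] [Module R T] [IsScalarTower A R T]

theorem relLength_restrictScalars_eq_length (U V : Submodule R T) :
    relLength (U.restrictScalars A) (V.restrictScalars A) =
      Module.length A (U ⧸ V.submoduleOf U) :=
  relLength_eq_of_surjective (M := T) (U := U.restrictScalars A) (V := V.restrictScalars A)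
    ((V.submoduleOf U).mkQ.restrictScalars A) (V.submoduleOf U).mkQ_surjective (by
      ext x
      exact Submodule.Quotient.mk_eq_zero _)

/-- Lengths over `R` and over `A` agree for modules killed by a power of an ideal `P` such that
`R = A + P`. -/
theorem relLength_restrictScalars (P : Ideal R)
    (hP : Function.Surjective (algebraMap A (R ⧸ P))) (k : ℕ) {U V : Submodule R T} (hVU : V ≤ U)
    (h : P ^ k • U ≤ V) :
    relLength (U.restrictScalars A) (V.restrictScalars A) = relLength U V := by
  induction k generalizing U with
  | zero =>
    rw [pow_zero, Ideal.one_eq_top, Submodule.top_smul] at h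
    rw [relLength_eq_zero.mpr h]
    exact relLength_eq_zero.mpr h
  | succ k ih =>
    have hle : P • U ⊔ V ≤ U := sup_le Submodule.smul_le_right hVU
    have h1 : P ^ k • (P • U ⊔ V) ≤ V := by
      rw [Submodule.smul_sup, ← mul_smul, ← pow_succ]
      exact sup_le h Submodule.smul_le_right
    -- The top layer is killed by `P`, and both `A` and `R` map onto `R / P`, so its length is the
    -- same over all three rings.
    have h3 : relLength (U.restrictScalars A) ((P • U ⊔ V).restrictScalars A) =
        relLength U (P • U ⊔ V) := by
      rw [relLength_restrictScalars_eq_length, relLength]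
      have htors : Module.IsTorsionBySet R (U ⧸ (P • U ⊔ V).submoduleOf U) P := by
        rintro x ⟨a, ha⟩
        obtain ⟨x, rfl⟩ := Submodule.Quotient.mk_surjective _ x
        change Submodule.Quotient.mk (a • x) = 0
        rw [Submodule.Quotient.mk_eq_zero]
        exact Submodule.mem_sup_left (Submodule.smul_mem_smul ha x.2)
      let := htors.module
      rw [Module.length_eq_of_surjective (R := R ⧸ P) (S := A) hP,
        Module.length_eq_of_surjective (R := R ⧸ P) (S := R) Ideal.Quotient.mk_surjective]
    rw [relLength_add le_sup_right hle, ← h3, ← ih le_sup_right h1]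
    exact relLength_add (M := T) (le_sup_right : V ≤ P • U ⊔ V) hle

end ChangeOfRings

/-! ### Limits of normalized lengths -/

section Limits

open Filter Topology

theorem tendsto_eval_div_pow (p : Polynomial ℚ) (d : ℕ) (hp : p.natDegree ≤ d) :
    Tendsto (fun n : ℕ => ((p.eval (n : ℚ) : ℚ) : ℝ) / (n : ℝ) ^ d) atTop
      (𝓝 ((p.coeff d : ℚ) : ℝ)) := by
  set P : Polynomial ℝ := p.map (algebraMap ℚ ℝ) with hP
  have hPd : P.natDegree ≤ d := Polynomial.natDegree_map_le.trans hp
  have h1 : Tendsto (fun x : ℝ => P.eval x / (Polynomial.X ^ d : Polynomial ℝ).eval x) atTop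
      (𝓝 (P.coeff d)) := by
    rcases hPd.lt_or_eq with hlt | heq
    · rw [Polynomial.coeff_eq_zero_of_natDegree_lt hlt]
      refine Polynomial.div_tendsto_atTop_zero_of_degree_lt _ _ ?_
      rw [Polynomial.degree_X_pow]
      exact (Polynomial.degree_le_natDegree).trans_lt (by exact_mod_cast hlt)
    · by_cases h0 : P = 0
      · simp [h0]
      · have h2 := Polynomial.div_tendsto_atTop_leadingCoeff_div_of_degree_eq P
          (Polynomial.X ^ d : Polynomial ℝ)
          (by rw [Polynomial.degree_X_pow, Polynomial.degree_eq_natDegree h0, heq])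
        rw [Polynomial.leadingCoeff_X_pow, div_one, Polynomial.leadingCoeff, heq] at h2
        exact h2
  have h2 := h1.comp (tendsto_natCast_atTop_atTop (R := ℝ))
  rw [hP, Polynomial.coeff_map] at h2
  refine h2.congr fun n => ?_
  rw [Function.comp_apply, Polynomial.eval_pow, Polynomial.eval_X]
  congr 1
  rw [Polynomial.eval_map_algebraMap]
  simpa using (Polynomial.aeval_algebraMap_apply ℝ (n : ℚ) p)

/-- The bound `C * n ^ d` forces `deg p ≤ d`, and the limit is `d!` times the coefficient in degree
`d`, which may be zero. -/
theorem tendsto_div_pow_of_eventually_eq (f : ℕ → ℕ) (p : Polynomial ℚ) (N C d : ℕ)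
    (hf : ∀ n, N ≤ n → (f n : ℚ) = p.eval (n : ℚ)) (hC : ∀ n, f n ≤ C * n ^ d) :
    ∃ e : ℝ, Tendsto (fun n => (d ! : ℝ) * (f n : ℝ) / (n : ℝ) ^ d) atTop (𝓝 e) := by
  have hdeg : p.natDegree ≤ d := by
    refine natDegree_le_of_sum_growth p d N (C * (N + 1) ^ d) fun L => ?_
    refine le_trans ?_ (sum_range_pow_le (C : ℚ) (Nat.cast_nonneg C) N d L)
    refine (Finset.abs_sum_le_sum_abs _ _).trans (Finset.sum_le_sum fun n _ => ?_)
    rw [← hf _ (Nat.le_add_left N n), Nat.abs_cast]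
    exact_mod_cast (hC (n + N)).trans
      (Nat.mul_le_mul_left C (Nat.pow_le_pow_left (Nat.le_succ _) d))
  refine ⟨d ! * ((p.coeff d : ℚ) : ℝ), ?_⟩
  refine ((tendsto_eval_div_pow p d hdeg).const_mul (d ! : ℝ)).congr' ?_
  filter_upwards [eventually_ge_atTop N] with n hn
  rw [← hf n hn, Rat.cast_natCast, mul_div_assoc]

theorem tendsto_div_pow_of_squeeze {f g w : ℕ → ℕ} {d κ : ℕ} {e : ℝ}
    (hf : Tendsto (fun n => (d ! : ℝ) * (f n : ℝ) / (n : ℝ) ^ d) atTop (𝓝 e))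
    (hlow : ∀ n, f (n - κ) ≤ g n) (hup : ∀ n, g n ≤ f n + w n)
    (hw : Tendsto (fun n => (w n : ℝ) / (n : ℝ) ^ d) atTop (𝓝 0)) :
    Tendsto (fun n => (d ! : ℝ) * (g n : ℝ) / (n : ℝ) ^ d) atTop (𝓝 e) := by
  have h1 : Tendsto (fun n : ℕ => (d ! : ℝ) * (f (n - κ) : ℝ) / ((n - κ : ℕ) : ℝ) ^ d *
      (((n - κ : ℕ) : ℝ) / (n : ℝ)) ^ d) atTop (𝓝 (e * 1 ^ d)) := by
    refine (hf.comp (tendsto_sub_atTop_nat κ)).mul (Tendsto.pow ?_ d)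
    have h2 : Tendsto (fun n : ℕ => 1 - (κ : ℝ) / (n : ℝ)) atTop (𝓝 (1 - 0)) :=
      tendsto_const_nhds.sub (tendsto_const_div_atTop_nhds_zero_nat (κ : ℝ))
    rw [sub_zero] at h2
    refine h2.congr' ?_
    filter_upwards [eventually_gt_atTop κ] with n hn
    have : (n : ℝ) ≠ 0 := by exact_mod_cast (by omega : n ≠ 0)
    rw [Nat.cast_sub hn.le]
    field_simp
  have h3 := hf.add (hw.const_mul (d ! : ℝ))
  rw [one_pow, mul_one] at h1
  rw [mul_zero, add_zero] at h3
  refine tendsto_of_tendsto_of_tendsto_of_le_of_le' h1 h3 ?_ ?_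
  · filter_upwards [eventually_gt_atTop κ] with n hn
    have hn0 : (0 : ℝ) < n := by exact_mod_cast (by omega : 0 < n)
    have hk0 : (0 : ℝ) < ((n - κ : ℕ) : ℝ) := by exact_mod_cast (by omega : 0 < n - κ)
    rw [div_pow, div_mul_div_cancel₀ (by positivity)]
    gcongr
    exact hlow n
  · filter_upwards with n
    rw [← mul_div_assoc, ← add_div, ← mul_add]
    gcongr
    exact_mod_cast hup n

end Limits

theorem eq_bot_of_add_one_le_zero {x : WithBot ℕ∞} (h : x + 1 ≤ (0 : ℕ)) : x = ⊥ := by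
  induction x using WithBot.recBotCoe with
  | bot => rfl
  | coe k =>
    have h1 : k + 1 ≤ 0 := by exact_mod_cast h
    simp at h1

theorem le_of_add_one_le_succ {x : WithBot ℕ∞} {d : ℕ} (h : x + 1 ≤ (d + 1 : ℕ)) : x ≤ d := by
  induction x using WithBot.recBotCoe with
  | bot => exact bot_le
  | coe k =>
    have h1 : k + 1 ≤ (d : ℕ∞) + 1 := by exact_mod_cast h
    have h2 : k ≤ d := (ENat.add_le_add_iff_right ENat.one_ne_top).mp h1
    exact_mod_cast h2

/-! ### Hilbert–Samuel multiplicity of a submodule with small quotient -/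

section HilbertSamuel

open Filter Topology

variable {R : Type*} [CommRing R] [IsNoetherianRing R] {X : Type*} [AddCommGroup X] [Module R X]
  [Module.Finite R X]

theorem relLength_pow_smul_ne_top (𝔪 𝔞 : Ideal R) [𝔪.IsMaximal] {c : ℕ} (hc : 𝔪 ^ c ≤ 𝔞)
    (U : Submodule R X) (n : ℕ) {V : Submodule R X} (hV : 𝔞 ^ n • U ≤ V) : relLength U V ≠ ⊤ := by
  refine relLength_ne_top 𝔪 (c * n) (le_trans (Submodule.smul_mono_left ?_) hV)
  rw [pow_mul]
  exact Ideal.pow_right_mono hc n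

theorem exists_eval_eq_relLength_pow_smul (𝔪 𝔞 : Ideal R) [𝔪.IsMaximal] {c : ℕ}
    (hc : 𝔪 ^ c ≤ 𝔞) (h𝔞 : 𝔞 ≠ ⊤) (U : Submodule R X) :
    ∃ (p : Polynomial ℚ) (N : ℕ), ∀ n, N ≤ n →
      ((relLength U (𝔞 ^ n • U)).toNat : ℚ) = p.eval (n : ℚ) := by
  obtain ⟨P, N, hP⟩ := eventuallyPolynomial_adic (fun _ : Fin 1 => 𝔞) (fun _ => h𝔞) 𝔞 U fun n =>
    relLength_ne_top 𝔪 c (Submodule.smul_mono_left hc)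
  let f : ℕ → ℕ := fun n => (relLength U (𝔞 ^ n • U)).toNat
  have hfin : ∀ n, relLength U (𝔞 ^ n • U) = f n := fun n =>
    (ENat.natCast_toNat (relLength_pow_smul_ne_top 𝔪 𝔞 hc U n le_rfl)).symm
  obtain ⟨G, hG⟩ := exists_eval_eq_sum_range (ray P fun _ => 1)
  have hstep : ∀ n, N ≤ n → (f (n + 1) : ℚ) = f n + (ray P fun _ => 1).eval (n : ℚ) := by
    intro n hn
    have h1 := hP (fun _ => n) fun _ => hn
    simp only [Finset.univ_unique, Finset.prod_singleton] at h1
    have h2 : relLength (𝔞 ^ n • U) (𝔞 • 𝔞 ^ n • U) ≠ ⊤ :=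
      relLength_ne_top 𝔪 c (Submodule.smul_mono_left hc)
    have h3 := relLength_add (U := U) (W := 𝔞 ^ n • U) (V := 𝔞 • 𝔞 ^ n • U)
      Submodule.smul_le_right Submodule.smul_le_right
    rw [← mul_smul, ← pow_succ', hfin, hfin, pow_succ', mul_smul, ← ENat.natCast_toNat h2] at h3
    rw [eval_ray]
    simp only [Nat.cast_one, mul_one]
    rw [← h1]
    exact_mod_cast h3
  -- The steps are polynomial only from `N` on; the constant corrects the antiderivative to the
  -- value at `N`.
  refine ⟨G + Polynomial.C ((f N : ℚ) - G.eval (N : ℚ)), N, fun n hn => ?_⟩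
  rw [Polynomial.eval_add, Polynomial.eval_C]
  induction n, hn using Nat.le_induction with
  | base => simp [f]
  | succ n hn ih =>
    refine (hstep n hn).trans ?_
    have h4 : (f n : ℚ) = _ := ih
    rw [h4, hG (n + 1), Finset.sum_range_succ, ← hG]
    ring

/-- The length is bounded by the Hilbert–Samuel function of `X / U`, whose dimension is less than
`d`; for `d = 0` this quotient is zero. -/
theorem exists_relLength_sup_le (𝔪 𝔞 : Ideal R) [𝔪.IsMaximal] {c : ℕ} (hc : 𝔪 ^ c ≤ 𝔞)
    (U : Submodule R X) {d : ℕ} (hd : Module.supportDim R (X ⧸ U) + 1 ≤ d) :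
    ∃ w : ℕ → ℕ, (∀ n, relLength ⊤ (U ⊔ 𝔞 ^ n • ⊤) ≤ w n) ∧
      Tendsto (fun n => (w n : ℝ) / (n : ℝ) ^ d) atTop (𝓝 0) := by
  have hquot : ∀ n, relLength ⊤ (U ⊔ 𝔞 ^ n • ⊤) ≤
      relLength (⊤ : Submodule R (X ⧸ U)) (𝔞 ^ n • ⊤) := by
    intro n
    have h1 := relLength_map_sup U.mkQ ⊤ (𝔞 ^ n • ⊤)
    have h2 : (𝔞 ^ n • (⊤ : Submodule R (X ⧸ U))).comap U.mkQ ≤ U ⊔ 𝔞 ^ n • ⊤ := by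
      rw [← U.range_mkQ, LinearMap.range_eq_map, ← Submodule.map_smul'', Submodule.comap_map_mkQ]
    refine (relLength_anti_right _ h2).trans (h1.symm.le.trans (relLength_mono_left le_top _))
  rcases d with _ | d
  · have h1 : Subsingleton (X ⧸ U) := by
      rw [← Module.supportDim_eq_bot_iff_subsingleton (R := R)]
      exact eq_bot_of_add_one_le_zero hd
    refine ⟨0, fun n => (hquot n).trans ?_, by simp⟩
    rw [relLength_eq_zero.mpr fun x _ => ?_]
    · exact bot_le
    · rw [Subsingleton.elim x 0]
      exact zero_mem _
  · obtain ⟨C, hC⟩ := exists_relLength_pow_smul_le (X := (⊤ : Submodule R (X ⧸ U))) 𝔪 𝔞 hc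
      (q := d) (by
        rw [Module.supportDim_eq_of_equiv Submodule.topEquiv]
        exact le_of_add_one_le_succ hd)
    refine ⟨fun n => C * n ^ d, fun n => (hquot n).trans (hC n), ?_⟩
    have h1 := tendsto_const_div_atTop_nhds_zero_nat (C : ℝ)
    refine h1.congr' ?_
    filter_upwards [eventually_gt_atTop 0] with n hn
    have : (n : ℝ) ≠ 0 := by exact_mod_cast hn.ne'
    push_cast
    field_simp
    ring

/-- A submodule with quotient of smaller dimension has the same multiplicity, also with respect
to a filtration that is equivalent to the adic filtration up to a bounded shift. -/
theorem exists_tendsto_relLength (𝔪 𝔞 : Ideal R) [𝔪.IsMaximal] {c : ℕ} (hc : 𝔪 ^ c ≤ 𝔞)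
    (h𝔞 : 𝔞 ≠ ⊤) (U : Submodule R X) {d : ℕ} (hU : Module.supportDim R U ≤ d)
    (hd : Module.supportDim R (X ⧸ U) + 1 ≤ d) (V : ℕ → Submodule R X) (c' : ℕ)
    (hV : ∀ n, 𝔞 ^ n • ⊤ ≤ V n) (hV' : ∀ n, V (n + c') ≤ 𝔞 ^ n • ⊤) :
    ∃ (l₀ l₁ : ℕ → ℕ) (e : ℝ), (∀ n, relLength U (𝔞 ^ n • U) = l₀ n) ∧
      (∀ n, relLength ⊤ (V n) = l₁ n) ∧
      Tendsto (fun n => (d ! : ℝ) * (l₀ n : ℝ) / (n : ℝ) ^ d) atTop (𝓝 e) ∧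
      Tendsto (fun n => (d ! : ℝ) * (l₁ n : ℝ) / (n : ℝ) ^ d) atTop (𝓝 e) := by
  obtain ⟨p, N, hp⟩ := exists_eval_eq_relLength_pow_smul 𝔪 𝔞 hc h𝔞 U
  obtain ⟨C, hC⟩ := exists_relLength_pow_smul_le 𝔪 𝔞 hc hU
  have hl₀ : ∀ n, relLength U (𝔞 ^ n • U) = (relLength U (𝔞 ^ n • U)).toNat := fun n =>
    (ENat.natCast_toNat (relLength_pow_smul_ne_top 𝔪 𝔞 hc U n le_rfl)).symm
  have hl₁ : ∀ n, relLength ⊤ (V n) = (relLength ⊤ (V n)).toNat := fun n =>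
    (ENat.natCast_toNat (relLength_pow_smul_ne_top 𝔪 𝔞 hc ⊤ n (hV n))).symm
  obtain ⟨e, he⟩ := tendsto_div_pow_of_eventually_eq (fun n => (relLength U (𝔞 ^ n • U)).toNat) p N
    C d hp fun n => by
      have := hC n
      rw [hl₀] at this
      exact_mod_cast this
  obtain ⟨w, hw, hw0⟩ := exists_relLength_sup_le 𝔪 𝔞 hc U hd
  -- Artin–Rees gives the lower bound for `ℓ(X / V n)` at the cost of a shift by `κ`, to which the
  -- shift `c'` of `V` is added.
  obtain ⟨κ, hκ⟩ := exists_inf_pow_smul_le 𝔞 (le_top : U ≤ ⊤) Module.Finite.fg_top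
  refine ⟨_, _, e, hl₀, hl₁, he, tendsto_div_pow_of_squeeze (κ := κ + c') he (fun n => ?_)
    (fun n => ?_) hw0⟩
  · rw [← Nat.cast_le (α := ℕ∞), ← hl₀, ← hl₁]
    rcases le_total (κ + c') n with hn | hn
    · have h1 : V n ≤ 𝔞 ^ (n - (κ + c') + κ) • ⊤ := by
        have := hV' (n - (κ + c') + κ)
        rwa [show n - (κ + c') + κ + c' = n by omega] at this
      refine (relLength_anti_right U (hκ _)).trans ?_
      rw [relLength_inf]
      exact relLength_mono le_top h1
    · rw [Nat.sub_eq_zero_of_le hn, relLength_eq_zero.mpr (by simp)]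
      exact bot_le
  · rw [← Nat.cast_le (α := ℕ∞), Nat.cast_add, ← hl₀, ← hl₁]
    refine (relLength_anti_right ⊤ (hV n)).trans ?_
    refine (relLength_le_add_of_le (Y := U) (W := 𝔞 ^ n • U) (smul_mono_right _ le_top)).trans ?_
    rw [add_comm]
    gcongr
    exact hw n

end HilbertSamuel

/-! ### Multi-Rees modules described by coefficients -/

section CoefficientSubmodules

variable {A : Type*} [CommRing A] {s : ℕ} {M : Type*} [AddCommGroup M] [Module A M]
  {F : Fin s → IdealFiltration A}

/-- The elements of `M[t₁, …, t_s]` with coefficients in a family of submodules. -/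
noncomputable def coeffSubmodule (F : Fin s → IdealFiltration A)
    (W : (Fin s →₀ ℕ) → Submodule A M)
    (hW : ∀ m n : Fin s →₀ ℕ, prodIdeal F m • W n ≤ W (m + n)) :
    Submodule (multiReesAlgebra F) (MvPolynomial (Fin s) A ⊗[A] M) where
  carrier := {x | ∀ n, moduleCoeff M n x ∈ W n}
  zero_mem' n := by simp
  add_mem' {x y} hx hy n := by
    rw [map_add]
    exact add_mem (hx n) (hy n)
  smul_mem' f x hx n := by
    rw [Subalgebra.smul_def, moduleCoeff_smul]
    refine Submodule.sum_mem _ fun ij hij => ?_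
    rw [← Finset.HasAntidiagonal.mem_antidiagonal.mp hij]
    exact hW _ _ (Submodule.smul_mem_smul (f.2 _) (hx _))

noncomputable instance
    (N : Submodule (multiReesAlgebra F) (MvPolynomial (Fin s) A ⊗[A] M)) :
    Module (multiReesAlgebra F) N :=
  Submodule.module _

/-- The degree zero part of `N` is all of `M`, so the annihilator sees only `Ann M` and not the
filtrations. -/
theorem mem_annihilator_iff {N : Submodule (multiReesAlgebra F) (MvPolynomial (Fin s) A ⊗[A] M)}
    (hN : ∀ m : M, MvPolynomial.monomial 0 (1 : A) ⊗ₜ[A] m ∈ N) {f : multiReesAlgebra F} :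
    f ∈ Module.annihilator (multiReesAlgebra F) N ↔
      ∀ n, f.1.coeff n ∈ Module.annihilator A M := by
  rw [Module.mem_annihilator]
  constructor
  · intro h n
    rw [Module.mem_annihilator]
    intro m
    have h1 := congr_arg Subtype.val (h ⟨_, hN m⟩)
    have h2 := congr_arg (moduleCoeff M n) h1
    rw [Submodule.coe_smul, Subalgebra.smul_def, TensorProduct.smul_tmul', moduleCoeff_tmul,
      Submodule.coe_zero, map_zero] at h2
    simpa using h2
  · intro h x
    refine Subtype.ext (eq_zero_of_moduleCoeff fun n => ?_)
    rw [Submodule.coe_smul, Subalgebra.smul_def, moduleCoeff_smul]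
    exact Finset.sum_eq_zero fun ij _ => Module.mem_annihilator.mp (h ij.1) _

theorem monomial_zero_tmul_mem (m : M) :
    MvPolynomial.monomial 0 (1 : A) ⊗ₜ[A] m ∈ multiReesModule F M := by
  intro n
  rw [moduleCoeff_monomial_tmul]
  split_ifs with h
  · rw [← h, Finsupp.coe_zero, prodIdeal_zero, Submodule.top_smul]
    trivial
  · exact zero_mem _

theorem mem_multiReesPlus {f : multiReesAlgebra F} :
    f ∈ multiReesPlus F ↔ f.1.coeff 0 = 0 := Iff.rfl

theorem exists_sub_algebraMap_mem_multiReesPlus (f : multiReesAlgebra F) :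
    ∃ a : A, f - algebraMap A _ a ∈ multiReesPlus F := by
  refine ⟨f.1.coeff 0, ?_⟩
  rw [mem_multiReesPlus]
  have h1 : ((algebraMap A (multiReesAlgebra F) (f.1.coeff 0) : multiReesAlgebra F) :
    MvPolynomial (Fin s) A) = MvPolynomial.C (f.1.coeff 0) := rfl
  rw [AddSubgroupClass.coe_sub, MvPolynomial.coeff_sub, h1, MvPolynomial.coeff_C, if_pos rfl,
    sub_self]

theorem multiReesIdeal_le_iff {Q : Ideal A} {𝔠 : Ideal (multiReesAlgebra F)} :
    multiReesIdeal F Q ≤ 𝔠 ↔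
      (∀ a ∈ Q, algebraMap A _ a ∈ 𝔠) ∧ multiReesPlus F ≤ 𝔠 := by
  rw [multiReesIdeal, sup_le_iff, Ideal.map_le_iff_le_comap]
  rfl

theorem multiReesPlus_le_multiReesIdeal (F : Fin s → IdealFiltration A) (Q : Ideal A) :
    multiReesPlus F ≤ multiReesIdeal F Q := le_sup_right

theorem algebraMap_mem_multiReesIdeal (F : Fin s → IdealFiltration A) {Q : Ideal A} {a : A}
    (ha : a ∈ Q) : algebraMap A (multiReesAlgebra F) a ∈ multiReesIdeal F Q :=
  Ideal.mem_sup_left (Ideal.mem_map_of_mem _ ha)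

theorem coeff_zero_mem_of_mem_multiReesIdeal {Q : Ideal A} {f : multiReesAlgebra F}
    (hf : f ∈ multiReesIdeal F Q) : f.1.coeff 0 ∈ Q := by
  have h : multiReesIdeal F Q ≤ Q.comap ((MvPolynomial.constantCoeff (σ := Fin s) (R := A)).comp
      (multiReesAlgebra F).val.toRingHom) := by
    refine multiReesIdeal_le_iff.mpr ⟨fun a ha => ?_, fun f hf => ?_⟩
    · change MvPolynomial.constantCoeff (MvPolynomial.C a) ∈ Q
      rwa [MvPolynomial.constantCoeff_C]
    · change f.1.coeff 0 ∈ Q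
      rw [mem_multiReesPlus.mp hf]
      exact zero_mem _
  exact h hf

theorem mem_multiReesIdeal {Q : Ideal A} {f : multiReesAlgebra F} :
    f ∈ multiReesIdeal F Q ↔ f.1.coeff 0 ∈ Q := by
  refine ⟨coeff_zero_mem_of_mem_multiReesIdeal, fun h => ?_⟩
  have h1 : f - algebraMap A _ (f.1.coeff 0) ∈ multiReesPlus F := by
    rw [mem_multiReesPlus, AddSubgroupClass.coe_sub, MvPolynomial.coeff_sub]
    change _ - MvPolynomial.coeff 0 (MvPolynomial.C _) = 0
    rw [MvPolynomial.coeff_C, if_pos rfl, sub_self]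
  rw [← sub_add_cancel f (algebraMap A _ (f.1.coeff 0))]
  exact add_mem (multiReesPlus_le_multiReesIdeal F Q h1) (algebraMap_mem_multiReesIdeal F h)

theorem multiReesIdeal_ne_top {Q : Ideal A} (hQ : Q ≠ ⊤) : multiReesIdeal F Q ≠ ⊤ := by
  rw [Ideal.ne_top_iff_one, mem_multiReesIdeal]
  change ¬ MvPolynomial.coeff 0 (1 : MvPolynomial (Fin s) A) ∈ Q
  rw [MvPolynomial.coeff_zero_one]
  exact (Ideal.ne_top_iff_one Q).mp hQ

theorem multiReesIdeal_isMaximal (F : Fin s → IdealFiltration A) (𝔪 : Ideal A) [h𝔪 : 𝔪.IsMaximal] :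
    (multiReesIdeal F 𝔪).IsMaximal := by
  have h1 : multiReesIdeal F 𝔪 = 𝔪.comap ((MvPolynomial.constantCoeff (σ := Fin s) (R := A)).comp
      (multiReesAlgebra F).val.toRingHom) := by
    ext f
    exact mem_multiReesIdeal
  rw [h1]
  refine Ideal.comap_isMaximal_of_surjective _ fun a => ⟨algebraMap A _ a, ?_⟩
  exact MvPolynomial.constantCoeff_C _ a

theorem multiReesIdeal_pow_le (F : Fin s → IdealFiltration A) {𝔪 Q : Ideal A} {c : ℕ}
    (h : 𝔪 ^ c ≤ Q) : multiReesIdeal F 𝔪 ^ (c + 1) ≤ multiReesIdeal F Q := by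
  refine Ideal.sup_pow_add_le_pow_sup_pow.trans (sup_le_sup ?_ ?_)
  · rw [← Ideal.map_pow]
    exact Ideal.map_mono h
  · rw [pow_one]

/-- The coefficients of the elements of `(Q, 𝔑₊)ᵏ 𝔑(F; M)`. -/
theorem moduleCoeff_mem_of_mem_pow_smul (Q : Ideal A) (k : ℕ)
    {x : MvPolynomial (Fin s) A ⊗[A] M}
    (hx : x ∈ multiReesIdeal F Q ^ k • multiReesModule F M) (n : Fin s →₀ ℕ) :
    moduleCoeff M n x ∈ (Q ^ (k - n.degree) * prodIdeal F n) • (⊤ : Submodule A M) := by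
  have hmul : ∀ k (m n : Fin s →₀ ℕ), prodIdeal F m • (Q ^ (k - n.degree) * prodIdeal F n) •
      (⊤ : Submodule A M) ≤ (Q ^ (k - n.degree) * prodIdeal F (m + n)) • ⊤ := by
    intro k m n
    rw [← mul_smul, mul_left_comm]
    exact Submodule.smul_mono_left (Ideal.mul_mono_right (prodIdeal_mul_le F m n))
  have hdeg : ∀ k (m n : Fin s →₀ ℕ), (Q ^ (k - n.degree) * prodIdeal F (m + n)) •
      (⊤ : Submodule A M) ≤ (Q ^ (k - (m + n).degree) * prodIdeal F (m + n)) • ⊤ := by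
    intro k m n
    refine Submodule.smul_mono_left (Ideal.mul_mono_left (Ideal.pow_le_pow_right ?_))
    rw [map_add]
    omega
  let W : ℕ → Submodule (multiReesAlgebra F) (MvPolynomial (Fin s) A ⊗[A] M) := fun k =>
    coeffSubmodule F (fun n => (Q ^ (k - n.degree) * prodIdeal F n) • ⊤)
      fun m n => (hmul k m n).trans (hdeg k m n)
  suffices h : ∀ k, multiReesIdeal F Q ^ k • multiReesModule F M ≤ W k from h k hx n
  clear hx n x k
  intro k
  induction k with
  | zero =>
    rw [pow_zero, Ideal.one_eq_top, Submodule.top_smul]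
    intro x hx n
    beta_reduce
    rw [Nat.zero_sub, pow_zero, one_mul]
    exact hx n
  | succ k ih =>
    rw [pow_succ', Submodule.mul_smul]
    refine Submodule.smul_le.mpr fun f hf x hx => ?_
    have hx' := ih hx
    -- A factor from `Q` supplies the additional power of `Q`; a factor of positive degree raises
    -- the degree and thereby lowers the required power.
    have h1 : multiReesIdeal F Q ≤
        (W (k + 1)).comap (LinearMap.toSpanSingleton (multiReesAlgebra F) _ x) := by
      refine multiReesIdeal_le_iff.mpr ⟨fun a ha n => ?_, fun f hf n => ?_⟩
      · rw [LinearMap.toSpanSingleton_apply, algebraMap_smul, map_smul]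
        refine (Submodule.smul_mono_left ?_ : (Q * (Q ^ (k - n.degree) * prodIdeal F n)) •
          (⊤ : Submodule A M) ≤ _) ?_
        · rw [← mul_assoc, ← pow_succ']
          exact Ideal.mul_mono_left (Ideal.pow_le_pow_right (by omega))
        · rw [mul_smul]
          exact Submodule.smul_mem_smul ha (hx' n)
      · rw [LinearMap.toSpanSingleton_apply, Subalgebra.smul_def, moduleCoeff_smul]
        refine Submodule.sum_mem _ fun ij hij => ?_
        rw [← Finset.HasAntidiagonal.mem_antidiagonal.mp hij]
        by_cases h0 : ij.1 = 0
        · rw [h0, mem_multiReesPlus.mp hf, zero_smul]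
          exact zero_mem _
        · have h2 := hmul k ij.1 ij.2 (Submodule.smul_mem_smul (f.2 ij.1) (hx' ij.2))
          refine (Submodule.smul_mono_left (Ideal.mul_mono_left (Ideal.pow_le_pow_right ?_)) :
            (Q ^ (k - ij.2.degree) * prodIdeal F (ij.1 + ij.2)) • (⊤ : Submodule A M) ≤ _) h2
          have h3 : ij.1.degree ≠ 0 := fun h => h0 ((Finsupp.degree_eq_zero_iff _).mp h)
          rw [map_add]
          omega
    exact h1 hf

end CoefficientSubmodules

/-! ### The multi-Rees module of the filtrations over the Rees algebra of the reductions -/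

section ReductionModule

variable {A : Type*} [CommRing A] {s : ℕ} {M : Type*} [AddCommGroup M] [Module A M]

/-- For adic families `c Tⁿ` is a sum of products of `|n|` homogeneous elements of degree one, each
in the irrelevant ideal. -/
theorem reesMonomial_mem_pow {Is : Fin s → Ideal A} {hIs : ∀ i, Is i ≠ ⊤} (Q : Ideal A)
    (n : Fin s →₀ ℕ) {c : A} (hc : c ∈ prodIdeal (adicFamily Is hIs) n) :
    reesMonomial n c hc ∈ multiReesIdeal (adicFamily Is hIs) Q ^ n.degree := by
  let L : (Fin s →₀ ℕ) → Ideal A := fun n => Submodule.comap (MvPolynomial.monomial n)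
    (((multiReesIdeal (adicFamily Is hIs) Q ^ n.degree).restrictScalars A).map
      (multiReesAlgebra (adicFamily Is hIs)).val.toLinearMap)
  have hL : ∀ n c, c ∈ L n ↔ ∃ r ∈ multiReesIdeal (adicFamily Is hIs) Q ^ n.degree,
      (r : MvPolynomial (Fin s) A) = MvPolynomial.monomial n c := fun n c => Iff.rfl
  have h1 : ∏ i, Is i ^ n i ≤ L n := by
    refine prod_pow_le_of_mul_le Is L ?_ (fun m n => ?_) (fun i c hc => ?_) n
    · rw [hL]
      refine ⟨1, ?_, rfl⟩
      rw [map_zero, pow_zero, Ideal.one_eq_top]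
      trivial
    · rw [Ideal.mul_le]
      intro a ha b hb
      obtain ⟨r, hr, hra⟩ := (hL m a).mp ha
      obtain ⟨t, ht, htb⟩ := (hL n b).mp hb
      rw [hL]
      refine ⟨r * t, ?_, ?_⟩
      · rw [map_add, pow_add]
        exact Ideal.mul_mem_mul hr ht
      · rw [MulMemClass.coe_mul, hra, htb, MvPolynomial.monomial_mul]
    · have hc' : c ∈ prodIdeal (adicFamily Is hIs) (Finsupp.single i 1) := by
        rw [prodIdeal_adicFamily, Finsupp.single_eq_pi_single, prod_pow_single, pow_one]
        exact hc
      rw [hL]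
      refine ⟨reesMonomial _ c hc', ?_, rfl⟩
      rw [Finsupp.degree_single, pow_one]
      refine multiReesPlus_le_multiReesIdeal _ Q ?_
      rw [mem_multiReesPlus]
      change MvPolynomial.coeff 0 (MvPolynomial.monomial _ c) = 0
      classical
      rw [MvPolynomial.coeff_monomial, if_neg]
      simp
  obtain ⟨r, hr, hrc⟩ := (hL n c).mp (h1 hc)
  have h2 : reesMonomial n c hc = r := Subtype.ext hrc.symm
  rwa [h2]

variable {Fs : Fin s → IdealFiltration A} {Is : Fin s → Ideal A}

/-- The filtrations by the powers of the members of a family of reductions. -/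
abbrev reductionFamily (hIs : ∀ i, IsReduction (Is i) (Fs i)) : Fin s → IdealFiltration A :=
  adicFamily Is fun i => (hIs i).ne_top

/-- The multi-Rees module of `Fs` as a module over the multi-Rees algebra of a family of
reductions. -/
noncomputable def reductionModule (hIs : ∀ i, IsReduction (Is i) (Fs i)) (M : Type*)
    [AddCommGroup M] [Module A M] :
    Submodule (multiReesAlgebra (reductionFamily hIs)) (MvPolynomial (Fin s) A ⊗[A] M) :=
  coeffSubmodule _ (fun n => prodIdeal Fs n • ⊤) fun m n => by
    rw [← Submodule.mul_smul]
    exact Submodule.smul_mono_left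
      ((Ideal.mul_mono_left (prod_pow_le_prodIdeal hIs m)).trans (prodIdeal_mul_le Fs m n))

theorem multiReesModule_le_reductionModule (hIs : ∀ i, IsReduction (Is i) (Fs i)) :
    multiReesModule (reductionFamily hIs) M ≤ reductionModule hIs M :=
  fun _ hx n => Submodule.smul_mono_left (prod_pow_le_prodIdeal hIs n) (hx n)

/-- Coordinate by coordinate, the excess over `Nᵢ` splits off as a power of `Iᵢ`. This one `N`
yields the finite generation, the bounded shift `|N|` and the multiplier ideal `∏ Iᵢ^{Nᵢ}`. -/
theorem exists_prodIdeal_le_mul_inf (hIs : ∀ i, IsReduction (Is i) (Fs i)) :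
    ∃ N : Fin s →₀ ℕ, ∀ n : Fin s →₀ ℕ,
      prodIdeal Fs n ≤ (∏ i, Is i ^ (n - N) i) * prodIdeal Fs ⇑(n ⊓ N) := by
  choose N hN using fun i => (hIs i).exists_ideal_add
  refine ⟨Finsupp.equivFunOnFinite.symm N, fun n => ?_⟩
  unfold prodIdeal
  rw [← Finset.prod_mul_distrib]
  refine Finset.prod_le_prod' fun i _ => ?_
  change (Fs i).ideal (n i) ≤ Is i ^ (n i - N i) * (Fs i).ideal (n i ⊓ N i)
  rcases le_total (n i) (N i) with h | h
  · rw [Nat.sub_eq_zero_of_le h, pow_zero, one_mul, inf_eq_left.mpr h]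
  · rw [inf_eq_right.mpr h, ← hN i _ _ le_rfl, Nat.add_sub_of_le h]

variable (hIs : ∀ i, IsReduction (Is i) (Fs i)) {N : Fin s →₀ ℕ}

theorem monomial_tmul_mem_pow_smul
    (hN : ∀ n : Fin s →₀ ℕ, prodIdeal Fs n ≤ (∏ i, Is i ^ (n - N) i) * prodIdeal Fs ⇑(n ⊓ N))
    (Q : Ideal A) (u : ℕ) (n : Fin s →₀ ℕ) {y : M}
    (hy : y ∈ (Q ^ u * prodIdeal Fs n) • (⊤ : Submodule A M)) :
    MvPolynomial.monomial n (1 : A) ⊗ₜ[A] y ∈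
      multiReesIdeal (reductionFamily hIs) Q ^ (u + (n - N).degree) • reductionModule hIs M := by
  let g : M →ₗ[A] MvPolynomial (Fin s) A ⊗[A] M :=
    TensorProduct.mk A (MvPolynomial (Fin s) A) M (MvPolynomial.monomial n 1)
  let Y : Submodule A M := ((multiReesIdeal (reductionFamily hIs) Q ^ (u + (n - N).degree) •
    reductionModule hIs M).restrictScalars A).comap g
  have h1 : (Q ^ u * prodIdeal Fs n) • (⊤ : Submodule A M) ≤ Y := by
    refine (Submodule.smul_mono_left (Ideal.mul_mono_right (hN n))).trans ?_
    rw [Submodule.mul_smul, Submodule.mul_smul]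
    refine Submodule.smul_le.mpr fun a ha z hz => ?_
    refine Submodule.smul_induction_on hz (fun c hc m hm => ?_) fun v w hv hw => ?_
    · change g (a • c • m) ∈ multiReesIdeal (reductionFamily hIs) Q ^ (u + (n - N).degree) •
        reductionModule hIs M
      have hc' : c ∈ prodIdeal (reductionFamily hIs) ⇑(n - N) := hc
      have hn : n - N + n ⊓ N = n := by
        ext i
        simp only [Finsupp.coe_add, Pi.add_apply, Finsupp.coe_tsub, Pi.sub_apply,
          Finsupp.inf_apply]
        omega
      have h2 : g (a • c • m) = (algebraMap A (multiReesAlgebra (reductionFamily hIs)) a *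
          reesMonomial (n - N) c hc') • (MvPolynomial.monomial (n ⊓ N) (1 : A) ⊗ₜ[A] m) := by
        rw [mul_smul, reesMonomial_smul_monomial_tmul, algebraMap_smul, map_smul, hn]
        rfl
      rw [h2, pow_add]
      refine Submodule.smul_mem_smul (Ideal.mul_mem_mul ?_ (reesMonomial_mem_pow Q _ hc')) ?_
      · refine Ideal.pow_right_mono (le_sup_left : Q.map _ ≤ _) u ?_
        rw [← Ideal.map_pow]
        exact Ideal.mem_map_of_mem _ ha
      · intro k
        rw [moduleCoeff_monomial_tmul]
        split_ifs with h
        · rw [one_smul, ← h]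
          exact hm
        · exact zero_mem _
    · rw [smul_add]
      exact add_mem hv hw
  exact h1 hy

/-- Converse of `moduleCoeff_mem_of_mem_pow_smul` up to the shift `|N|`: in degree `n` the part
`T^{n-N}` supplies `|n - N| ≥ |n| - |N|` factors of the ideal, and the power of `Q` supplies the
rest. -/
theorem mem_pow_smul_of_moduleCoeff_mem
    (hN : ∀ n : Fin s →₀ ℕ, prodIdeal Fs n ≤ (∏ i, Is i ^ (n - N) i) * prodIdeal Fs ⇑(n ⊓ N))
    (Q : Ideal A) (k : ℕ)
    {x : MvPolynomial (Fin s) A ⊗[A] M}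
    (hx : ∀ n : Fin s →₀ ℕ, moduleCoeff M n x ∈
      (Q ^ (k + N.degree - n.degree) * prodIdeal Fs n) • (⊤ : Submodule A M)) :
    x ∈ multiReesIdeal (reductionFamily hIs) Q ^ k • reductionModule hIs M := by
  obtain ⟨S, hS⟩ := exists_eq_sum_monomial_tmul x
  rw [hS]
  refine Submodule.sum_mem _ fun n _ => ?_
  have h1 := monomial_tmul_mem_pow_smul hIs hN Q _ n (hx n)
  refine Submodule.smul_mono_left (Ideal.pow_le_pow_right ?_) h1
  have h2 : n.degree ≤ (n - N).degree + N.degree := by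
    rw [← map_add]
    exact Finsupp.degree_mono le_tsub_add
  omega

theorem reductionModule_fg [IsNoetherianRing A] [Module.Finite A M]
    (hN : ∀ n : Fin s →₀ ℕ, prodIdeal Fs n ≤ (∏ i, Is i ^ (n - N) i) * prodIdeal Fs ⇑(n ⊓ N)) :
    (reductionModule hIs M).FG := by
  obtain ⟨B, hB, hmem⟩ := exists_fg_of_coeff_mem (M := M) Is (fun i => (hIs i).ne_top) N
  have := isNoetherian_of_fg_of_noetherian B hB
  have hle : reductionModule hIs M ≤ B := fun x hx => hmem x fun n =>
    Submodule.smul_mono_left ((hN n).trans Ideal.mul_le_left) (hx n)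
  exact isNoetherian_submodule.mp this _ hle

/-- The elements of `∏ Iᵢ ^ Nᵢ` map the multi-Rees module of `Fs` into the one of the reductions. -/
theorem algebraMap_smul_mem_multiReesModule
    (hN : ∀ n : Fin s →₀ ℕ, prodIdeal Fs n ≤ (∏ i, Is i ^ (n - N) i) * prodIdeal Fs ⇑(n ⊓ N))
    {a : A} (ha : a ∈ ∏ i, Is i ^ N i)
    {x : MvPolynomial (Fin s) A ⊗[A] M} (hx : x ∈ reductionModule hIs M) :
    algebraMap A (multiReesAlgebra (reductionFamily hIs)) a • x ∈
      multiReesModule (reductionFamily hIs) M := by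
  intro n
  rw [algebraMap_smul, map_smul]
  have h1 : (∏ i, Is i ^ N i) * prodIdeal Fs n ≤ prodIdeal (reductionFamily hIs) n := by
    refine (Ideal.mul_mono_right ((hN n).trans Ideal.mul_le_left)).trans ?_
    rw [prodIdeal_adicFamily, ← Finset.prod_mul_distrib]
    refine Finset.prod_le_prod' fun i _ => ?_
    rw [← pow_add]
    refine Ideal.pow_le_pow_right ?_
    rw [Finsupp.tsub_apply]
    omega
  refine (Submodule.smul_mono_left h1 : _ ≤ prodIdeal (reductionFamily hIs) n •
    (⊤ : Submodule A M)) ?_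
  rw [Submodule.mul_smul]
  exact Submodule.smul_mem_smul ha (hx n)

end ReductionModule

theorem ringKrullDim_quotient_comap_eq {R S : Type*} [CommRing R] [CommRing S] [Algebra R S]
    [Algebra.IsIntegral R S] {p : Ideal R} {P : Ideal S} (h : p = P.comap (algebraMap R S)) :
    ringKrullDim (R ⧸ p) = ringKrullDim (S ⧸ P) := by
  have : P.LiesOver p := ⟨h⟩
  have : Algebra.IsIntegral (R ⧸ p) (S ⧸ P) := inferInstance
  exact ringKrullDim_eq_of_isIntegral (FaithfulSMul.algebraMap_injective _ _)

theorem exists_eq_natCast {x : WithBot ℕ∞} (h : x ≠ ⊥) (h' : x < ⊤) : ∃ k : ℕ, x = k := by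
  induction x using WithBot.recBotCoe with
  | bot => exact absurd rfl h
  | coe x =>
    have hx : x ≠ ⊤ := fun hx => absurd h' (by rw [hx]; exact lt_irrefl _)
    obtain ⟨k, rfl⟩ := ENat.ne_top_iff_exists.mp hx
    exact ⟨k, rfl⟩

/-! ### Annihilators and dimensions of multi-Rees modules -/

section Dimension

variable {A : Type*} [CommRing A] {s : ℕ} {M : Type*} [AddCommGroup M] [Module A M]
  {F : Fin s → IdealFiltration A}

/-- Avoiding the minimal primes of `Ann M`, `a` can be cancelled in each coefficient modulo the
radical. A power of that radical lies in `Ann M`, which gives one exponent for all coefficients. -/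
theorem mem_radical_annihilator_of_mul_mem [IsNoetherianRing A]
    {N : Submodule (multiReesAlgebra F) (MvPolynomial (Fin s) A ⊗[A] M)}
    (hN : ∀ m : M, MvPolynomial.monomial 0 (1 : A) ⊗ₜ[A] m ∈ N) {a : A}
    (ha : ∀ p ∈ (Module.annihilator A M).minimalPrimes, a ∉ p) {f : multiReesAlgebra F}
    (hf : algebraMap A _ a * f ∈ (Module.annihilator (multiReesAlgebra F) N).radical) :
    f ∈ (Module.annihilator (multiReesAlgebra F) N).radical := by
  obtain ⟨k, hk⟩ := hf
  rw [mem_annihilator_iff hN] at hk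
  obtain ⟨j, hj⟩ := Ideal.exists_radical_pow_le_of_fg (Module.annihilator A M)
    (IsNoetherian.noetherian _)
  have h1 : ∀ n, (f.1 ^ k).coeff n ∈ (Module.annihilator A M).radical := by
    intro n
    refine mem_radical_of_mul_mem (a := a ^ k)
      (fun p hp h => ha p hp (hp.1.1.mem_of_pow_mem k h)) ?_
    have h2 := hk n
    have h3 : ((algebraMap A (multiReesAlgebra F) a * f) ^ k : multiReesAlgebra F).1 =
        MvPolynomial.C (a ^ k) * f.1 ^ k := by
      rw [map_pow, ← mul_pow]
      rfl
    rwa [h3, MvPolynomial.coeff_C_mul] at h2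
  have h2 : (f.1 ^ k) ^ j ∈ (Module.annihilator A M).map (MvPolynomial.C (σ := Fin s)) := by
    refine Ideal.map_mono hj ?_
    rw [Ideal.map_pow]
    exact Ideal.pow_mem_pow (MvPolynomial.mem_map_C_iff.mpr h1) j
  refine ⟨k * j, ?_⟩
  rw [mem_annihilator_iff hN]
  intro n
  have h3 : ((f ^ (k * j) : multiReesAlgebra F) : MvPolynomial (Fin s) A) = (f.1 ^ k) ^ j := by
    rw [← pow_mul]
    rfl
  rw [h3]
  exact MvPolynomial.mem_map_C_iff.mp h2 n

theorem ringKrullDim_multiReesAlgebra_lt_top [IsLocalRing A] [IsNoetherianRing A]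
    (Is : Fin s → Ideal A) (hIs : ∀ i, Is i ≠ ⊤) :
    ringKrullDim (multiReesAlgebra (adicFamily Is hIs)) < ⊤ := by
  obtain ⟨n, f, hf⟩ := Algebra.FiniteType.iff_quotient_mvPolynomial''.mp
    (inferInstance : Algebra.FiniteType A (multiReesAlgebra (adicFamily Is hIs)))
  refine (ringKrullDim_le_of_surjective f.toRingHom hf).trans_lt ?_
  rw [MvPolynomial.ringKrullDim_of_isNoetherianRing]
  obtain ⟨k, hk⟩ := exists_eq_natCast (x := ringKrullDim A)
    ringKrullDim_ne_bot ringKrullDim_lt_top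
  rw [hk]
  rw [← Nat.cast_add]
  exact WithBot.coe_lt_coe.mpr (ENat.natCast_lt_top (k + Nat.card (Fin n)))

theorem exists_supportDim_multiReesModule_eq [IsLocalRing A] [IsNoetherianRing A] [Nontrivial M]
    (Is : Fin s → Ideal A) (hIs : ∀ i, Is i ≠ ⊤) :
    ∃ d : ℕ, Module.supportDim (multiReesAlgebra (adicFamily Is hIs))
      (multiReesModule (adicFamily Is hIs) M) = d := by
  refine exists_eq_natCast ?_ ((Module.supportDim_le_ringKrullDim _ _).trans_lt
    (ringKrullDim_multiReesAlgebra_lt_top Is hIs))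
  rw [Module.supportDim_ne_bot_iff_nontrivial]
  obtain ⟨m, hm⟩ := exists_ne (0 : M)
  refine ⟨⟨_, monomial_zero_tmul_mem m⟩, 0, fun h => hm ?_⟩
  have h1 := congr_arg (moduleCoeff M 0) (congr_arg Subtype.val h)
  rw [moduleCoeff_monomial_tmul, if_pos rfl, one_smul] at h1
  simpa using h1

end Dimension

/-! ### The finite extension of multi-Rees algebras -/

section Comparison

variable {A : Type*} [CommRing A] {s : ℕ} {M : Type*} [AddCommGroup M] [Module A M]
  {Fs : Fin s → IdealFiltration A} {Is : Fin s → Ideal A}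

theorem multiReesAlgebra_reductionFamily_le (hIs : ∀ i, IsReduction (Is i) (Fs i)) :
    multiReesAlgebra (reductionFamily hIs) ≤ multiReesAlgebra Fs :=
  fun _ hf n => prod_pow_le_prodIdeal hIs n (hf n)

/-- The multi-Rees algebra of `Fs` as an algebra over the one of a family of reductions. -/
noncomputable abbrev reductionAlgebra (hIs : ∀ i, IsReduction (Is i) (Fs i)) :
    Algebra (multiReesAlgebra (reductionFamily hIs)) (multiReesAlgebra Fs) :=
  (Subalgebra.inclusion (multiReesAlgebra_reductionFamily_le hIs)).toAlgebra

theorem reductionAlgebra_isScalarTower (hIs : ∀ i, IsReduction (Is i) (Fs i)) (M : Type*)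
    [AddCommGroup M] [Module A M] :
    let := reductionAlgebra hIs
    IsScalarTower (multiReesAlgebra (reductionFamily hIs)) (multiReesAlgebra Fs)
      (MvPolynomial (Fin s) A ⊗[A] M) :=
  let := reductionAlgebra hIs
  ⟨fun r f x => mul_smul (r : MvPolynomial (Fin s) A) (f : MvPolynomial (Fin s) A) x⟩

/-- The algebra embeds into the finitely generated `reductionModule` of `M = A` by `f ↦ f ⊗ 1`. -/
theorem reductionAlgebra_finite [IsNoetherianRing A] (hIs : ∀ i, IsReduction (Is i) (Fs i)) :
    let := reductionAlgebra hIs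
    Module.Finite (multiReesAlgebra (reductionFamily hIs)) (multiReesAlgebra Fs) := by
  intro
  obtain ⟨N, hN⟩ := exists_prodIdeal_le_mul_inf hIs
  have := isNoetherian_of_fg_of_noetherian _ (reductionModule_fg (M := A) hIs hN)
  let g : multiReesAlgebra Fs →ₗ[multiReesAlgebra (reductionFamily hIs)]
      reductionModule hIs A :=
    { toFun := fun f => ⟨f.1 ⊗ₜ[A] (1 : A), fun n => by
        rw [moduleCoeff_tmul]
        exact Submodule.smul_mem_smul (f.2 n) trivial⟩
      map_add' := fun f f' => Subtype.ext (TensorProduct.add_tmul f.1 f'.1 (1 : A))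
      map_smul' := fun r f => Subtype.ext rfl }
  refine Module.Finite.of_injective g fun f f' hfg => ?_
  refine Subtype.ext (MvPolynomial.ext _ _ fun n => ?_)
  have h1 := congr_arg (moduleCoeff A n) (congr_arg Subtype.val hfg)
  change moduleCoeff A n (f.1 ⊗ₜ[A] (1 : A)) = moduleCoeff A n (f'.1 ⊗ₜ[A] (1 : A)) at h1
  simpa only [moduleCoeff_tmul, smul_eq_mul, mul_one] using h1

theorem multiReesModule_fg [IsNoetherianRing A] [Module.Finite A M]
    (hIs : ∀ i, IsReduction (Is i) (Fs i)) : (multiReesModule Fs M).FG := by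
  let := reductionAlgebra hIs
  have := reductionAlgebra_isScalarTower hIs M
  obtain ⟨N, hN⟩ := exists_prodIdeal_le_mul_inf hIs
  exact Submodule.FG.of_restrictScalars (multiReesAlgebra (reductionFamily hIs))
    (reductionModule_fg hIs hN)

/-- The annihilator on one side is the contraction of the other, and the extension is integral. -/
theorem supportDim_multiReesModule_eq [IsNoetherianRing A] [Module.Finite A M]
    (hIs : ∀ i, IsReduction (Is i) (Fs i)) :
    Module.supportDim (multiReesAlgebra Fs) (multiReesModule Fs M) =
      Module.supportDim (multiReesAlgebra (reductionFamily hIs))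
        (multiReesModule (reductionFamily hIs) M) := by
  let := reductionAlgebra hIs
  have := reductionAlgebra_finite hIs
  have : Module.Finite (multiReesAlgebra Fs) (multiReesModule Fs M) :=
    Module.Finite.iff_fg.mpr (multiReesModule_fg hIs)
  have : Module.Finite (multiReesAlgebra (reductionFamily hIs))
      (multiReesModule (reductionFamily hIs) M) :=
    Module.Finite.iff_fg.mpr (multiReesModule_fg fun i => isReduction_adic (hIs i).ne_top)
  rw [Module.supportDim_eq_ringKrullDim_quotient_annihilator,
    Module.supportDim_eq_ringKrullDim_quotient_annihilator]
  refine (ringKrullDim_quotient_comap_eq ?_).symm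
  ext f
  rw [mem_annihilator_iff monomial_zero_tmul_mem, Ideal.mem_comap,
    mem_annihilator_iff monomial_zero_tmul_mem]
  rfl

end Comparison

/-! ### Multiplicities of nested submodules -/

section Transfer

variable {R : Type*} [CommRing R] {T : Type*} [AddCommGroup T] [Module R T]

theorem relLength_top_submoduleOf (U V : Submodule R T) :
    relLength ⊤ (V.submoduleOf U) = relLength U V := by
  rw [← relLength_map_of_injective U.subtype U.subtype_injective, Submodule.map_subtype_top,
    Submodule.submoduleOf, Submodule.map_comap_subtype, relLength_inf]

theorem relLength_submoduleOf_pow_smul {U V : Submodule R T} (h : V ≤ U) (𝔠 : Ideal R) :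
    relLength (V.submoduleOf U) (𝔠 • V.submoduleOf U) = relLength V (𝔠 • V) := by
  rw [← relLength_map_of_injective U.subtype U.subtype_injective, Submodule.map_smul'',
    Submodule.submoduleOf, Submodule.map_comap_subtype, inf_eq_right.mpr h]

/-- `a` kills the quotient but is regular modulo the radical of `Ann N₁`, which costs one dimension.
-/
theorem supportDim_submoduleOf_quotient_add_one_le {N₀ N₁ : Submodule R T} [Module.Finite R N₁]
    {a : R} (ha : ∀ x ∈ N₁, a • x ∈ N₀)
    (hreg : ∀ f, a * f ∈ (Module.annihilator R N₁).radical →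
      f ∈ (Module.annihilator R N₁).radical) :
    Module.supportDim R (N₁ ⧸ N₀.submoduleOf N₁) + 1 ≤ Module.supportDim R N₁ := by
  refine supportDim_add_one_le
    (LinearMap.annihilator_le_of_surjective (Submodule.mkQ _) (Submodule.mkQ_surjective _))
    (a := a) ?_ hreg
  rw [Module.mem_annihilator]
  intro x
  obtain ⟨x, rfl⟩ := Submodule.Quotient.mk_surjective _ x
  rw [← Submodule.Quotient.mk_smul, Submodule.Quotient.mk_eq_zero]
  exact ha x x.2

theorem supportDim_eq_of_annihilator_eq {N₀ N₁ : Submodule R T} [Module.Finite R N₀]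
    [Module.Finite R N₁] (h : Module.annihilator R N₀ = Module.annihilator R N₁) :
    Module.supportDim R N₁ = Module.supportDim R N₀ := by
  rw [Module.supportDim_eq_ringKrullDim_quotient_annihilator,
    Module.supportDim_eq_ringKrullDim_quotient_annihilator, h]

/-- A version of `exists_tendsto_relLength` for submodules of a module. -/
theorem exists_tendsto_relLength_of_le [IsNoetherianRing R] (𝔪 𝔞 : Ideal R) [𝔪.IsMaximal] {c : ℕ}
    (hc : 𝔪 ^ c ≤ 𝔞) (h𝔞 : 𝔞 ≠ ⊤) {N₀ N₁ : Submodule R T} (hle : N₀ ≤ N₁) (hfg : N₁.FG)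
    (hann : Module.annihilator R N₀ = Module.annihilator R N₁) {a : R}
    (ha : ∀ x ∈ N₁, a • x ∈ N₀)
    (hreg : ∀ f, a * f ∈ (Module.annihilator R N₁).radical →
      f ∈ (Module.annihilator R N₁).radical) {d : ℕ} (hd : Module.supportDim R N₀ = d)
    (W : ℕ → Submodule R T) (c' : ℕ) (hW : ∀ n, 𝔞 ^ n • N₁ ≤ W n)
    (hW' : ∀ n, W (n + c') ≤ 𝔞 ^ n • N₁) :
    ∃ (l₀ l₁ : ℕ → ℕ) (e : ℝ), (∀ n, relLength N₀ (𝔞 ^ n • N₀) = l₀ n) ∧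
      (∀ n, relLength N₁ (W n) = l₁ n) ∧
      Filter.Tendsto (fun n => (d ! : ℝ) * (l₀ n : ℝ) / (n : ℝ) ^ d) Filter.atTop (nhds e) ∧
      Filter.Tendsto (fun n => (d ! : ℝ) * (l₁ n : ℝ) / (n : ℝ) ^ d) Filter.atTop (nhds e) := by
  have := isNoetherian_of_fg_of_noetherian N₁ hfg
  have : Module.Finite R N₀ := Module.Finite.iff_fg.mpr (isNoetherian_submodule.mp this _ hle)
  have h1 := supportDim_eq_of_annihilator_eq hann
  obtain ⟨l₀, l₁, e, hl₀, hl₁, he₀, he₁⟩ := exists_tendsto_relLength 𝔪 𝔞 hc h𝔞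
    (N₀.submoduleOf N₁) (d := d)
    (by rw [Module.supportDim_eq_of_equiv (Submodule.submoduleOfEquivOfLe hle), hd])
    (by
      rw [← hd, ← h1]
      exact supportDim_submoduleOf_quotient_add_one_le ha hreg)
    (fun n => (W n).submoduleOf N₁) c'
    (fun n => by
      refine Submodule.map_le_iff_le_comap.mp ?_
      rw [Submodule.map_smul'', Submodule.map_subtype_top]
      exact hW n)
    (fun n x hx => by
      rw [Submodule.mem_smul_top_iff]
      exact hW' n hx)
  refine ⟨l₀, l₁, e, fun n => ?_, fun n => ?_, he₀, he₁⟩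
  · rw [← hl₀, relLength_submoduleOf_pow_smul hle]
  · rw [← hl₁, relLength_top_submoduleOf]

end Transfer

/-! ### Equality of multiplicities of multi-Rees modules -/

section Multiplicity

variable {A : Type*} [CommRing A] {s : ℕ} {M : Type*} [AddCommGroup M] [Module A M]
  {Fs : Fin s → IdealFiltration A} {Is : Fin s → Ideal A}

/-- Positive height means that no minimal prime of `Ann M` contains `∏ (Fᵢ)₁`. A prime containing `∏
Iᵢ^{Nᵢ}` would contain it, so prime avoidance applies. -/
theorem exists_mem_prod_pow_forall_notMem [IsNoetherianRing A]
    (hIs : ∀ i, IsReduction (Is i) (Fs i)) (N : Fin s → ℕ)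
    (hht : 0 < (((∏ i, (Fs i).ideal 1) ⊔ Module.annihilator A M).map
      (Ideal.Quotient.mk (Module.annihilator A M))).height) :
    ∃ a ∈ ∏ i, Is i ^ N i, ∀ p ∈ (Module.annihilator A M).minimalPrimes, a ∉ p := by
  refine exists_mem_forall_notMem_minimalPrimes fun p hp hle => not_le_of_height_pos hht p hp ?_
  have hpp : p.IsPrime := hp.1.1
  obtain ⟨k, hk⟩ := exists_prodIdeal_one_pow_le hIs
  have h1 : (∏ i, Is i) ^ Finset.univ.sup N ≤ ∏ i, Is i ^ N i := by
    rw [← Finset.prod_pow]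
    exact Finset.prod_le_prod' fun i _ =>
      Ideal.pow_le_pow_right (Finset.le_sup (Finset.mem_univ i))
  exact hpp.le_of_pow_le (hk.trans (hpp.le_of_pow_le (h1.trans hle)))

theorem annihilator_multiReesModule_eq (hIs : ∀ i, IsReduction (Is i) (Fs i)) :
    Module.annihilator (multiReesAlgebra (reductionFamily hIs))
        (multiReesModule (reductionFamily hIs) M) =
      Module.annihilator (multiReesAlgebra (reductionFamily hIs)) (reductionModule hIs M) := by
  ext f
  rw [mem_annihilator_iff monomial_zero_tmul_mem,
    mem_annihilator_iff (N := reductionModule hIs M) monomial_zero_tmul_mem]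

theorem pow_smul_reductionModule_le (hIs : ∀ i, IsReduction (Is i) (Fs i)) (Q : Ideal A) (n : ℕ)
    {x : MvPolynomial (Fin s) A ⊗[A] M}
    (hx : x ∈ multiReesIdeal (reductionFamily hIs) Q ^ n • reductionModule hIs M) :
    x ∈ multiReesIdeal Fs Q ^ n • multiReesModule Fs M := by
  let i := Subalgebra.inclusion (multiReesAlgebra_reductionFamily_le hIs)
  have hideal : multiReesIdeal (reductionFamily hIs) Q ≤ (multiReesIdeal Fs Q).comap i :=
    fun f hf => by
      have h : f.1.coeff 0 ∈ Q := mem_multiReesIdeal.mp hf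
      rw [Ideal.mem_comap]
      exact mem_multiReesIdeal.mpr h
  refine Submodule.smul_induction_on hx (fun r hr y hy => ?_) fun y z hy hz => add_mem hy hz
  have h1 : i r ∈ multiReesIdeal Fs Q ^ n :=
    (Ideal.le_comap_pow _ n) (Ideal.pow_right_mono hideal n hr)
  have h2 : i r • y ∈ multiReesIdeal Fs Q ^ n • multiReesModule Fs M :=
    Submodule.smul_mem_smul h1 hy
  exact h2

theorem relLength_restrictScalars_reductionAlgebra (hIs : ∀ i, IsReduction (Is i) (Fs i))
    {U V : Submodule (multiReesAlgebra Fs) (MvPolynomial (Fin s) A ⊗[A] M)} (hVU : V ≤ U) (n : ℕ)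
    (h : multiReesPlus Fs ^ n • U ≤ V) :
    let := reductionAlgebra hIs
    let := reductionAlgebra_isScalarTower hIs M
    relLength (U.restrictScalars (multiReesAlgebra (reductionFamily hIs)))
      (V.restrictScalars (multiReesAlgebra (reductionFamily hIs))) = relLength U V := by
  intro _ _
  refine relLength_restrictScalars (multiReesPlus Fs) (fun x => ?_) n hVU h
  obtain ⟨f, rfl⟩ := Ideal.Quotient.mk_surjective x
  obtain ⟨a, ha⟩ := exists_sub_algebraMap_mem_multiReesPlus f
  exact ⟨algebraMap A _ a, (Ideal.Quotient.eq.mpr ha).symm⟩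

theorem exists_isMultiplicity [IsLocalRing A] [IsNoetherianRing A] [Module.Finite A M]
    [Nontrivial M] (hIs : ∀ i, IsReduction (Is i) (Fs i)) {Q : Ideal A} (hQ : IsMPrimary Q)
    (hht : 0 < (((∏ i, (Fs i).ideal 1) ⊔ Module.annihilator A M).map
      (Ideal.Quotient.mk (Module.annihilator A M))).height) :
    ∃ e : ℝ, IsMultiplicity (multiReesIdeal Fs Q) (multiReesModule Fs M) e ∧
      IsMultiplicity (multiReesIdeal (reductionFamily hIs) Q)
        (multiReesModule (reductionFamily hIs) M) e := by
  obtain ⟨N, hN⟩ := exists_prodIdeal_le_mul_inf hIs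
  obtain ⟨d, hd⟩ := exists_supportDim_multiReesModule_eq (M := M) Is fun i => (hIs i).ne_top
  obtain ⟨c, hc⟩ := hQ.exists_pow_le
  let := reductionAlgebra hIs
  have := reductionAlgebra_isScalarTower hIs M
  have hmax := multiReesIdeal_isMaximal (reductionFamily hIs) (IsLocalRing.maximalIdeal A)
  obtain ⟨a, ha, hap⟩ := exists_mem_prod_pow_forall_notMem (M := M) hIs N hht
  -- The filtration whose lengths define the multiplicity over the larger algebra; over the smaller
  -- one it is adic up to the shift `N.degree`.
  let W : ℕ → Submodule (multiReesAlgebra Fs) (MvPolynomial (Fin s) A ⊗[A] M) := fun n =>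
    multiReesIdeal Fs Q ^ n • multiReesModule Fs M
  obtain ⟨l₀, l₁, e, hl₀, hl₁, he₀, he₁⟩ := exists_tendsto_relLength_of_le _
    (multiReesIdeal (reductionFamily hIs) Q) (multiReesIdeal_pow_le (reductionFamily hIs) hc)
    (multiReesIdeal_ne_top hQ.1.1) (multiReesModule_le_reductionModule hIs)
    (reductionModule_fg hIs hN) (annihilator_multiReesModule_eq hIs)
    (fun x hx => algebraMap_smul_mem_multiReesModule hIs hN ha hx)
    (fun f hf => mem_radical_annihilator_of_mul_mem (N := reductionModule hIs M)
      monomial_zero_tmul_mem hap hf) hd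
    (fun n => (W n).restrictScalars _) N.degree
    (fun n x hx => pow_smul_reductionModule_le hIs Q n hx)
    (fun n x hx => mem_pow_smul_of_moduleCoeff_mem hIs hN Q n fun k =>
      moduleCoeff_mem_of_mem_pow_smul Q (n + N.degree) hx k)
  refine ⟨e, ⟨d, l₁, (supportDim_multiReesModule_eq hIs).trans hd, fun n => ?_, he₁⟩,
    ⟨d, l₀, hd, fun n => ?_, he₀⟩⟩
  · have h₁ := relLength_top (A := multiReesAlgebra Fs) (M := multiReesModule Fs M)
      (multiReesIdeal Fs Q ^ n • ⊤)
    have h₂ := relLength_smul_eq_top (multiReesModule Fs M) (multiReesIdeal Fs Q ^ n)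
    have h₃ := relLength_restrictScalars_reductionAlgebra hIs (V := W n)
      Submodule.smul_le_right n (Submodule.smul_mono_left
        (Ideal.pow_right_mono (multiReesPlus_le_multiReesIdeal Fs Q) n))
    exact h₁.symm.trans (h₂.symm.trans (h₃.symm.trans (hl₁ n)))
  · rw [← hl₀, relLength_smul_eq_top, relLength_top]

end Multiplicity

end MixedMult
theorem theorem2p3 {A : Type*} [CommRing A] [IsLocalRing A] [IsNoetherianRing A]
    (M : Type*) [AddCommGroup M] [Module A M] [Module.Finite A M]
    (s : ℕ) (hs : 0 < s)
    (F : MixedMult.IdealFiltration A) (hF : MixedMult.IsGood F)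
    (hFm : MixedMult.IsMPrimary (F.ideal 1))
    (Fs : Fin s → MixedMult.IdealFiltration A) (hFs : ∀ i, MixedMult.IsGood (Fs i))
    (hI : ¬ (∏ i, (Fs i).ideal 1) ≤ (Module.annihilator A M).radical)
    (J : Ideal A) (hJ : MixedMult.IsReduction J F)
    (Is : Fin s → Ideal A) (hIs : ∀ i, MixedMult.IsReduction (Is i) (Fs i))
    (Q : Ideal A) (hQ : MixedMult.IsMPrimary Q) :
    (∀ (k₀ : ℕ) (k : Fin s → ℕ),
      ((k₀ + ∑ i, k i + 1 : ℕ) : WithBot ℕ∞) = MixedMult.mixedDim Fs M →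
        ∃ e : ℚ, MixedMult.IsMixedMultiplicity F Fs M k₀ k e ∧
          MixedMult.IsMixedMultiplicity (MixedMult.adic J hJ.ne_top)
            (fun i => MixedMult.adic (Is i) (hIs i).ne_top) M k₀ k e) ∧
    (0 < (((∏ i, (Fs i).ideal 1) ⊔ Module.annihilator A M).map
        (Ideal.Quotient.mk (Module.annihilator A M))).height →
      ∃ e : ℝ,
        MixedMult.IsMultiplicity (MixedMult.multiReesIdeal Fs Q)
          (MixedMult.multiReesModule Fs M) e ∧
        MixedMult.IsMultiplicity
          (MixedMult.multiReesIdeal (fun i => MixedMult.adic (Is i) (hIs i).ne_top) Q)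
          (MixedMult.multiReesModule (fun i => MixedMult.adic (Is i) (hIs i).ne_top) M) e) := by
  refine ⟨fun k₀ k hk => MixedMult.exists_isMixedMultiplicity hFm hJ hIs k₀ k hk, fun hht => ?_⟩
  -- For `M = 0` the dimension would be `⊥`, and no natural number could serve as `d`.
  have : Nontrivial M := by
    by_contra h
    rw [not_nontrivial_iff_subsingleton] at h
    refine hI ?_
    rw [Module.annihilator_eq_top_iff.mpr h, Ideal.radical_top]
    exact le_top
  exact MixedMult.exists_isMultiplicity hIs hQ hht
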